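/- **Model.** A \emph{task graph} is a finite simple directed acyclic graph $G=(V,E)$ with edge costs $c(u,v)\ge 0$, a start $s$ and an end $t$ reachable from $s$. Write $c(v\to t)$ for the cost of a cheapest path from $v$ to $t$ ($+\infty$ if there is none). An agent with bias $b>1$ at a vertex $u\ne t$ moves along an edge $(u,v)$ that minimizes the \emph{perceived cost} $b\,c(u,v)+c(v\to t)$, and continues until it is at $t$. An \emph{$l$-chunking} ($l\ge 1$) of an edge $(u,v)$ replaces it by a path $u=u_1,u_2,\dots,u_l,u_{l+1}=v$ with edge costs $x_1,\dots,x_l\ge 0$, $\sum_i x_i=c(u,v)$, where each new vertex $u_2,\dots,u_l$ also keeps all the other edges (to the same task vertices and with the same costs) that $u$ had in $G$. Among edges of equal perceived cost the agent takes the one that lies on a chunked path if exactly one of them does, and otherwise the first one in a fixed order of $V$ (the vertices of a chunked edge $(u,v)$ having the place of $v$). The \emph{bottleneck} of a chunking is the maximum over $i$ of the perceived cost of starting with $(u_i,u_{i+1})$, and an $l$-chunking is \emph{optimal} if its bottleneck is the smallest among all $l$-chunkings of the edge. A \emph{configuration} leaves each edge unchunked or fixes a chunking of it. It uses $k$ chunks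 if $k$ is the sum, over the chunked edges, of the numbers of their chunks; unchunked edges use none. A configuration is \emph{optimal for the budget $k$} if it uses at most $k$ chunks and, among all configurations that do, makes the cost that the agent incurs from $s$ to $t$ in the chunked graph as small as possible. **Theorem.** On a real RAM with unit-cost operations: 1. There is an algorithm (an \emph{edge-chunking algorithm}) which, given $b$, $l\ge 1$, the cost $c(u,v)$ of an edge from whose head $v$ the end $t$ is reachable, and the precomputed numbers $c(u\to t)$ and $c(v\to t)$, returns an optimal $l$-chunking of $(u,v)$ and its bottleneck in $O(l)$ time. 2. There is an algorithm which, given any task graph $G=(V,E)$ (as a list of edges with their costs), any bias $b>1$ and any global budget $k\ge 2$, and with any such edge-chunking algorithm as a subroutine, computes a configuration that is optimal for the budget $k$ with $O(|E|\log k)$ calls of the subroutine, in total time $O(|E|\,k\log k+|V|)$, the time of the calls included. The constant of the number of calls is absolute; that of the total time depends only on the subroutine used. -/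

import Mathlib

/-! ## Weighted directed graphs and present-biased agents -/

/-- A directed graph with vertices `V` and edges `E`; every edge carries a real cost. -/
structure WDigraph (V E : Type) where
  src : E → V
  dst : E → V
  cost : E → ℝ

namespace WDigraph

variable {V E : Type}

/-- `G.IsWalk u p v`: the list of edges `p` is a directed walk from `u` to `v`. -/
def IsWalk (G : WDigraph V E) : V → List E → V → Prop
  | u, [], v => u = v
  | u, e :: p, v => G.src e = u ∧ G.IsWalk (G.dst e) p v

/-- Total cost of a list of edges. -/
def walkCost (G : WDigraph V E) (p : List E) : ℝ := (p.map G.cost).sum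

def Reaches (G : WDigraph V E) (u v : V) : Prop := ∃ p, G.IsWalk u p v

/-- `c(u → v)`: cost of a cheapest walk from `u` to `v`
(only used where `v` is reachable from `u` and costs are nonnegative). -/
noncomputable def dist (G : WDigraph V E) (u v : V) : ℝ :=
  sInf {c | ∃ p, G.IsWalk u p v ∧ G.walkCost p = c}

def Acyclic (G : WDigraph V E) : Prop := ∀ v p, G.IsWalk v p v → p = []

/-- Perceived cost, for bias `b` and target `t`, of starting with the edge `e` and then following
a cheapest path to `t`. -/
noncomputable def perceived (G : WDigraph V E) (b : ℝ) (t : V) (e : E) : ℝ :=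
  b * G.cost e + G.dist (G.dst e) t

/-- The options of an agent at `v`: edges out of `v` after which `t` can still be reached (starting
with any other edge has infinite perceived cost). -/
def options (G : WDigraph V E) (t v : V) : Set E := {e | G.src e = v ∧ G.Reaches (G.dst e) t}

/-- The options of least perceived cost. -/
def best (G : WDigraph V E) (b : ℝ) (t v : V) : Set E :=
  {e | e ∈ G.options t v ∧ ∀ f ∈ G.options t v, G.perceived b t e ≤ G.perceived b t f}

/-- The agent at `v` picks the edge `e`: it has least perceived cost, and among tied edges the agent
takes the one that belongs to a chunked path if exactly one of them does, and otherwise the one that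
comes first in the order given by `rank`. -/
def Picks (G : WDigraph V E) (b : ℝ) (t : V) (chunked : E → Prop) (rank : E → ℕ)
    (v : V) (e : E) : Prop :=
  e ∈ G.best b t v ∧
    ((chunked e ∧ ∀ f ∈ G.best b t v, chunked f → f = e) ∨
      ((¬ ∃! f, f ∈ G.best b t v ∧ chunked f) ∧ ∀ f ∈ G.best b t v, rank e ≤ rank f))

/-- `p` is the complete route of the agent from `v`, which ends when the agent is at `t`. -/
def AgentRoute (G : WDigraph V E) (b : ℝ) (t : V) (chunked : E → Prop) (rank : E → ℕ) :
    V → List E → Prop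
  | v, [] => v = t
  | v, e :: p =>
      v ≠ t ∧ G.Picks b t chunked rank v e ∧ G.AgentRoute b t chunked rank (G.dst e) p

end WDigraph

/-- A task graph with `n` vertices and `m` edges: a simple directed acyclic graph with nonnegative
edge costs, a start `s` and an end `t` that can be reached from `s`. -/
structure TaskGraph (n m : ℕ) extends WDigraph (Fin n) (Fin m) where
  s : Fin n
  t : Fin n
  simple : ∀ e f, src e = src f → dst e = dst f → e = f
  cost_nonneg : ∀ e, 0 ≤ cost e
  acyclic : toWDigraph.Acyclic
  reaches : toWDigraph.Reaches s t

/-! ## Chunking -/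

/-- A chunking configuration: the list of chunk costs of every edge. The empty list means that the
edge is left unchunked; it then uses no chunk. -/
abbrev ChunkConfig (m : ℕ) := Fin m → List ℝ

/-- `xs` is a chunking of an edge of cost `c` into `l` chunks. -/
def IsChunking (c : ℝ) (l : ℕ) (xs : List ℝ) : Prop :=
  xs.length = l ∧ (∀ x ∈ xs, 0 ≤ x) ∧ xs.sum = c

/-- Vertices of the chunked graph: the task vertices, and for an edge `e = (u, v)` that is split into
`l` chunks the vertices `(e, i)`, `1 ≤ i < l`, at which exactly `i` chunks of `e` are completed.
(The pairs `(e, i)` with other `i` are not reachable from any other vertex and play no role.) -/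
abbrev ChunkVertex (n m : ℕ) := Fin n ⊕ (Fin m × ℕ)

namespace TaskGraph

variable {n m : ℕ}

/-- The task vertex whose outgoing edges are on offer at `x`. -/
def home (G : TaskGraph n m) : ChunkVertex n m → Fin n
  | Sum.inl u => u
  | Sum.inr (e, _) => G.src e

/-- The vertex at which `i` chunks of `e` are completed. -/
def chunkPoint (G : TaskGraph n m) (cfg : ChunkConfig m) (e : Fin m) (i : ℕ) : ChunkVertex n m :=
  if i < (cfg e).length then Sum.inr (e, i) else Sum.inl (G.dst e)

/-- Edges of the chunked graph: at the vertex `x`, proceed along the edge `e` of the task graph. -/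
abbrev ChunkEdge (G : TaskGraph n m) := {p : ChunkVertex n m × Fin m // G.src p.2 = G.home p.1}

/-- The graph obtained from `G` by splitting every edge `e` with `cfg e ≠ []` into the chunks
`cfg e`. At a task vertex `u`, an unchunked edge is kept, and a chunked one is replaced by its first
chunk. At an inner vertex of the chunked edge `e = (u, v)`, one can go on with the next chunk of `e`,
or leave by any other edge that `u` had in `G`. -/
def chunkedGraph (G : TaskGraph n m) (cfg : ChunkConfig m) :
    WDigraph (ChunkVertex n m) G.ChunkEdge where
  src p := p.1.1
  dst p :=
    match p.1 with
    | (Sum.inl _, e) => G.chunkPoint cfg e 1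
    | (Sum.inr (e₀, i), e) => if e = e₀ then G.chunkPoint cfg e (i + 1) else Sum.inl (G.dst e)
  cost p :=
    match p.1 with
    | (Sum.inl _, e) => (cfg e).getD 0 (G.cost e)
    | (Sum.inr (e₀, i), e) => if e = e₀ then (cfg e).getD i 0 else G.cost e

/-- The edges of the chunked graph that are chunks. -/
def IsChunkEdge (G : TaskGraph n m) (cfg : ChunkConfig m) (p : G.ChunkEdge) : Prop :=
  match p.1 with
  | (Sum.inl _, e) => cfg e ≠ []
  | (Sum.inr (e₀, _), e) => e = e₀

/-- Order in which ties are broken: the order of the vertices of `G`, where the vertices of a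
chunked edge `(u, v)` have the place of `v`. -/
def tieRank (G : TaskGraph n m) (p : G.ChunkEdge) : ℕ := (G.dst p.1.2 : ℕ)

/-- The route from `s` to `t` of the agent of bias `b` in the graph chunked by `cfg`. -/
def IsRoute (G : TaskGraph n m) (b : ℝ) (cfg : ChunkConfig m) (p : List G.ChunkEdge) : Prop :=
  (G.chunkedGraph cfg).AgentRoute b (Sum.inl G.t) (G.IsChunkEdge cfg) G.tieRank (Sum.inl G.s) p

/-- `cfg` uses at most `k` chunks altogether. -/
def Admissible (G : TaskGraph n m) (k : ℕ) (cfg : ChunkConfig m) : Prop :=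
  (∀ e, cfg e ≠ [] → IsChunking (G.cost e) (cfg e).length (cfg e)) ∧ ∑ e, (cfg e).length ≤ k

/-- `cfg` is an optimal configuration for the global budget `k`: no configuration with at most `k`
chunks altogether makes the agent of bias `b` incur a smaller cost from `s` to `t`. -/
def IsOptimalConfig (G : TaskGraph n m) (b : ℝ) (k : ℕ) (cfg : ChunkConfig m) : Prop :=
  G.Admissible k cfg ∧ ∃ p, G.IsRoute b cfg p ∧
    ∀ cfg' p', G.Admissible k cfg' → G.IsRoute b cfg' p' →
      (G.chunkedGraph cfg).walkCost p ≤ (G.chunkedGraph cfg').walkCost p'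

/-- The configuration in which only `e` is chunked, into the chunks `xs`. -/
def chunkOnly (e : Fin m) (xs : List ℝ) : ChunkConfig m := Function.update (fun _ => []) e xs

/-- The `i`-th chunk of `e` (counted from `0`) as an edge of the chunked graph. -/
def chunkEdge (G : TaskGraph n m) (e : Fin m) (i : ℕ) : G.ChunkEdge :=
  if i = 0 then ⟨(Sum.inl (G.src e), e), rfl⟩ else ⟨(Sum.inr (e, i), e), rfl⟩

/-- The bottleneck of the chunking `xs` of `e`: the largest perceived cost of starting with one of
the chunks. -/
noncomputable def bottleneck (G : TaskGraph n m) (b : ℝ) (e : Fin m) (xs : List ℝ) : ℝ :=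
  ⨆ i : Fin xs.length,
    (G.chunkedGraph (chunkOnly e xs)).perceived b (Sum.inl G.t) (G.chunkEdge e i)

/-- `xs` is an optimal `l`-chunking of `e`, that is, an `l`-chunking with the smallest bottleneck. -/
def IsOptimalChunking (G : TaskGraph n m) (b : ℝ) (e : Fin m) (l : ℕ) (xs : List ℝ) : Prop :=
  IsChunking (G.cost e) l xs ∧
    ∀ ys, IsChunking (G.cost e) l ys → G.bottleneck b e xs ≤ G.bottleneck b e ys

end TaskGraph

/-! ## A real RAM with a step count

Programs work on finitely many natural and real variables and arrays. Natural numbers can be added,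
subtracted and halved, reals can be added, subtracted, multiplied and divided, both can be compared.
There is no multiplication of naturals and no rounding of reals. Every operation takes one step. -/

/-- Memory: natural and real variables, natural and real arrays. -/
structure Store where
  nat : ℕ → ℕ
  real : ℕ → ℝ
  natArr : ℕ → ℕ → ℕ
  realArr : ℕ → ℕ → ℝ

inductive NExp where
  | lit (c : ℕ)
  | var (x : ℕ)
  | get (a : ℕ) (i : NExp)
  | add (e f : NExp)
  | sub (e f : NExp)
  | half (e : NExp)

inductive RExp where
  | ofNat (e : NExp)
  | var (x : ℕ)
  | get (a : ℕ) (i : NExp)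
  | add (e f : RExp)
  | sub (e f : RExp)
  | mul (e f : RExp)
  | div (e f : RExp)

inductive BExp where
  | natLe (e f : NExp)
  | realLe (e f : RExp)
  | not (c : BExp)
  | and (c d : BExp)

/-- Commands. `call b x du dv l r a` calls the subroutine with the real arguments `b, x, du, dv` and
the natural argument `l`, and stores the real and the real array that it returns as the variable `r`
and the array `a`. -/
inductive Cmd where
  | skip
  | setNat (x : ℕ) (e : NExp)
  | setReal (x : ℕ) (e : RExp)
  | putNat (a : ℕ) (i e : NExp)
  | putReal (a : ℕ) (i : NExp) (e : RExp)
  | seq (p q : Cmd)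
  | ite (c : BExp) (p q : Cmd)
  | loop (c : BExp) (p : Cmd)
  | call (b x du dv : RExp) (l : NExp) (r a : ℕ)

def NExp.eval (σ : Store) : NExp → ℕ
  | lit c => c
  | var x => σ.nat x
  | get a i => σ.natArr a (i.eval σ)
  | add e f => e.eval σ + f.eval σ
  | sub e f => e.eval σ - f.eval σ
  | half e => e.eval σ / 2

noncomputable def RExp.eval (σ : Store) : RExp → ℝ
  | ofNat e => (e.eval σ : ℝ)
  | var x => σ.real x
  | get a i => σ.realArr a (i.eval σ)
  | add e f => e.eval σ + f.eval σ
  | sub e f => e.eval σ - f.eval σ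
  | mul e f => e.eval σ * f.eval σ
  | div e f => e.eval σ / f.eval σ

def BExp.Holds (σ : Store) : BExp → Prop
  | natLe e f => e.eval σ ≤ f.eval σ
  | realLe e f => e.eval σ ≤ f.eval σ
  | not c => ¬ c.Holds σ
  | and c d => c.Holds σ ∧ d.Holds σ

/-- Number of steps that the evaluation of an expression takes. -/
def NExp.size : NExp → ℕ
  | lit _ => 1
  | var _ => 1
  | get _ i => i.size + 1
  | add e f => e.size + f.size + 1
  | sub e f => e.size + f.size + 1
  | half e => e.size + 1

def RExp.size : RExp → ℕ
  | ofNat e => e.size + 1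
  | var _ => 1
  | get _ i => i.size + 1
  | add e f => e.size + f.size + 1
  | sub e f => e.size + f.size + 1
  | mul e f => e.size + f.size + 1
  | div e f => e.size + f.size + 1

def BExp.size : BExp → ℕ
  | natLe e f => e.size + f.size + 1
  | realLe e f => e.size + f.size + 1
  | not c => c.size + 1
  | and c d => c.size + d.size + 1

namespace Store

def setNat (σ : Store) (x v : ℕ) : Store := { σ with nat := Function.update σ.nat x v }

def setReal (σ : Store) (x : ℕ) (v : ℝ) : Store := { σ with real := Function.update σ.real x v }

def putNat (σ : Store) (a i v : ℕ) : Store :=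
  { σ with natArr := Function.update σ.natArr a (Function.update (σ.natArr a) i v) }

def putReal (σ : Store) (a i : ℕ) (v : ℝ) : Store :=
  { σ with realArr := Function.update σ.realArr a (Function.update (σ.realArr a) i v) }

def setRealArr (σ : Store) (a : ℕ) (v : ℕ → ℝ) : Store :=
  { σ with realArr := Function.update σ.realArr a v }

/-- Initial memory of a subroutine: its arguments, and zeros elsewhere. -/
noncomputable def args (b x du dv : ℝ) (l : ℕ) : Store where
  nat i := if i = 0 then l else 0
  real i := if i = 0 then b else if i = 1 then x else if i = 2 then du else if i = 3 then dv else 0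
  natArr _ _ := 0
  realArr _ _ := 0

end Store

/-- `Run sub p σ σ' time calls`: the program `p`, started on the memory `σ`, halts with the memory
`σ'` after `time` steps, in the course of which it makes `calls` calls of the subroutine. Here
`sub τ τ' t` says that the subroutine, started on its own memory `τ`, halts with the memory `τ'` after
`t` steps, which count as steps of the caller. The subroutine returns its real variable `0` and, by
reference, its real array `0`. -/
inductive Run (sub : Store → Store → ℕ → Prop) : Cmd → Store → Store → ℕ → ℕ → Prop
  | skip (σ : Store) : Run sub .skip σ σ 1 0
  | setNat (σ : Store) (x : ℕ) (e : NExp) :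
      Run sub (.setNat x e) σ (σ.setNat x (e.eval σ)) (1 + e.size) 0
  | setReal (σ : Store) (x : ℕ) (e : RExp) :
      Run sub (.setReal x e) σ (σ.setReal x (e.eval σ)) (1 + e.size) 0
  | putNat (σ : Store) (a : ℕ) (i e : NExp) :
      Run sub (.putNat a i e) σ (σ.putNat a (i.eval σ) (e.eval σ)) (1 + i.size + e.size) 0
  | putReal (σ : Store) (a : ℕ) (i : NExp) (e : RExp) :
      Run sub (.putReal a i e) σ (σ.putReal a (i.eval σ) (e.eval σ)) (1 + i.size + e.size) 0
  | seq {p q : Cmd} {σ σ₁ σ₂ : Store} {t₁ t₂ c₁ c₂ : ℕ} :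
      Run sub p σ σ₁ t₁ c₁ → Run sub q σ₁ σ₂ t₂ c₂ →
      Run sub (.seq p q) σ σ₂ (t₁ + t₂) (c₁ + c₂)
  | iteTrue {c : BExp} {p q : Cmd} {σ σ' : Store} {t k : ℕ} :
      c.Holds σ → Run sub p σ σ' t k → Run sub (.ite c p q) σ σ' (1 + c.size + t) k
  | iteFalse {c : BExp} {p q : Cmd} {σ σ' : Store} {t k : ℕ} :
      ¬ c.Holds σ → Run sub q σ σ' t k → Run sub (.ite c p q) σ σ' (1 + c.size + t) k
  | loopDone {c : BExp} {p : Cmd} {σ : Store} :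
      ¬ c.Holds σ → Run sub (.loop c p) σ σ (1 + c.size) 0
  | loopStep {c : BExp} {p : Cmd} {σ σ₁ σ₂ : Store} {t₁ t₂ c₁ c₂ : ℕ} :
      c.Holds σ → Run sub p σ σ₁ t₁ c₁ → Run sub (.loop c p) σ₁ σ₂ t₂ c₂ →
      Run sub (.loop c p) σ σ₂ (1 + c.size + t₁ + t₂) (c₁ + c₂)
  | call {b x du dv : RExp} {l : NExp} {r a : ℕ} {σ τ : Store} {t : ℕ} :
      sub (Store.args (b.eval σ) (x.eval σ) (du.eval σ) (dv.eval σ) (l.eval σ)) τ t →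
      Run sub (.call b x du dv l r a) σ ((σ.setReal r (τ.real 0)).setRealArr a (τ.realArr 0))
        (1 + b.size + x.size + du.size + dv.size + l.size + t) 1

/-- No subroutine is available. -/
def noSub : Store → Store → ℕ → Prop := fun _ _ _ => False

/-- The program `A` (which itself has no subroutine) as a subroutine. -/
def asSub (A : Cmd) : Store → Store → ℕ → Prop := fun τ τ' t => Run noSub A τ τ' t 0

/-- The first `l` entries of an array from position `o` on. -/
def readList (f : ℕ → ℝ) (o l : ℕ) : List ℝ := (List.range l).map fun i => f (o + i)

/-- `A` is an optimal edge-chunking algorithm that runs in linear time. Given the bias `b`, the cost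
of an edge `e = (u, v)`, the precomputed numbers `c(u → t)` and `c(v → t)`, and `l ≥ 1`, it returns an
optimal `l`-chunking of `e` together with its bottleneck, in `O(l)` steps. -/
def IsEdgeChunker (A : Cmd) : Prop :=
  ∃ C : ℝ, ∀ (n m : ℕ) (G : TaskGraph n m) (b : ℝ) (e : Fin m) (l : ℕ),
    1 < b → 1 ≤ l → G.Reaches (G.dst e) G.t →
    ∃ (τ : Store) (time : ℕ),
      asSub A (Store.args b (G.cost e) (G.dist (G.src e) G.t) (G.dist (G.dst e) G.t) l) τ time ∧
      G.IsOptimalChunking b e l (readList (τ.realArr 0) 0 l) ∧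
      τ.real 0 = G.bottleneck b e (readList (τ.realArr 0) 0 l) ∧
      (time : ℝ) ≤ C * l

/-- The memory that holds an instance: the numbers of vertices and edges, the budget, the start and
the end, the bias, and the list of edges with their costs. All else is zero. -/
noncomputable def inputStore {n m : ℕ} (G : TaskGraph n m) (b : ℝ) (k : ℕ) : Store where
  nat i := if i = 0 then n else if i = 1 then m else if i = 2 then k else
    if i = 3 then (G.s : ℕ) else if i = 4 then (G.t : ℕ) else 0
  real i := if i = 0 then b else 0
  natArr a j := if h : j < m then
      if a = 0 then (G.src ⟨j, h⟩ : ℕ) else if a = 1 then (G.dst ⟨j, h⟩ : ℕ) else 0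
    else 0
  realArr a j := if h : j < m then if a = 0 then G.cost ⟨j, h⟩ else 0 else 0

/-- The configuration that a memory describes: for the edge `e`, natural array `2` holds the number
of chunks, and natural array `3` the position in real array `1` from which on their costs stand. -/
def outputConfig (m : ℕ) (σ : Store) : ChunkConfig m :=
  fun e => readList (σ.realArr 1) (σ.natArr 3 e) (σ.natArr 2 e)

/-! Chunking one edge. An edge `e = (u, v)` of cost `c` interacts with the rest of the graph only
through `du = c(u → t)` and `dv = c(v → t)`. At an inner vertex of its chunked path, with the chunks
`ys` still to come, the distance to `t` is `min (ys.sum + dv) du`: one finishes the edge or leaves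
it as from `u` (`dist_chunkedGraph`). So the bottleneck is a function of a list of numbers
(`bottleneck_le_iff`). Fix a bottleneck `dv + a` and let `D = du - dv`. Read from the last chunk
backwards, a chunk followed by the total `s` has size at most `(a - s) / b` while `s ≤ D`, and at
most `(a - D) / b` afterwards. If the last `j + 1` chunks are of the first kind, then `l` chunks
cover at most `chunkReach b D l j a`, which is affine and increasing in `a`. Greedily maximal chunks
attain these bounds, so `c` can be split within `dv + a` exactly if `a ≥ 0` and `c ≤ chunkReach b D
l j a` for some `j < l` (`ChunksWithin.exists_sum_le`, `IsGreedy.sum_eq`). The optimal excess is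
thus the maximum of `0` and the least of `l` explicit thresholds (`le_chunkReach_iff`). One pass
over `j` finds it, and one backward pass writes the chunks.

Reduction of the global problem. At an inner vertex of a chunked edge `e = (u, v)` the other edges
of `u` are offered as in the task graph, and chunking never makes an option look worse. Hence an
agent that takes an edge which is not a chunk takes the default edge, the one it would take at that
place without any chunking (`isDefault_of_picks`); if it does so in the middle of `e`, the chunks
completed before were wasted. Cutting them out turns every route into a walk of the task graph that
is no more expensive, each edge of which is a default edge or carries a chunking whose chunks are
perceived as no worse than any option at the tail (`exists_walk_of_route`). Conversely, if just the
edges of such a walk are chunked, the tie-breaking rule makes the agent follow it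
(`exists_route_of_walk`). Since more chunks never hurt (`Guides.mono`), each edge has a least number
of chunks that works, `0` for default edges, and an optimal configuration is a cheapest walk from
`s` to `t` whose numbers add up to at most `k` (`isOptimalConfig_of_walk`).

The algorithm. Sorting the edges from the sinks upwards lets distances and default edges be found by
relaxing every edge once. The number of chunks that an edge needs, if at most `k`, is found by
binary search: `O(log k)` calls, each for at most `k` chunks and hence `O(k)` steps. A table over
vertices and budgets `0, …, k`, filled in the same order, then gives the cheapest walk in `O(m k)`
steps after the searches. Default edges need no chunks, so no entry of a vertex that reaches `t` is
infinite.

The programs are verified in a small Hoare logic that also bounds steps and calls: `Halts`, with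
weakest preconditions for straight-line code, loop invariants indexed by the rounds left, and frames
for what a program leaves untouched. -/

namespace WDigraph

/-! ### Walks and distances in directed graphs. -/

variable {V E : Type}

@[simp] lemma isWalk_nil (G : WDigraph V E) (u v : V) : G.IsWalk u [] v ↔ u = v := Iff.rfl

@[simp] lemma isWalk_cons (G : WDigraph V E) (u v : V) (e : E) (p : List E) :
    G.IsWalk u (e :: p) v ↔ G.src e = u ∧ G.IsWalk (G.dst e) p v := Iff.rfl

@[simp] lemma walkCost_nil (G : WDigraph V E) : G.walkCost [] = 0 := by simp [walkCost]

@[simp] lemma walkCost_cons (G : WDigraph V E) (e : E) (p : List E) :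
    G.walkCost (e :: p) = G.cost e + G.walkCost p := by simp [walkCost]

@[simp] lemma walkCost_append (G : WDigraph V E) (p q : List E) :
    G.walkCost (p ++ q) = G.walkCost p + G.walkCost q := by simp [walkCost]

lemma isWalk_append (G : WDigraph V E) {u v w : V} {p q : List E} (hp : G.IsWalk u p v)
    (hq : G.IsWalk v q w) : G.IsWalk u (p ++ q) w := by
  induction p generalizing u with
  | nil => obtain rfl : u = v := hp; simpa using hq
  | cons e p ih => exact ⟨hp.1, ih hp.2⟩

lemma isWalk_append_cons (G : WDigraph V E) {u v : V} {p q : List E} {e : E}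
    (h : G.IsWalk u (p ++ e :: q) v) : G.IsWalk u p (G.src e) ∧ G.IsWalk (G.dst e) q v := by
  induction p generalizing u with
  | nil => exact ⟨h.1.symm, h.2⟩
  | cons f p ih => exact ⟨⟨h.1, (ih h.2).1⟩, (ih h.2).2⟩

lemma Reaches.of_edge {G : WDigraph V E} {t : V} {e : E} (h : G.Reaches (G.dst e) t) :
    G.Reaches (G.src e) t :=
  let ⟨p, hp⟩ := h
  ⟨e :: p, rfl, hp⟩

lemma dist_eq_of_walk (G : WDigraph V E) {u v : V} {c : ℝ} {p : List E} (hp : G.IsWalk u p v)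
    (hc : G.walkCost p = c) (h : ∀ q, G.IsWalk u q v → c ≤ G.walkCost q) : G.dist u v = c := by
  apply le_antisymm
  · refine csInf_le ⟨c, ?_⟩ ⟨p, hp, hc⟩
    rintro _ ⟨q, hq, rfl⟩
    exact h q hq
  · refine le_csInf ⟨c, p, hp, hc⟩ ?_
    rintro _ ⟨q, hq, rfl⟩
    exact h q hq

/-- A repeated tail would close a directed cycle. Hence walks have bounded length, and a walk uses
at most one edge out of each vertex. -/
lemma Acyclic.nodup_src {G : WDigraph V E} (hG : G.Acyclic) {u v : V} {p : List E}
    (hp : G.IsWalk u p v) : (p.map G.src).Nodup := by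
  induction p generalizing u with
  | nil => simp
  | cons e p ih =>
    rw [List.map_cons, List.nodup_cons]
    refine ⟨fun hmem => ?_, ih hp.2⟩
    obtain ⟨f, hf, hfe⟩ := List.mem_map.1 hmem
    obtain ⟨p₁, p₂, rfl⟩ := List.append_of_mem hf
    have h1 := (G.isWalk_append_cons hp.2).1
    rw [hfe] at h1
    exact absurd (hG (G.src e) (e :: p₁) ⟨rfl, h1⟩) (by simp)

lemma Acyclic.nodup {G : WDigraph V E} (hG : G.Acyclic) {u v : V} {p : List E}
    (hp : G.IsWalk u p v) : p.Nodup := (hG.nodup_src hp).of_map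

lemma AgentRoute.isWalk {G : WDigraph V E} {b : ℝ} {t : V} {ch : E → Prop} {rk : E → ℕ} {v : V}
    {p : List E} (h : G.AgentRoute b t ch rk v p) : G.IsWalk v p t := by
  induction p generalizing v with
  | nil => exact h
  | cons e p ih => exact ⟨h.2.1.1.1.1, ih h.2.2⟩

end WDigraph

/-! ### Task graphs: induction towards the sinks, attained distances, default edges. -/

namespace TaskGraph

variable {n m : ℕ} (G : TaskGraph n m)

/-- In a finite acyclic graph, being reachable by a nonempty walk is a well-founded relation. -/
lemma induction {P : Fin n → Prop} (h : ∀ v, (∀ e, G.src e = v → P (G.dst e)) → P v) (v : Fin n) :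
    P v := by
  let r : Fin n → Fin n → Prop := fun u v => ∃ p, p ≠ [] ∧ G.IsWalk v p u
  have : IsTrans (Fin n) r := ⟨fun a b c ⟨p, hp, hp'⟩ ⟨q, hq, hq'⟩ =>
    ⟨q ++ p, by simp [hp], G.isWalk_append hq' hp'⟩⟩
  have : Std.Irrefl r := ⟨fun a ⟨p, hp, hp'⟩ => hp (G.acyclic a p hp')⟩
  refine (Finite.wellFounded_of_trans_of_irrefl r).induction v fun u ih => h u fun e he => ih _ ?_
  exact ⟨[e], by simp, he, rfl⟩

lemma walkCost_nonneg (p : List (Fin m)) : 0 ≤ G.walkCost p := by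
  apply List.sum_nonneg
  intro x hx
  obtain ⟨e, -, rfl⟩ := List.mem_map.1 hx
  exact G.cost_nonneg e

lemma src_ne_dst (e : Fin m) : G.src e ≠ G.dst e := by
  intro h
  have := G.acyclic (G.src e) [e] ⟨rfl, h.symm⟩
  simp at this

lemma src_ne_target {e : Fin m} (h : G.Reaches (G.dst e) G.t) : G.src e ≠ G.t := by
  obtain ⟨p, hp⟩ := h
  intro heq
  have := G.acyclic (G.src e) (e :: p) ⟨rfl, by rw [heq]; exact hp⟩
  simp at this

lemma dist_le {u v : Fin n} {p : List (Fin m)} (hp : G.IsWalk u p v) :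
    G.dist u v ≤ G.walkCost p := by
  refine csInf_le ⟨0, ?_⟩ ⟨p, hp, rfl⟩
  rintro _ ⟨q, -, rfl⟩
  exact G.walkCost_nonneg q

/-- Walks repeat no edge, so there are finitely many and the infimum is a minimum. -/
lemma exists_walk_dist {u v : Fin n} (h : G.Reaches u v) :
    ∃ p, G.IsWalk u p v ∧ G.walkCost p = G.dist u v := by
  have hfin : {p | G.IsWalk u p v}.Finite := by
    refine (List.finite_length_le (Fin m) m).subset fun p hp => ?_
    simpa using (G.acyclic.nodup hp).length_le_card
  obtain ⟨p, hp, hmin⟩ := Set.exists_min_image _ G.walkCost hfin h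
  exact ⟨p, hp, (G.dist_eq_of_walk hp rfl hmin).symm⟩

lemma dist_self (v : Fin n) : G.dist v v = 0 :=
  G.dist_eq_of_walk (p := []) rfl (by simp) fun q _ => G.walkCost_nonneg q

lemma dist_src_le {e : Fin m} {v : Fin n} (h : G.Reaches (G.dst e) v) :
    G.dist (G.src e) v ≤ G.cost e + G.dist (G.dst e) v := by
  obtain ⟨p, hp, hc⟩ := G.exists_walk_dist h
  have := G.dist_le (u := G.src e) (p := e :: p) ⟨rfl, hp⟩
  simpa [hc] using this

lemma exists_edge_dist {u v : Fin n} (h : G.Reaches u v) (huv : u ≠ v) :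
    ∃ e, G.src e = u ∧ G.Reaches (G.dst e) v ∧ G.dist u v = G.cost e + G.dist (G.dst e) v := by
  obtain ⟨p, hp, hc⟩ := G.exists_walk_dist h
  cases p with
  | nil => exact absurd hp huv
  | cons e p =>
    have h2 : G.Reaches (G.dst e) v := ⟨p, hp.2⟩
    refine ⟨e, hp.1, h2, le_antisymm ?_ ?_⟩
    · have := G.dist_src_le h2
      rwa [hp.1] at this
    · have := G.dist_le hp.2
      simp at hc
      linarith

/-- The edge that the agent takes at its tail when nothing is chunked. -/
def IsDefault (b : ℝ) (e : Fin m) : Prop :=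
  e ∈ G.best b G.t (G.src e) ∧ ∀ f ∈ G.best b G.t (G.src e), G.dst e ≤ G.dst f

lemma options_nonempty {u : Fin n} (h : G.Reaches u G.t) (hu : u ≠ G.t) :
    (G.options G.t u).Nonempty := by
  obtain ⟨e, he, hr, -⟩ := G.exists_edge_dist h hu
  exact ⟨e, he, hr⟩

lemma exists_isDefault (b : ℝ) {u : Fin n} (h : G.Reaches u G.t) (hu : u ≠ G.t) :
    ∃ e, G.src e = u ∧ G.IsDefault b e := by
  obtain ⟨e, he, hmin⟩ := Set.exists_min_image _ (G.perceived b G.t)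
    (Set.toFinite (G.options G.t u)) (G.options_nonempty h hu)
  obtain ⟨f, hf, hmin'⟩ := Set.exists_min_image _ G.dst (Set.toFinite (G.best b G.t u))
    ⟨e, he, hmin⟩
  have hfu : G.src f = u := hf.1.1
  subst hfu
  exact ⟨f, rfl, hf, hmin'⟩

lemma IsDefault.eq {G : TaskGraph n m} {b : ℝ} {e f : Fin m} (he : G.IsDefault b e)
    (hf : G.IsDefault b f) (h : G.src e = G.src f) : e = f := by
  refine G.simple e f h (le_antisymm (he.2 f ?_) (hf.2 e ?_))
  · rw [h]; exact hf.1
  · rw [← h]; exact he.1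

end TaskGraph

/-! ### Chunkings as lists of numbers: upper bounds for what chunks can cover. -/

/-- Cost still expected at the head of a chunk when the chunks `ys` are left, where `du` and `dv` are
the distances to the target from the tail and from the head of the chunked edge. -/
noncomputable def tailCost (du dv : ℝ) (ys : List ℝ) : ℝ :=
  if ys = [] then dv else min (ys.sum + dv) du

/-- Every chunk of `xs` has perceived cost at most `β`. -/
def ChunksWithin (b du dv β : ℝ) : List ℝ → Prop
  | [] => True
  | x :: ys => b * x + tailCost du dv ys ≤ β ∧ ChunksWithin b du dv β ys

lemma chunksWithin_iff (b du dv β : ℝ) (xs : List ℝ) :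
    ChunksWithin b du dv β xs ↔
      ∀ i < xs.length, b * xs.getD i 0 + tailCost du dv (xs.drop (i + 1)) ≤ β := by
  induction xs with
  | nil => simp [ChunksWithin]
  | cons x ys ih =>
    rw [ChunksWithin, ih]
    constructor
    · rintro ⟨h1, h2⟩ i hi
      cases i with
      | zero => simpa using h1
      | succ i => simpa using h2 i (by simpa using hi)
    · intro h
      refine ⟨by simpa using h 0 (by simp), fun i hi => ?_⟩
      simpa using h (i + 1) (by simpa using hi)

lemma ChunksWithin.mono {b du dv β β' : ℝ} (h : β ≤ β') {xs : List ℝ}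
    (hx : ChunksWithin b du dv β xs) : ChunksWithin b du dv β' xs := by
  rw [chunksWithin_iff] at *
  exact fun i hi => (hx i hi).trans h

/-- A chunk of cost `0` can be put in front: it is perceived as at most `du`. The chunk after it is
perceived as at least `du`, because either the escape is the cheaper continuation, or it costs at
least `c + dv ≥ du` as `b ≥ 1`. -/
lemma ChunksWithin.exists_succ {b du dv β c : ℝ} {l : ℕ} (hb : 1 ≤ b) (hl : 1 ≤ l)
    (hdu : du ≤ c + dv) {xs : List ℝ} (hc : IsChunking c l xs)
    (hx : ChunksWithin b du dv β xs) :
    ∃ ys, IsChunking c (l + 1) ys ∧ ChunksWithin b du dv β ys := by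
  obtain ⟨h1, h2, h3⟩ := hc
  refine ⟨0 :: xs, ⟨by simp [h1], by simpa using h2, by simp [h3]⟩, ?_, hx⟩
  obtain ⟨x, zs, rfl⟩ : ∃ x zs, xs = x :: zs := by
    cases xs with
    | nil => simp at h1; omega
    | cons x zs => exact ⟨x, zs, rfl⟩
  have h4 := hx.1
  have h5 : 0 ≤ x := h2 x (by simp)
  have h6 : x ≤ b * x := le_mul_of_one_le_left h5 hb
  simp only [List.sum_cons] at h3
  rw [tailCost, if_neg (by simp), mul_zero, zero_add]
  refine (min_le_right _ _).trans (le_trans ?_ h4)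
  unfold tailCost
  split_ifs with h
  · subst h; simp at h3; linarith
  · rcases min_choice (zs.sum + dv) du with h | h <;> rw [h] <;> linarith

lemma ChunksWithin.exists_of_le {b du dv β c : ℝ} {l l' : ℕ} (hb : 1 ≤ b) (hl : 1 ≤ l)
    (hll : l ≤ l') (hdu : du ≤ c + dv)
    (h : ∃ xs, IsChunking c l xs ∧ ChunksWithin b du dv β xs) :
    ∃ ys, IsChunking c l' ys ∧ ChunksWithin b du dv β ys := by
  induction l', hll using Nat.le_induction with
  | base => exact h
  | succ k hk ih =>
    obtain ⟨ys, h1, h2⟩ := ih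
    exact h2.exists_succ hb (hl.trans hk) hdu h1

/-- The largest total cost of `l` chunks with perceived cost at most `dv + a`, if the last `j + 1` of
them are followed by the head of the edge and the others by an escape that is `D` dearer. -/
noncomputable def chunkReach (b D : ℝ) (l j : ℕ) (a : ℝ) : ℝ :=
  a * (1 - (1 - 1 / b) ^ (j + 1)) + ((l - 1 - j : ℕ) : ℝ) * (a - D) / b

/-- The last chunk `x` is followed by the head of the edge, so `b * x ≤ a`. -/
lemma ChunksWithin.excess_nonneg {b du dv a : ℝ} (hb : 0 < b) {xs : List ℝ} (hne : xs ≠ [])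
    (h0 : ∀ x ∈ xs, 0 ≤ x) (hx : ChunksWithin b du dv (dv + a) xs) : 0 ≤ a := by
  induction xs with
  | nil => exact absurd rfl hne
  | cons x ys ih =>
    by_cases hy : ys = []
    · subst hy
      have := hx.1
      simp only [tailCost, if_true] at this
      have : 0 ≤ b * x := mul_nonneg hb.le (h0 x (by simp))
      linarith
    · exact ih hy (fun z hz => h0 z (by simp [hz])) hx.2

/-- While no chunk sees a cheaper escape, a chunk in front of a total `s` is at most `(a - s) / b`,
so the total grows at most to `a / b + s * (1 - 1 / b)`. The closed form solves this recursion from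
`s = 0`. -/
lemma ChunksWithin.sum_le_of_sum_le {b du dv a : ℝ} (hb : 1 < b) {xs : List ℝ}
    (h0 : ∀ x ∈ xs, 0 ≤ x) (hx : ChunksWithin b du dv (dv + a) xs)
    (hD : xs.tail.sum ≤ du - dv ∨ xs.length = 1) :
    xs.sum ≤ a * (1 - (1 - 1 / b) ^ xs.length) := by
  induction xs with
  | nil => simp
  | cons x ys ih =>
    have hb0 : 0 < b := by linarith
    have h1 := hx.1
    have hD' : ys = [] ∨ ys.sum ≤ du - dv := by
      rcases hD with h | h
      · exact Or.inr h
      · left; simpa using h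
    have h2 : b * x + ys.sum ≤ a := by
      by_cases hy : ys = []
      · subst hy; simp [tailCost] at h1; simp; linarith
      · rw [tailCost, if_neg hy, min_eq_left] at h1
        · linarith
        · rcases hD' with h | h
          · exact absurd h hy
          · linarith
    have h3 : ys.sum ≤ a * (1 - (1 - 1 / b) ^ ys.length) := by
      rcases hD' with h | h
      · subst h; simp
      · refine ih (fun z hz => h0 z (by simp [hz])) hx.2 (Or.inl ?_)
        refine le_trans ?_ h
        cases ys with
        | nil => simp
        | cons y zs => simpa using h0 y (by simp)
    have h4 : x ≤ (a - ys.sum) / b := by rw [le_div_iff₀ hb0]; linarith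
    rw [List.sum_cons, List.length_cons, pow_succ]
    have h5 : (0:ℝ) ≤ 1 - 1 / b := by
      rw [sub_nonneg, div_le_one hb0]; exact hb.le
    have h6 := mul_le_mul_of_nonneg_right h3 h5
    calc x + ys.sum ≤ (a - ys.sum) / b + ys.sum := by linarith
      _ = a / b + ys.sum * (1 - 1 / b) := by field_simp; ring
      _ ≤ a / b + a * (1 - (1 - 1 / b) ^ ys.length) * (1 - 1 / b) := by linarith
      _ = _ := by ring

/-- If the chunks after the first exceed `D = du - dv` in total, the first one is judged by the
escape and is at most `(a - D) / b`; this adds one term of the second kind to the bound for the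
others. Otherwise no chunk sees a cheaper escape, and `j` takes its largest value. -/
lemma ChunksWithin.exists_sum_le {b du dv a : ℝ} (hb : 1 < b) {xs : List ℝ} (hne : xs ≠ [])
    (h0 : ∀ x ∈ xs, 0 ≤ x) (hx : ChunksWithin b du dv (dv + a) xs) :
    ∃ j < xs.length, xs.sum ≤ chunkReach b (du - dv) xs.length j a := by
  induction xs with
  | nil => exact absurd rfl hne
  | cons x ys ih =>
    have hb0 : 0 < b := by linarith
    by_cases hD : ys.sum ≤ du - dv ∨ (x :: ys).length = 1
    · refine ⟨ys.length, by simp, ?_⟩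
      have := hx.sum_le_of_sum_le hb h0 (by simpa using hD)
      simpa [chunkReach] using this
    · push Not at hD
      have hy : ys ≠ [] := by rintro rfl; simp at hD
      obtain ⟨j, hj, hs⟩ := ih hy (fun z hz => h0 z (by simp [hz])) hx.2
      refine ⟨j, by simp; omega, ?_⟩
      have h1 := hx.1
      rw [tailCost, if_neg hy, min_eq_right (by linarith [hD.1])] at h1
      have h2 : x ≤ (a - (du - dv)) / b := by rw [le_div_iff₀ hb0]; linarith
      have h3 : ((x :: ys).length - 1 - j : ℕ) = (ys.length - 1 - j : ℕ) + 1 := by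
        simp; omega
      unfold chunkReach at hs ⊢
      rw [h3, List.sum_cons]
      push_cast
      calc x + ys.sum ≤ (a - (du - dv)) / b + _ := add_le_add h2 hs
        _ = _ := by ring

/-! ### Distances to the target in a chunked graph. -/

namespace TaskGraph

variable {n m : ℕ} (G : TaskGraph n m)

/-- The vertex `(e, i)` of a chunked edge, which for `i = 0` is the tail of `e`. -/
def chunkStart (e : Fin m) (i : ℕ) : ChunkVertex n m :=
  if i = 0 then Sum.inl (G.src e) else Sum.inr (e, i)

/-- The vertices that can be met on a walk from a task vertex. -/
def IsProper (cfg : ChunkConfig m) : ChunkVertex n m → Prop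
  | Sum.inl _ => True
  | Sum.inr (e, i) => 1 ≤ i ∧ i < (cfg e).length

/-- All chunked edges carry chunkings of their cost. -/
def IsChunkedBy (cfg : ChunkConfig m) : Prop :=
  ∀ e, cfg e ≠ [] → IsChunking (G.cost e) (cfg e).length (cfg e)

variable {G} {cfg : ChunkConfig m}

lemma IsChunkedBy.nonneg (h : G.IsChunkedBy cfg) (e : Fin m) : ∀ x ∈ cfg e, 0 ≤ x := by
  by_cases he : cfg e = []
  · simp [he]
  · exact (h e he).2.1

variable (G) in
/-- Distance to the target from the vertex at which `i` chunks of `e` are completed. -/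
noncomputable def chunkDist (cfg : ChunkConfig m) (e : Fin m) (i : ℕ) : ℝ :=
  open Classical in
  if G.Reaches (G.dst e) G.t then
    tailCost (G.dist (G.src e) G.t) (G.dist (G.dst e) G.t) ((cfg e).drop i)
  -- If the head does not lead to the target, leaving the edge is the only way on.
  else G.dist (G.src e) G.t

lemma chunkDist_le (e : Fin m) {i : ℕ} (hi : i < (cfg e).length) :
    G.chunkDist cfg e i ≤ G.dist (G.src e) G.t := by
  unfold chunkDist tailCost
  split_ifs with h1 h2
  · rw [List.drop_eq_nil_iff] at h2; omega
  · exact min_le_right _ _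
  · exact le_rfl

lemma chunkDist_le_sum (e : Fin m) (i : ℕ) (h : G.Reaches (G.dst e) G.t) :
    G.chunkDist cfg e i ≤ ((cfg e).drop i).sum + G.dist (G.dst e) G.t := by
  unfold chunkDist tailCost
  rw [if_pos h]
  split_ifs with h2
  · simp [h2]
  · exact min_le_left _ _

lemma chunkDist_zero (hcfg : G.IsChunkedBy cfg) (e : Fin m) (he : cfg e ≠ []) :
    G.chunkDist cfg e 0 = G.dist (G.src e) G.t := by
  unfold chunkDist tailCost
  split_ifs with h1 h2
  · exact absurd (by simpa using h2) he
  · rw [List.drop_zero, (hcfg e he).2.2, min_eq_right (G.dist_src_le h1)]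
  · rfl

/-- With `vertexDist_le`, which covers the escapes, this makes `vertexDist` a potential that falls
along an edge by at most the cost of the edge. -/
lemma chunkDist_le_add (hcfg : G.IsChunkedBy cfg) (e : Fin m) {i : ℕ} (hi : i < (cfg e).length) :
    G.chunkDist cfg e i ≤ (cfg e).getD i 0 + G.chunkDist cfg e (i + 1) := by
  have h0 : 0 ≤ (cfg e).getD i 0 := by
    rw [List.getD_eq_getElem _ _ hi]; exact hcfg.nonneg e _ (List.getElem_mem hi)
  have hs : ((cfg e).drop i).sum = (cfg e).getD i 0 + ((cfg e).drop (i + 1)).sum := by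
    rw [List.drop_eq_getElem_cons hi, List.sum_cons, List.getD_eq_getElem _ _ hi]
  by_cases h1 : G.Reaches (G.dst e) G.t
  · have h2 := chunkDist_le_sum (cfg := cfg) e i h1
    have h3 := chunkDist_le (G := G) e hi
    rw [hs] at h2
    by_cases h4 : (cfg e).drop (i + 1) = []
    · simp only [chunkDist, if_pos h1, tailCost, if_pos h4] at h2 h3 ⊢
      rw [h4] at h2
      simpa using h2
    · have h5 : G.chunkDist cfg e (i + 1) = min (((cfg e).drop (i + 1)).sum +
          G.dist (G.dst e) G.t) (G.dist (G.src e) G.t) := by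
        simp only [chunkDist, if_pos h1, tailCost, if_neg h4]
      rw [h5]
      rcases min_choice (((cfg e).drop (i + 1)).sum + G.dist (G.dst e) G.t)
        (G.dist (G.src e) G.t) with h | h <;> rw [h] <;> linarith
  · simp only [chunkDist, if_neg h1]
    linarith

variable (G) in
/-- Distance to the target in the chunked graph. -/
noncomputable def vertexDist (cfg : ChunkConfig m) : ChunkVertex n m → ℝ
  | Sum.inl v => G.dist v G.t
  | Sum.inr (e, i) => G.chunkDist cfg e i

/-- The hypothesis excludes the head of an edge from which the target is unreachable: there `dist`
is an infimum over the empty set, while `chunkDist` still refers to the tail. -/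
lemma vertexDist_chunkPoint (cfg : ChunkConfig m) (e : Fin m) (i : ℕ)
    (h : i < (cfg e).length ∨ G.Reaches (G.dst e) G.t) :
    G.vertexDist cfg (G.chunkPoint cfg e i) = G.chunkDist cfg e i := by
  unfold chunkPoint
  split_ifs with hi
  · rfl
  · rw [chunkDist, if_pos (h.resolve_left hi), tailCost,
      if_pos (List.drop_eq_nil_iff.2 (not_lt.1 hi))]
    rfl

lemma vertexDist_le (x : ChunkVertex n m) (hx : IsProper cfg x) :
    G.vertexDist cfg x ≤ G.dist (G.home x) G.t := by
  rcases x with v | ⟨e, i⟩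
  · exact le_rfl
  · exact chunkDist_le e hx.2

lemma vertexDist_chunkStart (hcfg : G.IsChunkedBy cfg) (e : Fin m) (i : ℕ) (he : cfg e ≠ []) :
    G.vertexDist cfg (G.chunkStart e i) = G.chunkDist cfg e i := by
  unfold chunkStart
  split_ifs with h
  · subst h; rw [chunkDist_zero hcfg e he]; rfl
  · rfl

@[simp] lemma home_chunkStart (e : Fin m) (i : ℕ) : G.home (G.chunkStart e i) = G.src e := by
  unfold chunkStart; split_ifs <;> rfl

lemma isProper_chunkStart (e : Fin m) {i : ℕ} (hi : i < (cfg e).length) :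
    IsProper cfg (G.chunkStart e i) := by
  unfold chunkStart
  split_ifs with h
  · trivial
  · exact ⟨by omega, hi⟩

lemma isProper_chunkPoint (e : Fin m) {i : ℕ} (hi : 1 ≤ i) :
    IsProper cfg (G.chunkPoint cfg e i) := by
  unfold chunkPoint
  split_ifs with h
  · exact ⟨hi, h⟩
  · trivial

lemma chunkEdge_val (e : Fin m) (i : ℕ) : (G.chunkEdge e i).1 = (G.chunkStart e i, e) := by
  unfold chunkEdge chunkStart; split_ifs <;> rfl

lemma src_chunkEdge (e : Fin m) (i : ℕ) :
    (G.chunkedGraph cfg).src (G.chunkEdge e i) = G.chunkStart e i := by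
  change (G.chunkEdge e i).1.1 = _
  rw [chunkEdge_val]

lemma dst_chunkEdge (e : Fin m) (i : ℕ) :
    (G.chunkedGraph cfg).dst (G.chunkEdge e i) = G.chunkPoint cfg e (i + 1) := by
  unfold chunkEdge; split_ifs with h
  · subst h; rfl
  · simp [chunkedGraph]

lemma cost_chunkEdge (e : Fin m) (i : ℕ) (he : cfg e ≠ []) :
    (G.chunkedGraph cfg).cost (G.chunkEdge e i) = (cfg e).getD i 0 := by
  unfold chunkEdge; split_ifs with h
  · subst h
    have := List.length_pos_of_ne_nil he
    simp [chunkedGraph, this]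
  · simp [chunkedGraph]

lemma isChunkEdge_chunkEdge (e : Fin m) (i : ℕ) (he : cfg e ≠ []) :
    G.IsChunkEdge cfg (G.chunkEdge e i) := by
  unfold chunkEdge; split_ifs with h
  · exact he
  · simp [IsChunkEdge]

variable (G) in
lemma src_eq_fst (p : G.ChunkEdge) : (G.chunkedGraph cfg).src p = p.1.1 := rfl

/-- An edge of the chunked graph is a chunk or has an edge of the task graph as its copy. -/
lemma edge_cases (p : G.ChunkEdge) (hp : IsProper cfg p.1.1) :
    (G.IsChunkEdge cfg p ∧ cfg p.1.2 ≠ [] ∧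
      ∃ i < (cfg p.1.2).length, p = G.chunkEdge p.1.2 i) ∨
    (¬ G.IsChunkEdge cfg p ∧ (G.chunkedGraph cfg).cost p = G.cost p.1.2 ∧
      (G.chunkedGraph cfg).dst p = Sum.inl (G.dst p.1.2)) := by
  rcases p with ⟨⟨v | ⟨e₀, i⟩, e⟩, h⟩
  · by_cases he : cfg e = []
    · right
      simp [IsChunkEdge, chunkedGraph, chunkPoint, he]
    · left
      refine ⟨he, he, 0, List.length_pos_of_ne_nil he, Subtype.ext ?_⟩
      rw [chunkEdge_val]
      have h' : G.src e = v := h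
      simp [chunkStart, h']
  · by_cases he : e = e₀
    · subst he
      left
      refine ⟨rfl, fun h0 => ?_, i, hp.2, Subtype.ext ?_⟩
      · have := hp.2
        simp_all
      · rw [chunkEdge_val]
        have := hp.1
        simp [chunkStart, Nat.ne_zero_of_lt hp.1]
    · right
      simp [IsChunkEdge, chunkedGraph, he]

/-- `vertexDist` is a potential that vanishes at the target, so summing its drops along a walk
bounds the cost from below. Reachability is carried along because the inequalities for `dist` hold
only where the target is reachable. -/
lemma le_walkCost (hcfg : G.IsChunkedBy cfg) {p : List G.ChunkEdge} {x : ChunkVertex n m}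
    (hx : IsProper cfg x) (hp : (G.chunkedGraph cfg).IsWalk x p (Sum.inl G.t)) :
    G.Reaches (G.home x) G.t ∧ G.vertexDist cfg x ≤ (G.chunkedGraph cfg).walkCost p := by
  induction p generalizing x with
  | nil =>
    obtain rfl : x = Sum.inl G.t := hp
    exact ⟨⟨[], rfl⟩, by simp [vertexDist, G.dist_self]⟩
  | cons ε p ih =>
    obtain ⟨hs, hw⟩ := hp
    have hs' : ε.1.1 = x := hs
    rw [WDigraph.walkCost_cons]
    have hhome : G.src ε.1.2 = G.home x := by rw [← hs']; exact ε.2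
    rcases edge_cases ε (hs' ▸ hx) with ⟨-, hne, i, hi, hε⟩ | ⟨-, hc, hd⟩
    · generalize ε.1.2 = e at *
      subst hε
      rw [dst_chunkEdge] at hw
      have hx' : x = G.chunkStart e i := by rw [← hs', chunkEdge_val]
      have h1 := ih (isProper_chunkPoint e (by omega)) hw
      have h2 : i + 1 < (cfg e).length ∨ G.Reaches (G.dst e) G.t := by
        by_cases h3 : i + 1 < (cfg e).length
        · exact Or.inl h3
        · right
          simpa [chunkPoint, h3, home] using h1.1
      rw [vertexDist_chunkPoint cfg e _ h2] at h1
      rw [cost_chunkEdge e i hne, hx', vertexDist_chunkStart hcfg e i hne]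
      refine ⟨?_, (chunkDist_le_add hcfg e hi).trans (by linarith [h1.2])⟩
      rw [home_chunkStart]
      by_cases h3 : i + 1 < (cfg e).length
      · simpa [chunkPoint, h3, home] using h1.1
      · exact (h2.resolve_left h3).of_edge
    · rw [hd] at hw
      have h1 := ih (x := Sum.inl (G.dst ε.1.2)) trivial hw
      refine ⟨?_, ?_⟩
      · rw [← hhome]; exact WDigraph.Reaches.of_edge h1.1
      · have h2 := G.dist_src_le h1.1
        have h3 := vertexDist_le (G := G) (cfg := cfg) x hx
        have h4 := h1.2
        simp only [home, vertexDist] at h2 h4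
        rw [hc]
        rw [← hhome] at h3
        linarith

lemma exists_walk_chunks (e : Fin m) (he : cfg e ≠ []) {i : ℕ} (hi : i < (cfg e).length) :
    ∃ p, (G.chunkedGraph cfg).IsWalk (G.chunkStart e i) p (Sum.inl (G.dst e)) ∧
      (G.chunkedGraph cfg).walkCost p = ((cfg e).drop i).sum := by
  obtain ⟨d, hd⟩ : ∃ d, (cfg e).length = i + 1 + d := ⟨(cfg e).length - (i + 1), by omega⟩
  induction d generalizing i with
  | zero =>
    refine ⟨[G.chunkEdge e i], ⟨src_chunkEdge e i, ?_⟩, ?_⟩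
    · rw [dst_chunkEdge, chunkPoint, if_neg (by omega)]; rfl
    · rw [List.drop_eq_getElem_cons hi, List.drop_eq_nil_iff.2 (by omega)]
      simp [cost_chunkEdge e i he, hi]
  | succ d ih =>
    obtain ⟨p, hp, hc⟩ := ih (i := i + 1) (by omega) (by omega)
    refine ⟨G.chunkEdge e i :: p, ⟨src_chunkEdge e i, ?_⟩, ?_⟩
    · rw [dst_chunkEdge, chunkPoint, if_pos (by omega)]
      simpa [chunkStart] using hp
    · rw [List.drop_eq_getElem_cons hi]
      simp [cost_chunkEdge e i he, hi, hc]

lemma exists_walk_expand (hcfg : G.IsChunkedBy cfg) {u v : Fin n} {p : List (Fin m)}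
    (hp : G.IsWalk u p v) :
    ∃ q, (G.chunkedGraph cfg).IsWalk (Sum.inl u) q (Sum.inl v) ∧
      (G.chunkedGraph cfg).walkCost q = G.walkCost p := by
  induction p generalizing u with
  | nil => obtain rfl : u = v := hp; exact ⟨[], rfl, by simp⟩
  | cons e p ih =>
    obtain ⟨q, hq, hc⟩ := ih hp.2
    obtain rfl : G.src e = u := hp.1
    by_cases he : cfg e = []
    · refine ⟨⟨(Sum.inl (G.src e), e), rfl⟩ :: q, ⟨rfl, ?_⟩, ?_⟩
      · simpa [chunkedGraph, chunkPoint, he] using hq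
      · rw [WDigraph.walkCost_cons, hc, WDigraph.walkCost_cons]
        simp [chunkedGraph, he]
    · obtain ⟨r, hr, hrc⟩ := exists_walk_chunks (G := G) e he (List.length_pos_of_ne_nil he)
      refine ⟨r ++ q, WDigraph.isWalk_append _ hr hq, ?_⟩
      rw [WDigraph.walkCost_append, hrc, hc, List.drop_zero, (hcfg e he).2.2,
        WDigraph.walkCost_cons]

/-- One of two walks attains the potential: the remaining chunks followed by a cheapest walk from
the head, or the first edge of a cheapest walk from the tail. At an inner vertex the tail must not
be the target itself, since the distance `0` of the target has no first edge to leave by. -/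
lemma exists_walk_vertexDist (hcfg : G.IsChunkedBy cfg) {x : ChunkVertex n m}
    (hx : IsProper cfg x) (hr : G.Reaches (G.home x) G.t)
    (hne : (∃ v, x = Sum.inl v) ∨ G.home x ≠ G.t) :
    ∃ p, (G.chunkedGraph cfg).IsWalk x p (Sum.inl G.t) ∧
      (G.chunkedGraph cfg).walkCost p = G.vertexDist cfg x := by
  rcases x with v | ⟨e, i⟩
  · obtain ⟨p, hp, hc⟩ := G.exists_walk_dist hr
    obtain ⟨q, hq, hqc⟩ := exists_walk_expand hcfg hp
    exact ⟨q, hq, hqc.trans hc⟩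
  · replace hne := hne.resolve_left (by simp)
    have hce : cfg e ≠ [] := List.ne_nil_of_length_pos (by have := hx.2; omega)
    change G.src e ≠ G.t at hne
    change G.Reaches (G.src e) G.t at hr
    have hdrop : (cfg e).drop i ≠ [] := by
      have := hx.2
      rw [Ne, List.drop_eq_nil_iff]; omega
    by_cases h : G.Reaches (G.dst e) G.t ∧
        ((cfg e).drop i).sum + G.dist (G.dst e) G.t ≤ G.dist (G.src e) G.t
    · obtain ⟨p, hp, hc⟩ := exists_walk_chunks (G := G) e hce hx.2
      obtain ⟨p', hp', hc'⟩ := G.exists_walk_dist h.1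
      obtain ⟨q, hq, hqc⟩ := exists_walk_expand hcfg hp'
      refine ⟨p ++ q, WDigraph.isWalk_append _ ?_ hq, ?_⟩
      · have := hx.1
        simpa [chunkStart, Nat.ne_zero_of_lt this] using hp
      · simp only [vertexDist, chunkDist, if_pos h.1, tailCost, if_neg hdrop, min_eq_left h.2]
        rw [WDigraph.walkCost_append, hc, hqc, hc']
    · obtain ⟨f, hf, hfr, hfd⟩ := G.exists_edge_dist hr hne
      have hv : G.vertexDist cfg (Sum.inr (e, i)) = G.dist (G.src e) G.t := by
        simp only [vertexDist, chunkDist]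
        split_ifs with h1
        · rw [tailCost, if_neg hdrop, min_eq_right]
          by_contra h2
          exact h ⟨h1, by linarith⟩
        · rfl
      -- If the cheapest walk from the tail began with `e`, finishing the chunks would be no dearer,
      -- which is the case already treated.
      have hfe : f ≠ e := by
        rintro rfl
        refine h ⟨hfr, ?_⟩
        rw [hfd]
        have h3 : ((cfg f).drop i).sum ≤ (cfg f).sum :=
          (List.drop_sublist i (cfg f)).sum_le_sum (hcfg.nonneg f)
        rw [(hcfg f hce).2.2] at h3
        linarith
      obtain ⟨p', hp', hc'⟩ := G.exists_walk_dist hfr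
      obtain ⟨q, hq, hqc⟩ := exists_walk_expand hcfg hp'
      refine ⟨⟨(Sum.inr (e, i), f), hf⟩ :: q, ⟨rfl, ?_⟩, ?_⟩
      · simpa [chunkedGraph, hfe] using hq
      · rw [WDigraph.walkCost_cons, hqc, hv, hfd, hc']
        simp [chunkedGraph, hfe]

lemma dist_chunkedGraph (hcfg : G.IsChunkedBy cfg) {x : ChunkVertex n m}
    (hx : IsProper cfg x) (hr : G.Reaches (G.home x) G.t)
    (hne : (∃ v, x = Sum.inl v) ∨ G.home x ≠ G.t) :
    (G.chunkedGraph cfg).dist x (Sum.inl G.t) = G.vertexDist cfg x := by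
  obtain ⟨p, hp, hc⟩ := exists_walk_vertexDist hcfg hx hr hne
  exact WDigraph.dist_eq_of_walk _ hp hc fun q hq => (le_walkCost hcfg hx hq).2

lemma reaches_chunkPoint (hcfg : G.IsChunkedBy cfg) (e : Fin m) {i : ℕ} (hi : 1 ≤ i)
    (hu : G.src e ≠ G.t) (hr : G.Reaches (G.src e) G.t) :
    (G.chunkedGraph cfg).Reaches (G.chunkPoint cfg e i) (Sum.inl G.t) ↔
      i < (cfg e).length ∨ G.Reaches (G.dst e) G.t := by
  constructor
  · rintro ⟨p, hp⟩
    by_contra! h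
    rw [chunkPoint, if_neg (by omega)] at hp
    exact h.2 (le_walkCost (x := Sum.inl (G.dst e)) hcfg trivial hp).1
  · intro h
    by_cases hil : i < (cfg e).length
    · rw [chunkPoint, if_pos hil]
      obtain ⟨p, hp, -⟩ := exists_walk_vertexDist (x := Sum.inr (e, i)) hcfg ⟨hi, hil⟩ hr
        (Or.inr hu)
      exact ⟨p, hp⟩
    · rw [chunkPoint, if_neg hil]
      obtain ⟨p, hp, -⟩ := exists_walk_vertexDist (x := Sum.inl (G.dst e)) hcfg trivial
        (h.resolve_left hil) (Or.inl ⟨_, rfl⟩)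
      exact ⟨p, hp⟩

lemma dist_chunkPoint (hcfg : G.IsChunkedBy cfg) (e : Fin m) {i : ℕ} (hi : 1 ≤ i)
    (hu : G.src e ≠ G.t) (hr : G.Reaches (G.src e) G.t)
    (h : i < (cfg e).length ∨ G.Reaches (G.dst e) G.t) :
    (G.chunkedGraph cfg).dist (G.chunkPoint cfg e i) (Sum.inl G.t) = G.chunkDist cfg e i := by
  rw [← vertexDist_chunkPoint cfg e i h, dist_chunkedGraph hcfg (isProper_chunkPoint e hi)]
  · by_cases hil : i < (cfg e).length
    · rw [chunkPoint, if_pos hil]; exact hr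
    · rw [chunkPoint, if_neg hil]; exact h.resolve_left hil
  · by_cases hil : i < (cfg e).length
    · rw [chunkPoint, if_pos hil]; exact Or.inr hu
    · rw [chunkPoint, if_neg hil]; exact Or.inl ⟨_, rfl⟩

lemma perceived_chunkEdge (hcfg : G.IsChunkedBy cfg) (b : ℝ) (e : Fin m) {i : ℕ}
    (hi : i < (cfg e).length) (hu : G.src e ≠ G.t) (hr : G.Reaches (G.src e) G.t)
    (h : i + 1 < (cfg e).length ∨ G.Reaches (G.dst e) G.t) :
    (G.chunkedGraph cfg).perceived b (Sum.inl G.t) (G.chunkEdge e i) =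
      b * (cfg e).getD i 0 + G.chunkDist cfg e (i + 1) := by
  rw [WDigraph.perceived, cost_chunkEdge e i (List.ne_nil_of_length_pos (by omega)),
    dst_chunkEdge, dist_chunkPoint hcfg e (by omega) hu hr h]

lemma isChunkedBy_chunkOnly {e : Fin m} {l : ℕ} {xs : List ℝ} (h : IsChunking (G.cost e) l xs) :
    G.IsChunkedBy (chunkOnly e xs) := by
  intro f hf
  by_cases hfe : f = e
  · subst hfe
    simp only [chunkOnly, Function.update_self]
    exact ⟨rfl, h.2⟩
  · simp [chunkOnly, hfe] at hf

/-- The bottleneck depends on the graph only through `du` and `dv`; this is why these numbers are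
all that the subroutine has to be given. -/
lemma bottleneck_le_iff (b : ℝ) {e : Fin m} {l : ℕ} {xs : List ℝ}
    (h : IsChunking (G.cost e) l xs) (hl : 1 ≤ l) (hr : G.Reaches (G.dst e) G.t) (β : ℝ) :
    G.bottleneck b e xs ≤ β ↔
      ChunksWithin b (G.dist (G.src e) G.t) (G.dist (G.dst e) G.t) β xs := by
  rw [chunksWithin_iff]
  have hlen : 0 < xs.length := by rw [h.1]; omega
  have hx : chunkOnly e xs e = xs := by simp [chunkOnly]
  have hval : ∀ i : Fin xs.length,
      (G.chunkedGraph (chunkOnly e xs)).perceived b (Sum.inl G.t) (G.chunkEdge e i) =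
      b * xs.getD i 0 + tailCost (G.dist (G.src e) G.t) (G.dist (G.dst e) G.t)
        (xs.drop (i + 1)) := by
    intro i
    rw [perceived_chunkEdge (isChunkedBy_chunkOnly h) b e (by rw [hx]; exact i.2)
      (G.src_ne_target hr) hr.of_edge (Or.inr hr), hx, chunkDist, if_pos hr, hx]
  have : Nonempty (Fin xs.length) := ⟨⟨0, hlen⟩⟩
  unfold bottleneck
  constructor
  · intro hle i hi
    refine le_trans ?_ hle
    rw [← hval ⟨i, hi⟩]
    exact le_ciSup (f := fun i : Fin xs.length =>
      (G.chunkedGraph (chunkOnly e xs)).perceived b (Sum.inl G.t) (G.chunkEdge e i))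
      (Set.finite_range _).bddAbove ⟨i, hi⟩
  · intro hle
    refine ciSup_le fun i => ?_
    rw [hval]
    exact hle i i.2

end TaskGraph

/-! ### Routes of the agent and walks along which it can be guided. -/

namespace TaskGraph

variable {n m : ℕ} (G : TaskGraph n m)

/-- The agent never prefers another edge at the tail of `e` to a chunk of `xs`. -/
def IsGuiding (b : ℝ) (e : Fin m) (xs : List ℝ) : Prop :=
  ∀ f ∈ G.options G.t (G.src e),
    ChunksWithin b (G.dist (G.src e) G.t) (G.dist (G.dst e) G.t) (G.perceived b G.t f) xs

/-- The agent can be made to follow `e` with the help of at most `l` chunks. -/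
def Guides (b : ℝ) (e : Fin m) (l : ℕ) : Prop :=
  G.Reaches (G.dst e) G.t ∧
    (G.IsDefault b e ∨ 1 ≤ l ∧ ∃ xs, IsChunking (G.cost e) l xs ∧ G.IsGuiding b e xs)

variable {G} {b : ℝ} {cfg : ChunkConfig m}

lemma Guides.mono (hb : 1 ≤ b) {e : Fin m} {l l' : ℕ} (h : G.Guides b e l) (hl : l ≤ l') :
    G.Guides b e l' := by
  refine ⟨h.1, h.2.imp_right fun ⟨h1, xs, hc, hx⟩ => ⟨h1.trans hl, ?_⟩⟩
  -- The longer chunking is produced for one bound, so the bound is taken to be the least perceived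
  -- cost of an option.
  obtain ⟨f, hf, hmin⟩ := Set.exists_min_image _ (G.perceived b G.t)
    (Set.toFinite (G.options G.t (G.src e)))
    ⟨e, rfl, h.1⟩
  obtain ⟨ys, hy, hy'⟩ := ChunksWithin.exists_of_le hb h1 hl (G.dist_src_le h.1) ⟨xs, hc, hx f hf⟩
  exact ⟨ys, hy, fun g hg => hy'.mono (hmin g hg)⟩

lemma mem_options_of_not_chunk (hcfg : G.IsChunkedBy cfg) {ε : G.ChunkEdge}
    (hx : IsProper cfg ε.1.1) (hch : ¬ G.IsChunkEdge cfg ε) :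
    ε ∈ (G.chunkedGraph cfg).options (Sum.inl G.t) ε.1.1 ↔
      ε.1.2 ∈ G.options G.t (G.home ε.1.1) := by
  rcases edge_cases ε hx with h | ⟨-, hc, hd⟩
  · exact absurd h.1 hch
  · simp only [WDigraph.options, Set.mem_ofPred_eq, hd, src_eq_fst, true_and, ε.2]
    constructor
    · rintro ⟨p, hp⟩
      exact (le_walkCost (x := Sum.inl (G.dst ε.1.2)) hcfg trivial hp).1
    · intro h
      obtain ⟨p, hp, -⟩ := exists_walk_vertexDist (x := Sum.inl (G.dst ε.1.2)) hcfg trivial h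
        (Or.inl ⟨_, rfl⟩)
      exact ⟨p, hp⟩

lemma perceived_of_not_chunk (hcfg : G.IsChunkedBy cfg) {ε : G.ChunkEdge}
    (hx : IsProper cfg ε.1.1) (hch : ¬ G.IsChunkEdge cfg ε)
    (hr : G.Reaches (G.dst ε.1.2) G.t) :
    (G.chunkedGraph cfg).perceived b (Sum.inl G.t) ε = G.perceived b G.t ε.1.2 := by
  rcases edge_cases ε hx with h | ⟨-, hc, hd⟩
  · exact absurd h.1 hch
  · rw [WDigraph.perceived, WDigraph.perceived, hc, hd,
      dist_chunkedGraph (x := Sum.inl (G.dst ε.1.2)) hcfg trivial hr (Or.inl ⟨_, rfl⟩)]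
    rfl

/-- Chunking never makes an option look worse: of a chunked edge only one chunk is weighted by `b ≥
1`, and it together with the chunks after it costs at most as much as the edge. -/
lemma copy_mem_options (hb : 1 ≤ b) (hcfg : G.IsChunkedBy cfg) {ε : G.ChunkEdge}
    (hx : IsProper cfg ε.1.1) (hr : G.Reaches (G.dst ε.1.2) G.t) :
    ε ∈ (G.chunkedGraph cfg).options (Sum.inl G.t) ε.1.1 ∧
      (G.chunkedGraph cfg).perceived b (Sum.inl G.t) ε ≤ G.perceived b G.t ε.1.2 := by
  by_cases hch : G.IsChunkEdge cfg ε
  · rcases edge_cases ε hx with ⟨-, hne, i, hi, hε⟩ | h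
    · generalize ε.1.2 = e at *
      subst hε
      have hu := G.src_ne_target hr
      refine ⟨⟨rfl, ?_⟩, ?_⟩
      · rw [dst_chunkEdge, reaches_chunkPoint hcfg e (by omega) hu hr.of_edge]
        exact Or.inr hr
      · rw [perceived_chunkEdge hcfg b e hi hu hr.of_edge (Or.inr hr), WDigraph.perceived]
        have h1 := chunkDist_le_sum (cfg := cfg) e (i + 1) hr
        have h2 : (cfg e).getD i 0 + ((cfg e).drop (i + 1)).sum ≤ G.cost e := by
          rw [← (hcfg e hne).2.2, List.getD_eq_getElem _ _ hi, ← List.sum_cons,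
            ← List.drop_eq_getElem_cons hi]
          exact (List.drop_sublist i (cfg e)).sum_le_sum (hcfg.nonneg e)
        have h3 : 0 ≤ ((cfg e).drop (i + 1)).sum :=
          List.sum_nonneg fun x hx => hcfg.nonneg e x (List.mem_of_mem_drop hx)
        have h4 := mul_le_mul_of_nonneg_left h2 (zero_le_one.trans hb)
        have h5 := le_mul_of_one_le_left h3 hb
        linarith
    · exact absurd hch h.1
  · refine ⟨(mem_options_of_not_chunk hcfg hx hch).2 ⟨ε.2, hr⟩, ?_⟩
    rw [perceived_of_not_chunk hcfg hx hch hr]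

/-- The picked edge is perceived as in the task graph, while every competitor has a copy that looks
at least as good. So an edge that wins in the chunked graph wins in the task graph, ties included.
-/
lemma isDefault_of_picks (hb : 1 ≤ b) (hcfg : G.IsChunkedBy cfg) {ε : G.ChunkEdge}
    (hx : IsProper cfg ε.1.1) (hch : ¬ G.IsChunkEdge cfg ε)
    (h : (G.chunkedGraph cfg).Picks b (Sum.inl G.t) (G.IsChunkEdge cfg) G.tieRank ε.1.1 ε) :
    G.IsDefault b ε.1.2 := by
  have ho := (mem_options_of_not_chunk hcfg hx hch).1 h.1.1
  have hp := perceived_of_not_chunk (b := b) hcfg hx hch ho.2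
  have hcopy : ∀ f ∈ G.options G.t (G.src ε.1.2), ∃ φ : G.ChunkEdge, φ.1.2 = f ∧
      φ.1.1 = ε.1.1 ∧ φ ∈ (G.chunkedGraph cfg).options (Sum.inl G.t) ε.1.1 ∧
      (G.chunkedGraph cfg).perceived b (Sum.inl G.t) φ ≤ G.perceived b G.t f := by
    intro f hf
    let φ : G.ChunkEdge := ⟨(ε.1.1, f), by rw [← ε.2]; exact hf.1⟩
    have := copy_mem_options (ε := φ) hb hcfg hx hf.2
    exact ⟨φ, rfl, rfl, this.1, this.2⟩
  refine ⟨⟨⟨rfl, ho.2⟩, fun f hf => ?_⟩, fun f hf => ?_⟩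
  · obtain ⟨φ, -, -, h1, h2⟩ := hcopy f hf
    rw [← hp]
    exact (h.1.2 φ h1).trans h2
  · obtain ⟨φ, hφ, -, h1, h2⟩ := hcopy f hf.1
    -- The copy of an edge that ties in the task graph ties here as well. As the picked edge is not
    -- a chunk, the tie was broken by the order of the heads.
    have hbest : φ ∈ (G.chunkedGraph cfg).best b (Sum.inl G.t) ε.1.1 := by
      refine ⟨h1, fun ψ hψ => h2.trans ((hf.2 ε.1.2 ⟨rfl, ho.2⟩).trans ?_)⟩
      rw [← hp]
      exact h.1.2 ψ hψ
    rcases h.2 with h3 | h3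
    · exact absurd h3.1 hch
    · have := h3.2 φ hbest
      rw [← hφ]
      exact this

lemma perceived_chunk_le (hb : 1 ≤ b) (hcfg : G.IsChunkedBy cfg) {ε : G.ChunkEdge}
    (hx : IsProper cfg ε.1.1)
    (h : ε ∈ (G.chunkedGraph cfg).best b (Sum.inl G.t) ε.1.1)
    (f : Fin m) (hf : f ∈ G.options G.t (G.home ε.1.1)) :
    (G.chunkedGraph cfg).perceived b (Sum.inl G.t) ε ≤ G.perceived b G.t f := by
  let φ : G.ChunkEdge := ⟨(ε.1.1, f), hf.1⟩
  have := copy_mem_options (ε := φ) hb hcfg hx hf.2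
  exact (h.2 φ this.1).trans this.2

/-- From inside a chunked edge, the agent either completes it or leaves it by the default edge. -/
lemma route_from_chunk (hb : 1 ≤ b) (hcfg : G.IsChunkedBy cfg) (e : Fin m) {i : ℕ}
    (hi : 1 ≤ i) (hil : i < (cfg e).length) {p : List G.ChunkEdge}
    (hp : (G.chunkedGraph cfg).AgentRoute b (Sum.inl G.t) (G.IsChunkEdge cfg) G.tieRank
      (Sum.inr (e, i)) p) :
    (∃ q, q.length < p.length ∧ (G.chunkedGraph cfg).AgentRoute b (Sum.inl G.t)
        (G.IsChunkEdge cfg) G.tieRank (Sum.inl (G.dst e)) q ∧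
      ((cfg e).drop i).sum + (G.chunkedGraph cfg).walkCost q ≤ (G.chunkedGraph cfg).walkCost p ∧
      ∀ f ∈ G.options G.t (G.src e), ∀ j, i ≤ j → j < (cfg e).length →
        b * (cfg e).getD j 0 + G.chunkDist cfg e (j + 1) ≤ G.perceived b G.t f) ∨
    (∃ g q, q.length < p.length ∧ G.src g = G.src e ∧ G.IsDefault b g ∧
      (G.chunkedGraph cfg).AgentRoute b (Sum.inl G.t)
        (G.IsChunkEdge cfg) G.tieRank (Sum.inl (G.dst g)) q ∧
      G.cost g + (G.chunkedGraph cfg).walkCost q ≤ (G.chunkedGraph cfg).walkCost p) := by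
  have hne : cfg e ≠ [] := List.ne_nil_of_length_pos (by omega)
  obtain ⟨d, hd⟩ : ∃ d, (cfg e).length = i + 1 + d := ⟨(cfg e).length - (i + 1), by omega⟩
  induction d generalizing i p with
  | zero =>
    cases p with
    | nil => simp [WDigraph.AgentRoute] at hp
    | cons ε p =>
      obtain ⟨-, hpick, hroute⟩ := hp
      have hs : ε.1.1 = Sum.inr (e, i) := hpick.1.1.1
      have hx : IsProper cfg ε.1.1 := by rw [hs]; exact ⟨hi, hil⟩
      have hhome : G.src ε.1.2 = G.src e := by rw [ε.2, hs]; rfl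
      rw [← hs] at hpick
      by_cases hch : G.IsChunkEdge cfg ε
      · have hε : ε = G.chunkEdge e i := by
          obtain ⟨⟨x, f⟩, hf⟩ := ε
          obtain rfl : x = Sum.inr (e, i) := hs
          obtain rfl : f = e := hch
          apply Subtype.ext
          rw [chunkEdge_val]
          simp [chunkStart, Nat.ne_zero_of_lt hi]
        have hdst : G.chunkPoint cfg e (i + 1) = Sum.inl (G.dst e) := by
          rw [chunkPoint, if_neg (by omega)]
        left
        have hle := perceived_chunk_le hb hcfg hx hpick.1
        subst hε
        rw [dst_chunkEdge, hdst] at hroute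
        have hreach : G.Reaches (G.dst e) G.t :=
          (le_walkCost (x := Sum.inl (G.dst e)) hcfg trivial hroute.isWalk).1
        refine ⟨p, by simp, hroute, ?_, fun f hf j hj hj' => ?_⟩
        · rw [List.drop_eq_getElem_cons hil, List.drop_eq_nil_iff.2 (by omega),
            WDigraph.walkCost_cons, cost_chunkEdge e i hne]
          simp [hil]
        · obtain rfl : j = i := by omega
          rw [← perceived_chunkEdge hcfg b e hil (G.src_ne_target hreach) hreach.of_edge
            (Or.inr hreach)]
          refine hle f ?_
          rw [← (G.chunkEdge e j).2, hhome]
          exact hf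
      · right
        have hdef := isDefault_of_picks hb hcfg hx hch hpick
        rcases edge_cases ε hx with h | ⟨-, hc, hd'⟩
        · exact absurd h.1 hch
        · rw [hd'] at hroute
          exact ⟨ε.1.2, p, by simp, hhome, hdef, hroute, by rw [WDigraph.walkCost_cons, hc]⟩
  | succ d ih =>
    cases p with
    | nil => simp [WDigraph.AgentRoute] at hp
    | cons ε p =>
      obtain ⟨-, hpick, hroute⟩ := hp
      have hs : ε.1.1 = Sum.inr (e, i) := hpick.1.1.1
      have hx : IsProper cfg ε.1.1 := by rw [hs]; exact ⟨hi, hil⟩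
      have hhome : G.src ε.1.2 = G.src e := by rw [ε.2, hs]; rfl
      rw [← hs] at hpick
      by_cases hch : G.IsChunkEdge cfg ε
      · have hε : ε = G.chunkEdge e i := by
          obtain ⟨⟨x, f⟩, hf⟩ := ε
          obtain rfl : x = Sum.inr (e, i) := hs
          obtain rfl : f = e := hch
          apply Subtype.ext
          rw [chunkEdge_val]
          simp [chunkStart, Nat.ne_zero_of_lt hi]
        have hdst : G.chunkPoint cfg e (i + 1) = Sum.inr (e, i + 1) := by
          rw [chunkPoint, if_pos (by omega)]
        have hle := perceived_chunk_le hb hcfg hx hpick.1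
        have hx0 : 0 ≤ (cfg e).getD i 0 := by
          rw [List.getD_eq_getElem _ _ hil]; exact hcfg.nonneg e _ (List.getElem_mem hil)
        subst hε
        rw [dst_chunkEdge, hdst] at hroute
        have hcost := cost_chunkEdge (G := G) (cfg := cfg) e i hne
        rcases ih (i := i + 1) (by omega) (by omega) hroute (by omega) with
          ⟨q, hq, hqr, hqc, hqp⟩ | ⟨g, q, hq, hg, hgd, hqr, hqc⟩
        · left
          have hreach : G.Reaches (G.dst e) G.t :=
            (le_walkCost (x := Sum.inl (G.dst e)) hcfg trivial hqr.isWalk).1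
          refine ⟨q, by simp; omega, hqr, ?_, fun f hf j hj hj' => ?_⟩
          · rw [List.drop_eq_getElem_cons hil, WDigraph.walkCost_cons, hcost, List.sum_cons,
              List.getD_eq_getElem _ _ hil]
            linarith
          · rcases hj.eq_or_lt with rfl | hlt
            · rw [← perceived_chunkEdge hcfg b e hil (G.src_ne_target hreach) hreach.of_edge
                (Or.inr hreach)]
              refine hle f ?_
              rw [← (G.chunkEdge e i).2, hhome]
              exact hf
            · exact hqp f hf j hlt hj'
        · right
          exact ⟨g, q, by simp; omega, hg, hgd, hqr, by
            rw [WDigraph.walkCost_cons, hcost]; linarith⟩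
      · right
        have hdef := isDefault_of_picks hb hcfg hx hch hpick
        rcases edge_cases ε hx with h | ⟨-, hc, hd'⟩
        · exact absurd h.1 hch
        · rw [hd'] at hroute
          exact ⟨ε.1.2, p, by simp, hhome, hdef, hroute, by rw [WDigraph.walkCost_cons, hc]⟩

/-- The route of the agent in a chunked graph costs at least as much as some walk of the task graph
along which the agent can be guided with the chunks used. -/
theorem exists_walk_of_route (hb : 1 ≤ b) (hcfg : G.IsChunkedBy cfg) {u : Fin n}
    {p : List G.ChunkEdge}
    (hp : (G.chunkedGraph cfg).AgentRoute b (Sum.inl G.t) (G.IsChunkEdge cfg) G.tieRank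
      (Sum.inl u) p) :
    ∃ q, G.IsWalk u q G.t ∧ G.walkCost q ≤ (G.chunkedGraph cfg).walkCost p ∧
      ∀ e ∈ q, G.Guides b e (cfg e).length := by
  -- The induction is on the length of the route, since passing a chunked edge consumes several of
  -- its edges at once.
  induction hN : p.length using Nat.strong_induction_on generalizing u p with
  | _ N ih =>
  cases p with
  | nil =>
    have : u = G.t := by simpa [WDigraph.AgentRoute] using hp
    exact ⟨[], this, by simp, by simp⟩
  | cons ε p =>
    obtain ⟨-, hpick, hroute⟩ := hp
    have hs : ε.1.1 = Sum.inl u := hpick.1.1.1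
    have hx : IsProper cfg ε.1.1 := by rw [hs]; trivial
    have hhome : G.src ε.1.2 = u := by rw [ε.2, hs]; rfl
    rw [← hs] at hpick
    simp only [List.length_cons] at hN
    by_cases hch : G.IsChunkEdge cfg ε
    · obtain ⟨e, he⟩ : ∃ e, ε.1.2 = e := ⟨_, rfl⟩
      have hce : cfg e ≠ [] := by
        rcases edge_cases ε hx with h | h
        · rw [← he]; exact h.2.1
        · exact absurd hch h.1
      have hε : ε = G.chunkEdge e 0 := by
        apply Subtype.ext
        rw [chunkEdge_val, ← he]
        simp only [chunkStart, if_true, hhome, ← hs]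
      have hlen := List.length_pos_of_ne_nil hce
      have hle := perceived_chunk_le hb hcfg hx hpick.1
      have hcost := cost_chunkEdge (G := G) (cfg := cfg) e 0 hce
      have hhome' : G.home ε.1.1 = G.src e := by rw [← ε.2, he]
      have hsum : (cfg e).getD 0 0 + ((cfg e).drop 1).sum = G.cost e := by
        rw [← (hcfg e hce).2.2]
        cases h : cfg e with
        | nil => exact absurd h hce
        | cons x ys => simp
      have hx0 : 0 ≤ (cfg e).getD 0 0 := by
        rw [List.getD_eq_getElem _ _ hlen]; exact hcfg.nonneg e _ (List.getElem_mem hlen)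
      rw [hhome'] at hle
      rw [he] at hhome
      subst hε
      rw [dst_chunkEdge] at hroute
      -- After the first chunk, the edge is either completed, all further chunks being optimal
      -- choices, or left by the default edge of its tail. A chunking into a single chunk is
      -- completed at once.
      have key : (∃ q, q.length < N ∧ (G.chunkedGraph cfg).AgentRoute b (Sum.inl G.t)
            (G.IsChunkEdge cfg) G.tieRank (Sum.inl (G.dst e)) q ∧
          ((cfg e).drop 1).sum + (G.chunkedGraph cfg).walkCost q ≤
            (G.chunkedGraph cfg).walkCost p ∧
          ∀ f ∈ G.options G.t (G.src e), ∀ j, 1 ≤ j → j < (cfg e).length →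
            b * (cfg e).getD j 0 + G.chunkDist cfg e (j + 1) ≤ G.perceived b G.t f) ∨
        (∃ g q, q.length < N ∧ G.src g = G.src e ∧ G.IsDefault b g ∧
          (G.chunkedGraph cfg).AgentRoute b (Sum.inl G.t)
            (G.IsChunkEdge cfg) G.tieRank (Sum.inl (G.dst g)) q ∧
          G.cost g + (G.chunkedGraph cfg).walkCost q ≤ (G.chunkedGraph cfg).walkCost p) := by
        by_cases h1 : 1 < (cfg e).length
        · rw [chunkPoint, if_pos h1] at hroute
          rcases route_from_chunk hb hcfg e le_rfl h1 hroute with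
            ⟨q, hq, h⟩ | ⟨g, q, hq, h⟩
          · exact Or.inl ⟨q, by omega, h⟩
          · exact Or.inr ⟨g, q, by omega, h⟩
        · rw [chunkPoint, if_neg (by omega)] at hroute
          refine Or.inl ⟨p, by omega, hroute, ?_, fun f hf j hj hj' => by omega⟩
          rw [List.drop_eq_nil_iff.2 (by omega)]
          simp
      rcases key with ⟨q, hq, hqr, hqc, hqp⟩ | ⟨g, q, hq, hg, hgd, hqr, hqc⟩
      · obtain ⟨r, hr, hrc, hrg⟩ := ih _ hq hqr rfl
        have hreach : G.Reaches (G.dst e) G.t := ⟨r, hr⟩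
        refine ⟨e :: r, ⟨hhome, hr⟩, ?_, ?_⟩
        · rw [WDigraph.walkCost_cons, WDigraph.walkCost_cons, hcost]
          linarith
        · intro f hf
          rcases List.mem_cons.1 hf with rfl | hf
          · refine ⟨hreach, Or.inr ⟨hlen, cfg f, hcfg f hce, fun g hg => ?_⟩⟩
            rw [chunksWithin_iff]
            intro j hj
            have hcd : ∀ j, G.chunkDist cfg f j = tailCost (G.dist (G.src f) G.t)
                (G.dist (G.dst f) G.t) ((cfg f).drop j) := fun j => by
              rw [chunkDist, if_pos hreach]
            rw [← hcd]
            rcases Nat.eq_zero_or_pos j with rfl | hj0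
            · rw [← perceived_chunkEdge hcfg b f hlen (G.src_ne_target hreach) hreach.of_edge
                (Or.inr hreach)]
              exact hle g hg
            · exact hqp g hg j hj0 hj
          · exact hrg f hf
      -- The edge was abandoned: going along the default edge `g` right from the tail saves the
      -- completed chunks.
      · obtain ⟨r, hr, hrc, hrg⟩ := ih _ hq hqr rfl
        refine ⟨g :: r, ⟨hg.trans hhome, hr⟩, ?_, ?_⟩
        · rw [WDigraph.walkCost_cons, WDigraph.walkCost_cons, hcost]
          linarith
        · intro f hf
          rcases List.mem_cons.1 hf with rfl | hf
          · exact ⟨⟨r, hr⟩, Or.inl hgd⟩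
          · exact hrg f hf
    · have hdef := isDefault_of_picks hb hcfg hx hch hpick
      rcases edge_cases ε hx with h | ⟨-, hc, hd⟩
      · exact absurd h.1 hch
      · rw [hd] at hroute
        obtain ⟨r, hr, hrc, hrg⟩ := ih _ (by omega) hroute rfl
        refine ⟨ε.1.2 :: r, ⟨hhome, hr⟩, ?_, ?_⟩
        · rw [WDigraph.walkCost_cons, WDigraph.walkCost_cons, hc]
          linarith
        · intro f hf
          rcases List.mem_cons.1 hf with rfl | hf
          · exact ⟨⟨r, hr⟩, Or.inl hdef⟩
          · exact hrg f hf

/-- With nothing chunked at the tail, the options are perceived as in the task graph, and only the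
order of the heads breaks ties. -/
lemma picks_default (hcfg : G.IsChunkedBy cfg) {e : Fin m} (he : G.IsDefault b e)
    (hnone : ∀ f, G.src f = G.src e → cfg f = []) :
    (G.chunkedGraph cfg).Picks b (Sum.inl G.t) (G.IsChunkEdge cfg) G.tieRank
      (Sum.inl (G.src e)) ⟨(Sum.inl (G.src e), e), rfl⟩ := by
  have hnc : ∀ ε : G.ChunkEdge, ε.1.1 = Sum.inl (G.src e) → ¬ G.IsChunkEdge cfg ε := by
    rintro ⟨⟨x, f⟩, hf⟩ rfl
    simpa [IsChunkEdge] using hnone f hf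
  have hopt : ∀ ε ∈ (G.chunkedGraph cfg).options (Sum.inl G.t) (Sum.inl (G.src e)),
      ε.1.2 ∈ G.options G.t (G.src e) ∧
      (G.chunkedGraph cfg).perceived b (Sum.inl G.t) ε = G.perceived b G.t ε.1.2 := by
    intro ε hε
    have hs : ε.1.1 = Sum.inl (G.src e) := hε.1
    have hx : IsProper cfg ε.1.1 := by rw [hs]; trivial
    have hε' := hε
    rw [← hs, mem_options_of_not_chunk hcfg hx (hnc ε hs), hs] at hε'
    exact ⟨hε', perceived_of_not_chunk hcfg hx (hnc ε hs) hε'.2⟩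
  have hself : (⟨(Sum.inl (G.src e), e), rfl⟩ : G.ChunkEdge) ∈
      (G.chunkedGraph cfg).options (Sum.inl G.t) (Sum.inl (G.src e)) :=
    (mem_options_of_not_chunk (ε := ⟨(Sum.inl (G.src e), e), rfl⟩) hcfg trivial
      (hnc _ rfl)).2 he.1.1
  refine ⟨⟨hself, fun ε hε => ?_⟩, Or.inr ⟨?_, fun ε hε => ?_⟩⟩
  · rw [(hopt _ hself).2, (hopt _ hε).2]
    exact he.1.2 _ (hopt _ hε).1
  · rintro ⟨ε, ⟨hε, hc⟩, -⟩
    exact hnc ε hε.1.1 hc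
  · refine he.2 ε.1.2 ⟨(hopt _ hε.1).1, fun f hf => ?_⟩
    rw [← (hopt _ hε.1).2]
    refine (hε.2 _ hself).trans ?_
    rw [(hopt _ hself).2]
    exact he.1.2 f hf

/-- The next chunk has least perceived cost because the chunking is guiding. As the siblings are
unchunked, it is the only chunk on offer, hence it wins all ties. -/
lemma picks_chunk (hcfg : G.IsChunkedBy cfg) {e : Fin m} (hr : G.Reaches (G.dst e) G.t)
    (hg : G.IsGuiding b e (cfg e))
    (hnone : ∀ f, G.src f = G.src e → f ≠ e → cfg f = []) {i : ℕ} (hi : i < (cfg e).length) :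
    (G.chunkedGraph cfg).Picks b (Sum.inl G.t) (G.IsChunkEdge cfg) G.tieRank
      (G.chunkStart e i) (G.chunkEdge e i) := by
  have hne : cfg e ≠ [] := List.ne_nil_of_length_pos (by omega)
  have hu := G.src_ne_target hr
  -- At the tail this uses that the siblings are unchunked; at an inner vertex the other edges are
  -- never chunks.
  have huniq : ∀ ε : G.ChunkEdge, ε.1.1 = G.chunkStart e i → G.IsChunkEdge cfg ε →
      ε = G.chunkEdge e i := by
    intro ε hs hc
    apply Subtype.ext
    rw [chunkEdge_val]
    refine Prod.ext hs ?_
    have hsrc : G.src ε.1.2 = G.src e := by rw [ε.2, hs, home_chunkStart]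
    obtain ⟨⟨x, f⟩, hf⟩ := ε
    obtain rfl : x = _ := hs
    by_contra hfe
    unfold chunkStart IsChunkEdge at hc
    split_ifs at hc with h0
    · exact hc (hnone f hsrc hfe)
    · exact hfe hc
  have hself : G.chunkEdge e i ∈
      (G.chunkedGraph cfg).options (Sum.inl G.t) (G.chunkStart e i) := by
    refine ⟨src_chunkEdge e i, ?_⟩
    rw [dst_chunkEdge, reaches_chunkPoint hcfg e (by omega) hu hr.of_edge]
    exact Or.inr hr
  refine ⟨⟨hself, fun ε hε => ?_⟩,
    Or.inl ⟨isChunkEdge_chunkEdge e i hne, fun ε hε hc => huniq ε hε.1.1 hc⟩⟩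
  have hs : ε.1.1 = G.chunkStart e i := hε.1
  by_cases hc : G.IsChunkEdge cfg ε
  · rw [huniq ε hs hc]
  · have hx : IsProper cfg ε.1.1 := by rw [hs]; exact isProper_chunkStart e hi
    have hε' := hε
    rw [← hs, mem_options_of_not_chunk hcfg hx hc, hs, home_chunkStart] at hε'
    rw [perceived_of_not_chunk hcfg hx hc hε'.2,
      perceived_chunkEdge hcfg b e hi hu hr.of_edge (Or.inr hr)]
    have := (chunksWithin_iff _ _ _ _ _).1 (hg _ hε') i hi
    rwa [chunkDist, if_pos hr]

lemma chunkStart_ne_target {e : Fin m} (hu : G.src e ≠ G.t) (i : ℕ) :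
    G.chunkStart e i ≠ Sum.inl G.t := by
  unfold chunkStart
  split_ifs
  · simpa using hu
  · simp

lemma exists_route_chunks (hcfg : G.IsChunkedBy cfg) {e : Fin m}
    (hr : G.Reaches (G.dst e) G.t) (hg : G.IsGuiding b e (cfg e))
    (hnone : ∀ f, G.src f = G.src e → f ≠ e → cfg f = []) {i : ℕ} (hi : i < (cfg e).length)
    {q : List G.ChunkEdge}
    (hq : (G.chunkedGraph cfg).AgentRoute b (Sum.inl G.t) (G.IsChunkEdge cfg) G.tieRank
      (Sum.inl (G.dst e)) q) :
    ∃ p, (G.chunkedGraph cfg).AgentRoute b (Sum.inl G.t) (G.IsChunkEdge cfg) G.tieRank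
      (G.chunkStart e i) p ∧
      (G.chunkedGraph cfg).walkCost p =
        ((cfg e).drop i).sum + (G.chunkedGraph cfg).walkCost q := by
  have hne : cfg e ≠ [] := List.ne_nil_of_length_pos (by omega)
  have hu := G.src_ne_target hr
  obtain ⟨d, hd⟩ : ∃ d, (cfg e).length = i + 1 + d := ⟨(cfg e).length - (i + 1), by omega⟩
  induction d generalizing i with
  | zero =>
    refine ⟨G.chunkEdge e i :: q, ⟨chunkStart_ne_target hu i,
      picks_chunk hcfg hr hg hnone hi, ?_⟩, ?_⟩
    · rw [dst_chunkEdge, chunkPoint, if_neg (by omega)]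
      exact hq
    · rw [List.drop_eq_getElem_cons hi, List.drop_eq_nil_iff.2 (by omega)]
      simp [cost_chunkEdge e i hne, hi]
  | succ d ih =>
    obtain ⟨p, hp, hc⟩ := ih (i := i + 1) (by omega) (by omega)
    refine ⟨G.chunkEdge e i :: p, ⟨chunkStart_ne_target hu i,
      picks_chunk hcfg hr hg hnone hi, ?_⟩, ?_⟩
    · rw [dst_chunkEdge, chunkPoint, if_pos (by omega)]
      simpa [chunkStart] using hp
    · rw [List.drop_eq_getElem_cons hi, WDigraph.walkCost_cons, hc]
      simp [cost_chunkEdge e i hne, hi, add_assoc]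

/-- A walk of the task graph whose edges are default edges or carry guiding chunkings, all other
edges being unchunked, is followed by the agent. -/
theorem exists_route_of_walk (hcfg : G.IsChunkedBy cfg) {u : Fin n} {p : List (Fin m)}
    (hp : G.IsWalk u p G.t)
    (hguide : ∀ e ∈ p, cfg e = [] ∧ G.IsDefault b e ∨ cfg e ≠ [] ∧ G.IsGuiding b e (cfg e))
    (hnone : ∀ e ∈ p, ∀ f, G.src f = G.src e → f ≠ e → cfg f = []) :
    ∃ q, (G.chunkedGraph cfg).AgentRoute b (Sum.inl G.t) (G.IsChunkEdge cfg) G.tieRank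
      (Sum.inl u) q ∧ (G.chunkedGraph cfg).walkCost q = G.walkCost p := by
  induction p generalizing u with
  | nil =>
    obtain rfl : u = G.t := hp
    exact ⟨[], rfl, by simp⟩
  | cons e p ih =>
    obtain ⟨q, hq, hc⟩ := ih hp.2 (fun f hf => hguide f (by simp [hf]))
      (fun f hf => hnone f (by simp [hf]))
    obtain rfl : G.src e = u := hp.1
    have hr : G.Reaches (G.dst e) G.t := ⟨p, hp.2⟩
    rcases hguide e (by simp) with ⟨h1, h2⟩ | ⟨h1, h2⟩
    · refine ⟨⟨(Sum.inl (G.src e), e), rfl⟩ :: q, ⟨?_, picks_default hcfg h2 fun f hf => ?_, ?_⟩, ?_⟩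
      · simpa using G.src_ne_target hr
      · by_cases hfe : f = e
        · rw [hfe]; exact h1
        · exact hnone e (by simp) f hf hfe
      · simpa [chunkedGraph, chunkPoint, h1] using hq
      · rw [WDigraph.walkCost_cons, hc, WDigraph.walkCost_cons]
        simp [chunkedGraph, h1]
    · obtain ⟨r, hr', hrc⟩ := exists_route_chunks hcfg hr h2 (hnone e (by simp))
        (List.length_pos_of_ne_nil h1) hq
      refine ⟨r, hr', ?_⟩
      rw [hrc, hc, List.drop_zero, (hcfg e h1).2.2, WDigraph.walkCost_cons]

end TaskGraph

/-! ## Reasoning about programs -/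

namespace Store

@[simp] lemma nat_setNat (σ : Store) (x v y : ℕ) :
    (σ.setNat x v).nat y = if y = x then v else σ.nat y := by
  simp [setNat, Function.update_apply]

@[simp] lemma real_setNat (σ : Store) (x v : ℕ) : (σ.setNat x v).real = σ.real := rfl

@[simp] lemma natArr_setNat (σ : Store) (x v : ℕ) : (σ.setNat x v).natArr = σ.natArr := rfl

@[simp] lemma realArr_setNat (σ : Store) (x v : ℕ) : (σ.setNat x v).realArr = σ.realArr := rfl

@[simp] lemma real_setReal (σ : Store) (x : ℕ) (v : ℝ) (y : ℕ) :
    (σ.setReal x v).real y = if y = x then v else σ.real y := by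
  simp [setReal, Function.update_apply]

@[simp] lemma nat_setReal (σ : Store) (x : ℕ) (v : ℝ) : (σ.setReal x v).nat = σ.nat := rfl

@[simp] lemma natArr_setReal (σ : Store) (x : ℕ) (v : ℝ) :
    (σ.setReal x v).natArr = σ.natArr := rfl

@[simp] lemma realArr_setReal (σ : Store) (x : ℕ) (v : ℝ) :
    (σ.setReal x v).realArr = σ.realArr := rfl

@[simp] lemma natArr_putNat (σ : Store) (a i v a' : ℕ) :
    (σ.putNat a i v).natArr a' =
      if a' = a then Function.update (σ.natArr a) i v else σ.natArr a' := by
  simp [putNat, Function.update_apply]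

@[simp] lemma nat_putNat (σ : Store) (a i v : ℕ) : (σ.putNat a i v).nat = σ.nat := rfl

@[simp] lemma real_putNat (σ : Store) (a i v : ℕ) : (σ.putNat a i v).real = σ.real := rfl

@[simp] lemma realArr_putNat (σ : Store) (a i v : ℕ) : (σ.putNat a i v).realArr = σ.realArr := rfl

@[simp] lemma realArr_putReal (σ : Store) (a i : ℕ) (v : ℝ) (a' : ℕ) :
    (σ.putReal a i v).realArr a' =
      if a' = a then Function.update (σ.realArr a) i v else σ.realArr a' := by
  simp [putReal, Function.update_apply]

@[simp] lemma nat_putReal (σ : Store) (a i : ℕ) (v : ℝ) : (σ.putReal a i v).nat = σ.nat := rfl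

@[simp] lemma real_putReal (σ : Store) (a i : ℕ) (v : ℝ) : (σ.putReal a i v).real = σ.real := rfl

@[simp] lemma natArr_putReal (σ : Store) (a i : ℕ) (v : ℝ) :
    (σ.putReal a i v).natArr = σ.natArr := rfl

@[simp] lemma realArr_setRealArr (σ : Store) (a : ℕ) (v : ℕ → ℝ) (a' : ℕ) :
    (σ.setRealArr a v).realArr a' = if a' = a then v else σ.realArr a' := by
  simp [setRealArr, Function.update_apply]

@[simp] lemma nat_setRealArr (σ : Store) (a : ℕ) (v : ℕ → ℝ) :
    (σ.setRealArr a v).nat = σ.nat := rfl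

@[simp] lemma real_setRealArr (σ : Store) (a : ℕ) (v : ℕ → ℝ) :
    (σ.setRealArr a v).real = σ.real := rfl

@[simp] lemma natArr_setRealArr (σ : Store) (a : ℕ) (v : ℕ → ℝ) :
    (σ.setRealArr a v).natArr = σ.natArr := rfl

end Store

namespace Cmd

/-- The natural variables that a program may change. -/
def natVars : Cmd → List ℕ
  | setNat x _ => [x]
  | seq p q => p.natVars ++ q.natVars
  | ite _ p q => p.natVars ++ q.natVars
  | loop _ p => p.natVars
  | _ => []

/-- The real variables that a program may change. -/
def realVars : Cmd → List ℕ
  | setReal x _ => [x]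
  | call _ _ _ _ _ r _ => [r]
  | seq p q => p.realVars ++ q.realVars
  | ite _ p q => p.realVars ++ q.realVars
  | loop _ p => p.realVars
  | _ => []

/-- The natural arrays that a program may change. -/
def natArrs : Cmd → List ℕ
  | putNat a _ _ => [a]
  | seq p q => p.natArrs ++ q.natArrs
  | ite _ p q => p.natArrs ++ q.natArrs
  | loop _ p => p.natArrs
  | _ => []

/-- The real arrays that a program may change. -/
def realArrs : Cmd → List ℕ
  | putReal a _ _ => [a]
  | call _ _ _ _ _ _ a => [a]
  | seq p q => p.realArrs ++ q.realArrs
  | ite _ p q => p.realArrs ++ q.realArrs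
  | loop _ p => p.realArrs
  | _ => []

/-- `p.Frame σ σ'`: the memories `σ` and `σ'` agree wherever `p` writes nothing. -/
structure Frame (p : Cmd) (σ σ' : Store) : Prop where
  nat : ∀ x, x ∉ p.natVars → σ'.nat x = σ.nat x
  real : ∀ x, x ∉ p.realVars → σ'.real x = σ.real x
  natArr : ∀ a, a ∉ p.natArrs → σ'.natArr a = σ.natArr a
  realArr : ∀ a, a ∉ p.realArrs → σ'.realArr a = σ.realArr a

lemma Frame.refl (p : Cmd) (σ : Store) : p.Frame σ σ :=
  ⟨fun _ _ => rfl, fun _ _ => rfl, fun _ _ => rfl, fun _ _ => rfl⟩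

lemma Frame.trans {p : Cmd} {σ σ₁ σ₂ : Store} (h₁ : p.Frame σ σ₁) (h₂ : p.Frame σ₁ σ₂) :
    p.Frame σ σ₂ :=
  ⟨fun x hx => (h₂.nat x hx).trans (h₁.nat x hx), fun x hx => (h₂.real x hx).trans (h₁.real x hx),
    fun x hx => (h₂.natArr x hx).trans (h₁.natArr x hx),
    fun x hx => (h₂.realArr x hx).trans (h₁.realArr x hx)⟩

/-- Weakest precondition of a program without loops and calls. -/
def wp : Cmd → (Store → Prop) → Store → Prop
  | skip, P, σ => P σ
  | setNat x e, P, σ => P (σ.setNat x (e.eval σ))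
  | setReal x e, P, σ => P (σ.setReal x (e.eval σ))
  | putNat a i e, P, σ => P (σ.putNat a (i.eval σ) (e.eval σ))
  | putReal a i e, P, σ => P (σ.putReal a (i.eval σ) (e.eval σ))
  | seq p q, P, σ => p.wp (q.wp P) σ
  | ite c p q, P, σ => (c.Holds σ → p.wp P σ) ∧ (¬ c.Holds σ → q.wp P σ)
  | loop _ _, _, _ => False
  | call _ _ _ _ _ _ _, _, _ => False

/-- Bound for the number of steps of a program without loops and calls. -/
def steps : Cmd → ℕ
  | skip => 1
  | setNat _ e => 1 + e.size
  | setReal _ e => 1 + e.size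
  | putNat _ i e => 1 + i.size + e.size
  | putReal _ i e => 1 + i.size + e.size
  | seq p q => p.steps + q.steps
  | ite c p q => 1 + c.size + (p.steps + q.steps)
  | loop _ _ => 0
  | call _ _ _ _ _ _ _ => 0

end Cmd

/-- The lists of written variables and arrays are computed from the program, so that a concrete
program leaves something untouched is settled by `decide`. -/
lemma Run.frame {sub : Store → Store → ℕ → Prop} {p : Cmd} {σ σ' : Store} {t c : ℕ}
    (h : Run sub p σ σ' t c) : p.Frame σ σ' := by
  induction h with
  | skip σ => exact Cmd.Frame.refl _ _
  | setNat σ x e =>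
    refine ⟨fun y hy => ?_, fun _ _ => rfl, fun _ _ => rfl, fun _ _ => rfl⟩
    simp_all [Cmd.natVars]
  | setReal σ x e =>
    refine ⟨fun _ _ => rfl, fun y hy => ?_, fun _ _ => rfl, fun _ _ => rfl⟩
    simp_all [Cmd.realVars]
  | putNat σ a i e =>
    refine ⟨fun _ _ => rfl, fun _ _ => rfl, fun y hy => ?_, fun _ _ => rfl⟩
    simp_all [Cmd.natArrs]
  | putReal σ a i e =>
    refine ⟨fun _ _ => rfl, fun _ _ => rfl, fun _ _ => rfl, fun y hy => ?_⟩
    simp_all [Cmd.realArrs]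
  | seq _ _ ih₁ ih₂ =>
    refine ⟨fun y hy => ?_, fun y hy => ?_, fun y hy => ?_, fun y hy => ?_⟩
    · simp only [Cmd.natVars, List.mem_append, not_or] at hy
      rw [ih₂.nat y hy.2, ih₁.nat y hy.1]
    · simp only [Cmd.realVars, List.mem_append, not_or] at hy
      rw [ih₂.real y hy.2, ih₁.real y hy.1]
    · simp only [Cmd.natArrs, List.mem_append, not_or] at hy
      rw [ih₂.natArr y hy.2, ih₁.natArr y hy.1]
    · simp only [Cmd.realArrs, List.mem_append, not_or] at hy
      rw [ih₂.realArr y hy.2, ih₁.realArr y hy.1]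
  | iteTrue _ _ ih =>
    exact ⟨fun y hy => ih.nat y fun h => hy (List.mem_append_left _ h),
      fun y hy => ih.real y fun h => hy (List.mem_append_left _ h),
      fun y hy => ih.natArr y fun h => hy (List.mem_append_left _ h),
      fun y hy => ih.realArr y fun h => hy (List.mem_append_left _ h)⟩
  | iteFalse _ _ ih =>
    exact ⟨fun y hy => ih.nat y fun h => hy (List.mem_append_right _ h),
      fun y hy => ih.real y fun h => hy (List.mem_append_right _ h),
      fun y hy => ih.natArr y fun h => hy (List.mem_append_right _ h),
      fun y hy => ih.realArr y fun h => hy (List.mem_append_right _ h)⟩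
  | loopDone _ => exact Cmd.Frame.refl _ _
  | loopStep _ _ _ ih₁ ih₂ =>
    exact ⟨fun y hy => (ih₂.nat y hy).trans (ih₁.nat y hy),
      fun y hy => (ih₂.real y hy).trans (ih₁.real y hy),
      fun y hy => (ih₂.natArr y hy).trans (ih₁.natArr y hy),
      fun y hy => (ih₂.realArr y hy).trans (ih₁.realArr y hy)⟩
  | call h =>
    refine ⟨fun _ _ => rfl, fun y hy => ?_, fun _ _ => rfl, fun y hy => ?_⟩
    · simp_all [Cmd.realVars]
    · simp_all [Cmd.realArrs]

/-- The program `p`, started on `σ`, halts after at most `T` steps and `K` calls of the subroutine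
with a memory that satisfies `P`. -/
def Halts (sub : Store → Store → ℕ → Prop) (p : Cmd) (σ : Store) (T K : ℕ) (P : Store → Prop) :
    Prop :=
  ∃ σ' t c, Run sub p σ σ' t c ∧ t ≤ T ∧ c ≤ K ∧ P σ'

namespace Halts

variable {sub : Store → Store → ℕ → Prop} {p q : Cmd} {σ : Store} {T T' K K' : ℕ}
  {P P' : Store → Prop}

lemma mono (h : Halts sub p σ T K P) (hT : T ≤ T') (hK : K ≤ K') (hP : ∀ σ', P σ' → P' σ') :
    Halts sub p σ T' K' P' :=
  let ⟨σ', t, c, h1, h2, h3, h4⟩ := h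
  ⟨σ', t, c, h1, h2.trans hT, h3.trans hK, hP _ h4⟩

lemma frame (h : Halts sub p σ T K P) :
    Halts sub p σ T K fun σ' => P σ' ∧ p.Frame σ σ' :=
  let ⟨σ', t, c, h1, h2, h3, h4⟩ := h
  ⟨σ', t, c, h1, h2, h3, h4, h1.frame⟩

lemma seq (h : Halts sub p σ T K fun σ' => Halts sub q σ' T' K' P) :
    Halts sub (p.seq q) σ (T + T') (K + K') P := by
  obtain ⟨σ₁, t₁, c₁, h1, h2, h3, σ₂, t₂, c₂, h4, h5, h6, h7⟩ := h
  exact ⟨σ₂, _, _, h1.seq h4, add_le_add h2 h5, add_le_add h3 h6, h7⟩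

lemma ite {c : BExp} (h1 : c.Holds σ → Halts sub p σ T K P)
    (h2 : ¬ c.Holds σ → Halts sub q σ T K P) :
    Halts sub (.ite c p q) σ (1 + c.size + T) K P := by
  by_cases hc : c.Holds σ
  · obtain ⟨σ', t, k, h, ht, hk, hP⟩ := h1 hc
    exact ⟨σ', _, k, h.iteTrue hc, by omega, hk, hP⟩
  · obtain ⟨σ', t, k, h, ht, hk, hP⟩ := h2 hc
    exact ⟨σ', _, k, h.iteFalse hc, by omega, hk, hP⟩

/-- `steps` adds up both branches of a conditional. This overestimate is harmless, as only constants
are affected. -/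
lemma of_wp (h : p.wp P σ) : Halts sub p σ p.steps 0 P := by
  induction p generalizing σ P with
  | skip => exact ⟨_, _, _, .skip σ, le_rfl, le_rfl, h⟩
  | setNat x e => exact ⟨_, _, _, .setNat σ x e, le_rfl, le_rfl, h⟩
  | setReal x e => exact ⟨_, _, _, .setReal σ x e, le_rfl, le_rfl, h⟩
  | putNat a i e => exact ⟨_, _, _, .putNat σ a i e, le_rfl, le_rfl, h⟩
  | putReal a i e => exact ⟨_, _, _, .putReal σ a i e, le_rfl, le_rfl, h⟩
  | seq p q ihp ihq =>
    exact Halts.seq ((ihp h).mono le_rfl le_rfl fun σ' h' => ihq h')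
  | ite c p q ihp ihq =>
    exact Halts.ite (fun hc => (ihp (h.1 hc)).mono (by omega) le_rfl fun _ h => h)
      (fun hc => (ihq (h.2 hc)).mono (by omega) le_rfl fun _ h => h)
  | loop c p => exact h.elim
  | call => exact h.elim

lemma of_wp_frame (h : p.wp P' σ) (hT : p.steps ≤ T) (h' : ∀ σ', P' σ' → p.Frame σ σ' → P σ') :
    Halts sub p σ T 0 P :=
  (of_wp h).frame.mono hT le_rfl fun σ' h'' => h' σ' h''.1 h''.2

lemma andThen (h : Halts sub p σ T K P')
    (h' : ∀ σ', P' σ' → p.Frame σ σ' → Halts sub q σ' T' K' P) :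
    Halts sub (p.seq q) σ (T + T') (K + K') P :=
  seq (h.frame.mono le_rfl le_rfl fun σ' h'' => h' σ' h''.1 h''.2)

/-- The index of the invariant strictly decreases with every round, so its initial value bounds the
number of rounds; the extra summand pays for the last test. -/
lemma loop {c : BExp} (I : ℕ → Store → Prop) {r : ℕ}
    (h : ∀ r' σ', p.Frame σ σ' → I r' σ' → c.Holds σ' →
      Halts sub p σ' T K fun σ'' => ∃ r'' < r', I r'' σ'') (h0 : I r σ) :
    Halts sub (.loop c p) σ (r * (1 + c.size + T) + (1 + c.size)) (r * K)
      fun σ' => (∃ r', I r' σ') ∧ ¬ c.Holds σ' := by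
  suffices H : ∀ r σ', p.Frame σ σ' → I r σ' →
      Halts sub (.loop c p) σ' (r * (1 + c.size + T) + (1 + c.size)) (r * K)
        fun σ' => (∃ r', I r' σ') ∧ ¬ c.Holds σ' from H r σ (.refl _ _) h0
  intro r
  induction r using Nat.strong_induction_on with
  | _ r ih =>
  intro σ' hf hI
  by_cases hc : c.Holds σ'
  · obtain ⟨σ₁, t₁, c₁, h1, h2, h3, r₁, hr, h4⟩ := h r σ' hf hI hc
    obtain ⟨σ₂, t₂, c₂, h5, h6, h7, h8⟩ := ih r₁ hr σ₁ (hf.trans h1.frame) h4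
    refine ⟨σ₂, _, _, .loopStep hc h1 h5, ?_, ?_, h8⟩
    · have : (r₁ + 1) * (1 + c.size + T) ≤ r * (1 + c.size + T) := Nat.mul_le_mul_right _ hr
      rw [add_mul] at this
      omega
    · have : (r₁ + 1) * K ≤ r * K := Nat.mul_le_mul_right _ hr
      rw [add_mul] at this
      omega
  · exact ⟨σ', _, _, .loopDone hc, by omega, by omega, ⟨r, hI⟩, hc⟩

/-- Rule for loops in which the variable `x` runs from `0` to the value of the variable `y`. -/
lemma count {x y N : ℕ} (I : ℕ → Store → Prop) (hx : σ.nat x = 0) (hy : σ.nat y = N)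
    (hyp : y ∉ p.natVars) (h0 : I 0 σ)
    (h : ∀ i τ, i < N → p.Frame σ τ → τ.nat x = i → I i τ →
      Halts sub p τ T K fun τ' => τ'.nat x = i + 1 ∧ I (i + 1) τ') :
    Halts sub (.loop (.natLe (.add (.var x) (.lit 1)) (.var y)) p) σ (N * (6 + T) + 6) (N * K)
      (I N) := by
  let J : ℕ → Store → Prop := fun r τ => r ≤ N ∧ τ.nat x = N - r ∧ τ.nat y = N ∧ I (N - r) τ
  refine (loop (T := T) (K := K) J (r := N) ?_ ?_).mono ?_ le_rfl ?_
  · rintro r τ hf ⟨hr, hxr, hyr, hI⟩ hc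
    have hlt : N - r < N := by simpa [BExp.Holds, NExp.eval, hxr, hyr] using hc
    refine (h _ τ hlt hf hxr hI).frame.mono le_rfl le_rfl ?_
    rintro τ' ⟨⟨h1, h2⟩, hf'⟩
    have e : N - (r - 1) = N - r + 1 := by omega
    exact ⟨r - 1, by omega, by omega, by rw [e, h1], by rw [hf'.nat y hyp, hyr], by rwa [e]⟩
  · exact ⟨le_rfl, by simp [hx], hy, by simpa using h0⟩
  -- A test of this form has size `5` and takes one further step.
  · simp only [BExp.size, NExp.size, Nat.reduceAdd]; omega
  · rintro τ ⟨⟨r, hr, hxr, hyr, hI⟩, hc⟩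
    simp only [BExp.Holds, NExp.eval, hxr, hyr, not_le] at hc
    rwa [show N - r = N by omega] at hI

end Halts

/-! ## Reading lists from arrays -/

@[simp] lemma length_readList (f : ℕ → ℝ) (o l : ℕ) : (readList f o l).length = l := by
  simp [readList]

@[simp] lemma readList_zero (f : ℕ → ℝ) (o : ℕ) : readList f o 0 = [] := rfl

lemma readList_succ (f : ℕ → ℝ) (o l : ℕ) :
    readList f o (l + 1) = f o :: readList f (o + 1) l := by
  simp only [readList, List.range_succ_eq_map, List.map_cons, List.map_map, add_zero]
  congr 1
  refine List.map_congr_left fun i _ => ?_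
  simp only [Function.comp]
  congr 1
  omega

lemma readList_congr {f g : ℕ → ℝ} {o o' l : ℕ} (h : ∀ i < l, f (o + i) = g (o' + i)) :
    readList f o l = readList g o' l := by
  refine List.map_congr_left fun i hi => h i (List.mem_range.1 hi)

/-! ## Optimal chunkings of one edge -/

/-- The reach is affine in `a`, with a positive slope because `0 ≤ 1 - 1 / b < 1`. Solving for `a`
gives the threshold that the program computes for each `j`. -/
lemma le_chunkReach_iff {b D c a : ℝ} (hb : 1 < b) (l j : ℕ) :
    c ≤ chunkReach b D l j a ↔
      (c + ((l - 1 - j : ℕ) : ℝ) * D / b) /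
        (1 - (1 - 1 / b) ^ (j + 1) + ((l - 1 - j : ℕ) : ℝ) / b) ≤ a := by
  have hb0 : 0 < b := by linarith
  have hq0 : 0 ≤ 1 - 1 / b := by rw [sub_nonneg, div_le_one hb0]; exact hb.le
  have hq1 : 1 - 1 / b < 1 := by have := one_div_pos.2 hb0; linarith
  have hw : (1 - 1 / b) ^ (j + 1) < 1 := pow_lt_one₀ hq0 hq1 (by simp)
  have hr : (0 : ℝ) ≤ ((l - 1 - j : ℕ) : ℝ) / b := by positivity
  rw [div_le_iff₀ (by linarith), ← sub_nonneg, ← sub_nonneg (b := c + _), chunkReach]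
  apply Eq.to_iff
  congr 1
  ring

/-- The escape cost `D` above `dv`, capped by what is left of the edge, at the head of a chunk. -/
noncomputable def tailExcess (D : ℝ) (ys : List ℝ) : ℝ := if ys = [] then 0 else min ys.sum D

lemma tailCost_eq (du dv : ℝ) (ys : List ℝ) : tailCost du dv ys = dv + tailExcess (du - dv) ys := by
  unfold tailCost tailExcess
  split_ifs
  · simp
  · rw [add_comm dv, min_add, sub_add_cancel]

/-- Cost that `k` chunks can cover within the excess `a` by being as large as possible from the last
one on. -/
noncomputable def greedyReach (b D a : ℝ) (j k : ℕ) : ℝ :=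
  a * (1 - (1 - 1 / b) ^ min k (j + 1)) + ((k - 1 - j : ℕ) : ℝ) * (a - D) / b

/-- Chunks at the end of an edge of cost `c`, each as large as the excess `a` permits. -/
structure IsGreedy (b du dv c a : ℝ) (ys : List ℝ) : Prop where
  nonneg : ∀ y ∈ ys, 0 ≤ y
  sum_le : ys.sum ≤ c
  excess_le : tailExcess (du - dv) ys ≤ a
  within : ChunksWithin b du dv (dv + a) ys
  le_sum : ∀ j, min c (greedyReach b (du - dv) a j ys.length) ≤ ys.sum

lemma isGreedy_nil {b du dv c a : ℝ} (hc : 0 ≤ c) (ha : 0 ≤ a) : IsGreedy b du dv c a [] where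
  nonneg := by simp
  sum_le := by simpa using hc
  excess_le := by simpa [tailExcess] using ha
  within := trivial
  le_sum j := by simp [greedyReach]

/-- Nonnegativity of the new chunk comes from `excess_le`, and `x ≤ b * x` keeps `excess_le` true.
The lower bound for the total holds for all `j` simultaneously, since the tail excess is at most the
total and, unless nothing follows, at most `du - dv`. -/
lemma IsGreedy.cons {b du dv c a : ℝ} (hb : 1 < b) {ys : List ℝ}
    (h : IsGreedy b du dv c a ys) {x : ℝ}
    (hx : x = min ((a - tailExcess (du - dv) ys) / b) (c - ys.sum)) :
    IsGreedy b du dv c a (x :: ys) := by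
  have hb0 : 0 < b := by linarith
  have h1 : 0 ≤ (a - tailExcess (du - dv) ys) / b := div_nonneg (by linarith [h.excess_le]) hb0.le
  have hx0 : 0 ≤ x := by rw [hx]; exact le_min h1 (by linarith [h.sum_le])
  have hxa : x ≤ (a - tailExcess (du - dv) ys) / b := hx ▸ min_le_left _ _
  have hxc : x ≤ c - ys.sum := hx ▸ min_le_right _ _
  have hbx : b * x ≤ a - tailExcess (du - dv) ys := by
    rw [le_div_iff₀ hb0] at hxa; linarith
  have hxb : x ≤ b * x := le_mul_of_one_le_left hx0 hb.le
  have hs0 : 0 ≤ ys.sum := List.sum_nonneg h.nonneg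
  refine ⟨?_, ?_, ?_, ?_, fun j => ?_⟩
  · intro y hy
    rcases List.mem_cons.1 hy with rfl | hy
    · exact hx0
    · exact h.nonneg y hy
  · rw [List.sum_cons]; linarith
  · rw [tailExcess, if_neg (by simp), List.sum_cons]
    by_cases hy : ys = []
    · subst hy
      simp only [tailExcess, if_true] at hbx
      refine (min_le_left _ _).trans ?_
      simp; linarith
    · have he := h.excess_le
      rw [tailExcess, if_neg hy] at hbx he
      rcases min_choice ys.sum (du - dv) with hm | hm
      · rw [hm] at hbx
        exact (min_le_left _ _).trans (by linarith)
      · rw [hm] at he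
        exact (min_le_right _ _).trans he
  · refine ⟨?_, h.within⟩
    rw [tailCost_eq]; linarith
  · rw [List.sum_cons, List.length_cons]
    -- If the cap by the rest of the edge is active, the whole cost is now covered and the minimum
    -- with `c` settles the claim.
    rcases min_choice ((a - tailExcess (du - dv) ys) / b) (c - ys.sum) with hm | hm
    swap
    · exact (min_le_left _ _).trans (by rw [hx, hm]; linarith)
    rw [hm] at hx
    have hj := h.le_sum j
    rcases min_choice c (greedyReach b (du - dv) a j ys.length) with hm' | hm'
    · rw [hm'] at hj
      exact (min_le_left _ _).trans (by linarith)
    rw [hm'] at hj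
    refine (min_le_right _ _).trans ?_
    unfold greedyReach at hj ⊢
    -- With at most `j` chunks present the tail excess is bounded by their total, which gives the
    -- geometric growth; with more it is bounded by `du - dv`, which gives the linear growth.
    by_cases hk : ys.length < j + 1
    · rw [min_eq_left hk, show ys.length + 1 - 1 - j = 0 by omega]
      rw [min_eq_left hk.le, show ys.length - 1 - j = 0 by omega] at hj
      have hM : tailExcess (du - dv) ys ≤ ys.sum := by
        unfold tailExcess
        split_ifs
        · exact hs0
        · exact min_le_left _ _
      have hq0 : 0 ≤ 1 - 1 / b := by rw [sub_nonneg, div_le_one hb0]; exact hb.le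
      have h2 := mul_le_mul_of_nonneg_right hj hq0
      have h3 : (a - ys.sum) / b ≤ x := by
        rw [hx]; gcongr
      rw [pow_succ]
      calc _ = a / b + (a * (1 - (1 - 1 / b) ^ ys.length) + ((0 : ℕ) : ℝ) * (a - (du - dv)) / b) *
              (1 - 1 / b) := by push_cast; ring
        _ ≤ a / b + ys.sum * (1 - 1 / b) := by linarith
        _ = (a - ys.sum) / b + ys.sum := by ring
        _ ≤ _ := by linarith
    · have hy : ys ≠ [] := by rintro rfl; simp at hk
      rw [min_eq_right (by omega), show ys.length + 1 - 1 - j = (ys.length - 1 - j) + 1 by omega]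
      rw [min_eq_right (by omega)] at hj
      have h3 : (a - (du - dv)) / b ≤ x := by
        rw [hx]
        gcongr
        rw [tailExcess, if_neg hy]
        exact min_le_right _ _
      push_cast
      calc _ = (a - (du - dv)) / b + (a * (1 - (1 - 1 / b) ^ (j + 1)) +
              ((ys.length - 1 - j : ℕ) : ℝ) * (a - (du - dv)) / b) := by ring
        _ ≤ _ := add_le_add h3 hj

lemma IsGreedy.sum_eq {b du dv c a : ℝ} {ys : List ℝ} (h : IsGreedy b du dv c a ys) {j : ℕ}
    (hj : j < ys.length) (hc : c ≤ chunkReach b (du - dv) ys.length j a) : ys.sum = c := by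
  refine le_antisymm h.sum_le ?_
  have := h.le_sum j
  rwa [greedyReach, min_eq_right (a := ys.length) (by omega), ← chunkReach, min_eq_left hc] at this

infixr:60 " ;; " => Cmd.seq

/-- Least excess over `dv` of the bottleneck of a chunking, computed into the variable `6`. -/
def excessLoop : Cmd :=
  .loop (.natLe (.lit 1) (.var 1)) (
    .setNat 1 (.sub (.var 1) (.lit 1)) ;;
    .setReal 5 (.mul (.var 5) (.var 4)) ;;
    .setReal 10 (.div (.add (.var 1) (.div (.mul (.ofNat (.var 1)) (.var 7)) (.var 0)))
      (.add (.sub (.ofNat (.lit 1)) (.var 5)) (.div (.ofNat (.var 1)) (.var 0)))) ;;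
    .ite (.realLe (.var 6) (.var 10)) .skip (.setReal 6 (.var 10)))

/-- Greedy choice of the chunks, from the last one to the first. -/
def greedyLoop : Cmd :=
  .loop (.natLe (.lit 1) (.var 1)) (
    .setNat 1 (.sub (.var 1) (.lit 1)) ;;
    .setReal 10 (.div (.sub (.var 6) (.var 9)) (.var 0)) ;;
    .ite (.realLe (.var 10) (.sub (.var 1) (.var 8))) .skip
      (.setReal 10 (.sub (.var 1) (.var 8))) ;;
    .putReal 0 (.var 1) (.var 10) ;;
    .setReal 8 (.add (.var 8) (.var 10)) ;;
    .ite (.realLe (.var 8) (.var 7)) (.setReal 9 (.var 8)) (.setReal 9 (.var 7)))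

/-- An edge-chunking algorithm. -/
def edgeChunker : Cmd :=
  -- The real variables `0` to `3` hold `b`, `c`, `du`, `dv`. Further, `4` is `1 - 1 / b`, `5` its
  -- current power, `6` the excess, `7` the difference `du - dv`, `8` the total of the chunks chosen
  -- so far, `9` their tail excess, and `10` is auxiliary. The natural variable `1` counts down from
  -- `l`.
  (.setReal 4 (.sub (.ofNat (.lit 1)) (.div (.ofNat (.lit 1)) (.var 0))) ;;
    .setReal 5 (.ofNat (.lit 1)) ;;
    .setReal 6 (.mul (.var 0) (.var 1)) ;;
    .setReal 7 (.sub (.var 2) (.var 3)) ;;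
    .setNat 1 (.var 0)) ;;
  excessLoop ;;
  (.ite (.realLe (.ofNat (.lit 0)) (.var 6)) .skip (.setReal 6 (.ofNat (.lit 0))) ;;
    .setReal 8 (.ofNat (.lit 0)) ;;
    .setReal 9 (.ofNat (.lit 0)) ;;
    .setNat 1 (.var 0)) ;;
  greedyLoop ;;
  .setReal 0 (.add (.var 3) (.var 6))

section

variable {sub : Store → Store → ℕ → Prop} {b c du dv : ℝ} {l : ℕ}

/-- When the counter has been lowered to `l - 1 - j`, the variable `5` has become `(1 - 1 / b) ^ (j
+ 1)`. Thus each threshold takes constantly many steps, and the minimum over all `j < l` linearly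
many. -/
lemma halts_excessLoop (hb : 1 < b) (hc : 0 ≤ c) (hl : 1 ≤ l) {σ : Store} (h0 : σ.real 0 = b)
    (h1 : σ.real 1 = c) (h4 : σ.real 4 = 1 - 1 / b) (h5 : σ.real 5 = 1) (h6 : σ.real 6 = b * c)
    (h7 : σ.real 7 = du - dv) (hn : σ.nat 1 = l) :
    Halts sub excessLoop σ (60 * l + 40) 0 fun σ' =>
      (∃ j < l, c ≤ chunkReach b (du - dv) l j (σ'.real 6)) ∧
      ∀ j < l, ∀ a, c ≤ chunkReach b (du - dv) l j a → σ'.real 6 ≤ a := by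
  have hb0 : 0 < b := by linarith
  let I : ℕ → Store → Prop := fun r τ => τ.nat 1 = r ∧ r ≤ l ∧
    τ.real 5 = (1 - 1 / b) ^ (l - r) ∧
    (∃ j < l, c ≤ chunkReach b (du - dv) l j (τ.real 6)) ∧
    ∀ j < l, r ≤ l - 1 - j → ∀ a, c ≤ chunkReach b (du - dv) l j a → τ.real 6 ≤ a
  refine (Halts.loop (T := 50) (K := 0) I (r := l) ?_ ?_).mono ?_ (by simp) ?_
  · rintro r τ hf ⟨hr, hrl, hw, hex, hall⟩ hcond
    have g0 : τ.real 0 = b := (hf.real 0 (by decide)).trans h0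
    have g1 : τ.real 1 = c := (hf.real 1 (by decide)).trans h1
    have g4 : τ.real 4 = 1 - 1 / b := (hf.real 4 (by decide)).trans h4
    have g7 : τ.real 7 = du - dv := (hf.real 7 (by decide)).trans h7
    have hr1 : 1 ≤ r := by simpa [BExp.Holds, NExp.eval, hr] using hcond
    have hj : l - r < l := by omega
    have e1 : l - 1 - (l - r) = r - 1 := by omega
    have e2 : l - (r - 1) = l - r + 1 := by omega
    have key := fun a => le_chunkReach_iff (D := du - dv) (c := c) (a := a) hb l (l - r)
    rw [e1] at key
    refine Halts.of_wp_frame ?_ (by decide) fun _ h _ => h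
    simp only [Cmd.wp, NExp.eval, RExp.eval, BExp.Holds, Store.nat_setNat, Store.real_setNat,
      Store.real_setReal, Store.nat_setReal, Nat.reduceEqDiff, if_true, if_false,
      hr, hw, g0, g1, g4, g7, Nat.cast_one, ← pow_succ, OfNat.one_ne_ofNat, OfNat.zero_ne_ofNat]
    have hstep : ∀ j < l, r - 1 ≤ l - 1 - j → r ≤ l - 1 - j ∨ j = l - r := by
      intro j hj hj'; omega
    refine ⟨fun hle => ⟨r - 1, by omega, ?_⟩, fun hle => ⟨r - 1, by omega, ?_⟩⟩
    · refine ⟨by simp, by omega, by simp [e2], by simpa using hex, ?_⟩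
      intro j hj hj' a ha
      rcases hstep j hj hj' with h | rfl
      · simpa using hall j hj h a ha
      · have := (key a).1 ha
        simpa using hle.trans this
    · refine ⟨by simp, by omega, by simp [e2], ⟨l - r, hj, ?_⟩, ?_⟩
      · simpa using (key _).2 le_rfl
      · intro j hj hj' a ha
        rcases hstep j hj hj' with h | rfl
        · simpa using (le_of_lt (not_le.1 hle)).trans (hall j hj h a ha)
        · simpa using (key a).1 ha
  -- The initial excess `b * c` suffices with `j = l - 1`: already one chunk of cost `c` stays
  -- within it.
  · refine ⟨hn, le_rfl, by simp [h5], ⟨l - 1, by omega, ?_⟩, fun j hj hj' => by omega⟩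
    have hq0 : 0 ≤ 1 - 1 / b := by rw [sub_nonneg, div_le_one hb0]; exact hb.le
    have hq1 : 1 - 1 / b ≤ 1 := by have := one_div_pos.2 hb0; linarith
    have hpow : (1 - 1 / b) ^ (l - 1 + 1) ≤ 1 - 1 / b := pow_le_of_le_one hq0 hq1 (by simp)
    have : b * c * (1 / b) ≤ b * c * (1 - (1 - 1 / b) ^ (l - 1 + 1)) :=
      mul_le_mul_of_nonneg_left (by linarith) (by positivity)
    rw [chunkReach, h6, Nat.sub_self]
    have e : b * c * (1 / b) = c := by field_simp
    simp only [Nat.cast_zero, zero_mul, zero_div, add_zero]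
    linarith
  · simp only [BExp.size, NExp.size]; omega
  · rintro τ ⟨⟨r, hr, -, -, hex, hall⟩, hcond⟩
    have : r = 0 := by simpa [BExp.Holds, NExp.eval, hr] using hcond
    exact ⟨hex, fun j hj => hall j hj (by omega)⟩

lemma halts_greedyLoop (hb : 1 < b) (hc : 0 ≤ c) {a : ℝ} (ha : 0 ≤ a) {σ : Store}
    (h0 : σ.real 0 = b) (h1 : σ.real 1 = c) (h6 : σ.real 6 = a) (h7 : σ.real 7 = du - dv)
    (h8 : σ.real 8 = 0) (h9 : σ.real 9 = 0) (hn : σ.nat 1 = l) :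
    Halts sub greedyLoop σ (60 * l + 40) 0 fun σ' =>
      IsGreedy b du dv c a (readList (σ'.realArr 0) 0 l) := by
  -- Positions `r` to `l - 1` of the array are filled with greedy chunks; their total and tail
  -- excess are maintained so that each round is constant time.
  let I : ℕ → Store → Prop := fun r τ => τ.nat 1 = r ∧ r ≤ l ∧
    IsGreedy b du dv c a (readList (τ.realArr 0) r (l - r)) ∧
    τ.real 8 = (readList (τ.realArr 0) r (l - r)).sum ∧
    τ.real 9 = tailExcess (du - dv) (readList (τ.realArr 0) r (l - r))
  refine (Halts.loop (T := 50) (K := 0) I (r := l) ?_ ?_).mono ?_ (by simp) ?_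
  · rintro r τ hf ⟨hr, hrl, hg, hs, hm⟩ hcond
    have g0 : τ.real 0 = b := (hf.real 0 (by decide)).trans h0
    have g1 : τ.real 1 = c := (hf.real 1 (by decide)).trans h1
    have g6 : τ.real 6 = a := (hf.real 6 (by decide)).trans h6
    have g7 : τ.real 7 = du - dv := (hf.real 7 (by decide)).trans h7
    have hr1 : 1 ≤ r := by simpa [BExp.Holds, NExp.eval, hr] using hcond
    have hread : ∀ x, readList (Function.update (τ.realArr 0) (r - 1) x) (r - 1) (l - (r - 1)) =
        x :: readList (τ.realArr 0) r (l - r) := by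
      intro x
      rw [show l - (r - 1) = l - r + 1 by omega, readList_succ, Function.update_self,
        Nat.sub_add_cancel hr1]
      congr 1
      refine readList_congr fun i hi => ?_
      rw [Function.update_of_ne (by omega)]
    generalize readList (τ.realArr 0) r (l - r) = ys at *
    have hnext : ∀ x, x = min ((a - tailExcess (du - dv) ys) / b) (c - ys.sum) →
        IsGreedy b du dv c a (x :: ys) := fun x hx => hg.cons hb hx
    have hex : ∀ x, tailExcess (du - dv) (x :: ys) = min (ys.sum + x) (du - dv) := by
      intro x; simp [tailExcess, add_comm]
    refine Halts.of_wp_frame ?_ (by decide) fun _ h _ => h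
    simp only [Cmd.wp, NExp.eval, RExp.eval, BExp.Holds, Store.nat_setNat, Store.real_setNat,
      Store.real_setReal, Store.nat_setReal, Nat.reduceEqDiff, if_true, if_false,
      Store.real_putReal, hr, hs, hm, g0, g1, g6, g7, OfNat.one_ne_ofNat]
    refine ⟨fun hle => ⟨fun hle' => ⟨r - 1, by omega, ?_⟩, fun hle' => ⟨r - 1, by omega, ?_⟩⟩,
      fun hle => ⟨fun hle' => ⟨r - 1, by omega, ?_⟩, fun hle' => ⟨r - 1, by omega, ?_⟩⟩⟩ <;>
    refine ⟨by simp, by omega, ?_, ?_, ?_⟩ <;>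
    simp only [Store.real_setNat, Store.real_setReal, Nat.reduceEqDiff, if_true, if_false,
      Store.real_putReal, Store.realArr_putReal, Store.realArr_setReal,
      Store.realArr_setNat, hread, hex, List.sum_cons]
    · exact hnext _ (min_eq_left hle).symm
    · rw [add_comm]
    · exact (min_eq_left hle').symm
    · exact hnext _ (min_eq_left hle).symm
    · rw [add_comm]
    · exact (min_eq_right (le_of_not_ge hle')).symm
    · exact hnext _ (min_eq_right (le_of_not_ge hle)).symm
    · rw [add_comm]
    · exact (min_eq_left hle').symm
    · exact hnext _ (min_eq_right (le_of_not_ge hle)).symm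
    · rw [add_comm]
    · exact (min_eq_right (le_of_not_ge hle')).symm
  · exact ⟨hn, le_rfl, by simpa using isGreedy_nil hc ha, by simp [h8], by simp [h9, tailExcess]⟩
  · simp only [BExp.size, NExp.size]; omega
  · rintro τ ⟨⟨r, hr, -, hg, -⟩, hcond⟩
    obtain rfl : r = 0 := by simpa [BExp.Holds, NExp.eval, hr] using hcond
    simpa using hg

lemma halts_edgeChunker (hb : 1 < b) (hc : 0 ≤ c) (hl : 1 ≤ l) :
    Halts noSub edgeChunker (Store.args b c du dv l) (400 * l) 0 fun τ =>
      ∃ a, τ.real 0 = dv + a ∧ IsChunking c l (readList (τ.realArr 0) 0 l) ∧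
        ChunksWithin b du dv (dv + a) (readList (τ.realArr 0) 0 l) ∧
        ∀ ys, IsChunking c l ys → ∀ β, ChunksWithin b du dv β ys → dv + a ≤ β := by
  refine Halts.mono (T := 40 + ((60 * l + 40) + (40 + ((60 * l + 40) + 40))))
    (K := 0 + (0 + (0 + (0 + 0)))) (Halts.andThen (P' := fun τ => τ.real 4 = 1 - 1 / b ∧
    τ.real 5 = 1 ∧ τ.real 6 = b * c ∧ τ.real 7 = du - dv ∧ τ.nat 1 = l)
    (Halts.of_wp_frame ?_ (by decide) fun _ h _ => h) ?_) (by omega) le_rfl fun _ h => h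
  · simp [Cmd.wp, NExp.eval, RExp.eval, Store.args]
  rintro σ₁ ⟨h4, h5, h6, h7, hn⟩ hf₁
  have h0 : σ₁.real 0 = b := (hf₁.real 0 (by decide)).trans (by simp [Store.args])
  have h1 : σ₁.real 1 = c := (hf₁.real 1 (by decide)).trans (by simp [Store.args])
  have h3 : σ₁.real 3 = dv := (hf₁.real 3 (by decide)).trans (by simp [Store.args])
  have hn0 : σ₁.nat 0 = l := (hf₁.nat 0 (by decide)).trans (by simp [Store.args])
  refine Halts.andThen (halts_excessLoop hb hc hl h0 h1 h4 h5 h6 h7 hn) ?_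
  rintro σ₂ ⟨⟨j, hj, hex⟩, hall⟩ hf₂
  replace h0 := (hf₂.real 0 (by decide)).trans h0
  replace h1 := (hf₂.real 1 (by decide)).trans h1
  replace h3 := (hf₂.real 3 (by decide)).trans h3
  replace h7 := (hf₂.real 7 (by decide)).trans h7
  replace hn0 := (hf₂.nat 0 (by decide)).trans hn0
  refine Halts.andThen (P' := fun τ =>
    τ.real 6 = max 0 (σ₂.real 6) ∧ τ.real 8 = 0 ∧ τ.real 9 = 0 ∧ τ.nat 1 = l)
    (Halts.of_wp_frame ?_ (by decide) fun _ h _ => h) ?_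
  · simp only [Cmd.wp, NExp.eval, RExp.eval, BExp.Holds]
    refine ⟨fun h => ?_, fun h => ?_⟩
    · rw [max_eq_right (by simpa using h)]
      simp [hn0]
    · rw [max_eq_left (by simpa using le_of_not_ge h)]
      simp [hn0]
  rintro σ₃ ⟨h6', h8, h9, hn'⟩ hf₃
  replace h0 := (hf₃.real 0 (by decide)).trans h0
  replace h1 := (hf₃.real 1 (by decide)).trans h1
  replace h3 := (hf₃.real 3 (by decide)).trans h3
  replace h7 := (hf₃.real 7 (by decide)).trans h7
  -- The least threshold may be negative, when escaping is cheap, but no chunking has negative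
  -- excess.
  generalize ha : max 0 (σ₂.real 6) = a at h6'
  have ha0 : 0 ≤ a := ha ▸ le_max_left _ _
  refine Halts.andThen (halts_greedyLoop hb hc ha0 h0 h1 h6' h7 h8 h9 hn') ?_
  rintro σ₄ hg hf₄
  replace h3 := (hf₄.real 3 (by decide)).trans h3
  replace h6' := (hf₄.real 6 (by decide)).trans h6'
  refine Halts.of_wp_frame ?_ (by decide) fun _ h _ => h
  simp only [Cmd.wp, RExp.eval, Store.real_setReal, Store.realArr_setReal, if_true, h3, h6']
  refine ⟨a, rfl, ⟨by simp, hg.nonneg, hg.sum_eq (j := j) (by simpa using hj) ?_⟩, hg.within, ?_⟩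
  · rw [length_readList]
    rw [le_chunkReach_iff hb] at hex ⊢
    exact hex.trans (ha ▸ le_max_right _ _)
  -- Any chunking has a nonnegative excess which also lies above the threshold of some `j`, hence
  -- above the computed value.
  · intro ys hys β hβ
    have hne : ys ≠ [] := List.ne_nil_of_length_pos (by rw [hys.1]; omega)
    obtain ⟨a', rfl⟩ : ∃ a', β = dv + a' := ⟨β - dv, by ring⟩
    have h1 := hβ.excess_nonneg (by linarith) hne hys.2.1
    obtain ⟨j', hj', hs⟩ := hβ.exists_sum_le hb hne hys.2.1
    rw [hys.1] at hj' hs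
    rw [hys.2.2] at hs
    have h2 := hall j' hj' a' hs
    rw [← ha]
    linarith [max_le h1 h2]

end

theorem isEdgeChunker_edgeChunker : IsEdgeChunker edgeChunker := by
  refine ⟨400, fun n m G b e l hb hl hr => ?_⟩
  obtain ⟨τ, t, k, hrun, ht, hk, a, ha, hc, hw, hopt⟩ :=
    halts_edgeChunker (du := G.dist (G.src e) G.t) (dv := G.dist (G.dst e) G.t) hb
      (G.cost_nonneg e) hl
  obtain rfl : k = 0 := by omega
  have hle := (G.bottleneck_le_iff b hc hl hr _).2 hw
  have hge : ∀ ys, IsChunking (G.cost e) l ys → G.dist (G.dst e) G.t + a ≤ G.bottleneck b e ys :=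
    fun ys hys => hopt ys hys _ ((G.bottleneck_le_iff b hys hl hr _).1 le_rfl)
  exact ⟨τ, t, hrun, ⟨hc, fun ys hys => hle.trans (hge ys hys)⟩,
    ha.trans (le_antisymm (hge _ hc) hle), by exact_mod_cast ht⟩

/-! ## Sorting the edges topologically -/

/-- The memory `σ` still holds the instance. -/
structure HasInput {n m : ℕ} (G : TaskGraph n m) (b : ℝ) (k : ℕ) (σ : Store) : Prop where
  numVertices : σ.nat 0 = n
  numEdges : σ.nat 1 = m
  budget : σ.nat 2 = k
  start : σ.nat 3 = G.s
  target : σ.nat 4 = G.t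
  bias : σ.real 0 = b
  src : ∀ e : Fin m, σ.natArr 0 e = G.src e
  dst : ∀ e : Fin m, σ.natArr 1 e = G.dst e
  cost : ∀ e : Fin m, σ.realArr 0 e = G.cost e

/-- The program `p` does not change the instance. -/
def Cmd.keepsInput (p : Cmd) : Bool :=
  p.natVars.all (5 ≤ ·) && p.realVars.all (1 ≤ ·) && p.natArrs.all (2 ≤ ·) &&
    p.realArrs.all (1 ≤ ·)

section

variable {n m : ℕ} {G : TaskGraph n m} {b : ℝ} {k : ℕ}

lemma hasInput_inputStore (G : TaskGraph n m) (b : ℝ) (k : ℕ) :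
    HasInput G b k (inputStore G b k) := by
  constructor <;> simp [inputStore]

lemma HasInput.of_frame {p : Cmd} {σ σ' : Store} (h : HasInput G b k σ) (hf : p.Frame σ σ')
    (hp : p.keepsInput = true) : HasInput G b k σ' := by
  simp only [Cmd.keepsInput, Bool.and_eq_true, List.all_eq_true, decide_eq_true_eq] at hp
  obtain ⟨⟨⟨h1, h2⟩, h3⟩, h4⟩ := hp
  have e1 : ∀ x < 5, σ'.nat x = σ.nat x := fun x hx => hf.nat x fun h => by
    have := h1 x h; omega
  have e3 : ∀ x < 2, σ'.natArr x = σ.natArr x := fun x hx => hf.natArr x fun h => by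
    have := h3 x h; omega
  have e2 : σ'.real 0 = σ.real 0 := hf.real 0 fun h => by have := h2 0 h; omega
  have e4 : σ'.realArr 0 = σ.realArr 0 := hf.realArr 0 fun h => by have := h4 0 h; omega
  constructor
  · rw [e1 0 (by omega), h.numVertices]
  · rw [e1 1 (by omega), h.numEdges]
  · rw [e1 2 (by omega), h.budget]
  · rw [e1 3 (by omega), h.start]
  · rw [e1 4 (by omega), h.target]
  · rw [e2, h.bias]
  · rw [e3 0 (by omega)]; exact h.src
  · rw [e3 1 (by omega)]; exact h.dst
  · rw [e4]; exact h.cost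

/-- The array `f` holds the list `xs` from position `o` on. -/
def Stores {m : ℕ} (f : ℕ → ℕ) : ℕ → List (Fin m) → Prop
  | _, [] => True
  | o, x :: xs => f o = x ∧ Stores f (o + 1) xs

lemma Stores.concat {f : ℕ → ℕ} {o : ℕ} {xs : List (Fin m)} (h : Stores f o xs) (x : Fin m) :
    Stores (Function.update f (o + xs.length) x) o (xs ++ [x]) := by
  induction xs generalizing o with
  | nil => simp [Stores]
  | cons y ys ih =>
    refine ⟨?_, ?_⟩
    · rw [Function.update_of_ne (by simp), h.1]
    · have := ih h.2
      rwa [show o + 1 + ys.length = o + (y :: ys).length by simp; omega] at this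

lemma Stores.getElem {f : ℕ → ℕ} {o : ℕ} {xs : List (Fin m)} (h : Stores f o xs) {i : ℕ}
    (hi : i < xs.length) : f (o + i) = xs[i] := by
  induction xs generalizing o i with
  | nil => simp at hi
  | cons y ys ih =>
    cases i with
    | zero => exact h.1
    | succ i =>
      have := ih h.2 (i := i) (by simpa using hi)
      rw [show o + (i + 1) = o + 1 + i by omega]
      simpa using this

/-- `p` is the head of a linked list, with pointers `next`, that holds `es`. A pointer to `e` is
`e + 1`, the null pointer is `0`. -/
def LinkedList {m : ℕ} (next : ℕ → ℕ) : ℕ → List (Fin m) → Prop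
  | p, [] => p = 0
  | p, e :: es => p = e + 1 ∧ LinkedList next (next e) es

lemma LinkedList.update {next : ℕ → ℕ} {p : ℕ} {es : List (Fin m)} (h : LinkedList next p es)
    {i : ℕ} (hi : ∀ e ∈ es, (e : ℕ) ≠ i) (v : ℕ) :
    LinkedList (Function.update next i v) p es := by
  induction es generalizing p with
  | nil => exact h
  | cons e es ih =>
    refine ⟨h.1, ?_⟩
    rw [Function.update_of_ne (hi e (by simp))]
    exact ih h.2 fun f hf => hi f (by simp [hf])

/-- Number of edges of `S` that start at `v`. -/
def TaskGraph.outdeg (G : TaskGraph n m) (S : Finset (Fin m)) (v : Fin n) : ℕ :=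
  (S.filter fun e => G.src e = v).card

lemma TaskGraph.outdeg_insert {S : Finset (Fin m)} {e : Fin m} (he : e ∉ S) (v : Fin n) :
    G.outdeg (insert e S) v = G.outdeg S v + if G.src e = v then 1 else 0 := by
  unfold outdeg
  rw [Finset.filter_insert]
  split_ifs with h
  · rw [Finset.card_insert_of_notMem (by simp [he])]
  · rfl

lemma TaskGraph.outdeg_eq_zero {S : Finset (Fin m)} {v : Fin n} :
    G.outdeg S v = 0 ↔ ∀ e, G.src e = v → e ∉ S := by
  simp only [outdeg, Finset.card_eq_zero, Finset.filter_eq_empty_iff]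
  exact ⟨fun h e he hS => h hS he, fun h e hS he => h e he hS⟩

/-- Builds lists of the edges into every vertex, and counts the edges out of it. -/
def linkLoop : Cmd :=
  .loop (.natLe (.add (.var 5) (.lit 1)) (.var 1)) (
    -- Array `5` holds for each vertex a pointer to the first edge into it, array `6` the pointers
    -- to the next edge, array `4` the out-degrees. Pointers are shifted by one, so that the initial
    -- zeros are null pointers.
    .putNat 6 (.var 5) (.get 5 (.get 1 (.var 5))) ;;
    .putNat 5 (.get 1 (.var 5)) (.add (.var 5) (.lit 1)) ;;
    .putNat 4 (.get 0 (.var 5)) (.add (.get 4 (.get 0 (.var 5))) (.lit 1)) ;;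
    .setNat 5 (.add (.var 5) (.lit 1)))

lemma halts_linkLoop {sub : Store → Store → ℕ → Prop} {σ : Store} (hI : HasInput G b k σ)
    (h5 : σ.nat 5 = 0) (a4 : ∀ i, σ.natArr 4 i = 0) (a5 : ∀ i, σ.natArr 5 i = 0) :
    Halts sub linkLoop σ (60 * m + 6) 0 fun τ =>
      (∀ v : Fin n, τ.natArr 4 v = G.outdeg Finset.univ v) ∧
      ∀ v : Fin n, ∃ es : List (Fin m), LinkedList (τ.natArr 6) (τ.natArr 5 v) es ∧ es.Nodup ∧
        ∀ e, e ∈ es ↔ G.dst e = v := by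
  let I : ℕ → Store → Prop := fun i τ =>
    (∀ v : Fin n, τ.natArr 4 v = G.outdeg (Finset.univ.filter fun e => (e : ℕ) < i) v) ∧
    ∀ v : Fin n, ∃ es : List (Fin m), LinkedList (τ.natArr 6) (τ.natArr 5 v) es ∧ es.Nodup ∧
        ∀ e, e ∈ es ↔ G.dst e = v ∧ (e : ℕ) < i
  refine (Halts.count (T := 50) (K := 0) I h5 hI.numEdges (by decide) ?_ ?_).mono
    (by omega) (by simp) ?_
  · refine ⟨fun v => ?_, fun v => ⟨[], ?_, by simp, by simp⟩⟩
    · simp [TaskGraph.outdeg, a4]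
    · exact a5 v
  · rintro i τ hlt hf hi ⟨hdeg, hlist⟩
    have hIτ := hI.of_frame hf (by decide)
    have hsrc : τ.natArr 0 i = _ := hIτ.src ⟨i, hlt⟩
    have hdst : τ.natArr 1 i = _ := hIτ.dst ⟨i, hlt⟩
    refine Halts.of_wp_frame ?_ (by decide) fun _ h _ => h
    simp only [Cmd.wp, NExp.eval, Store.natArr_putNat, Store.nat_putNat, if_false,
      Nat.reduceEqDiff, hi, hsrc, hdst, OfNat.zero_ne_ofNat, OfNat.one_ne_ofNat]
    refine ⟨by simp, fun v => ?_, fun v => ?_⟩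
    · have hset : (Finset.univ.filter fun e : Fin m => (e : ℕ) < i + 1) =
          insert ⟨i, hlt⟩ (Finset.univ.filter fun e : Fin m => (e : ℕ) < i) := by
        ext e
        simp only [Finset.mem_filter_univ, Finset.mem_insert, Fin.ext_iff]
        omega
      rw [hset, TaskGraph.outdeg_insert (by simp), ← hdeg v]
      simp only [Store.natArr_setNat, Store.natArr_putNat, Nat.reduceEqDiff, if_false, if_true]
      by_cases hv : G.src ⟨i, hlt⟩ = v
      · simp [hv]
      · rw [Function.update_of_ne (fun h => hv (Fin.ext h.symm))]
        simp [hv]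
    · simp only [Store.natArr_setNat, Store.natArr_putNat, Nat.reduceEqDiff, if_false, if_true]
      obtain ⟨es, hl, hn, hes⟩ := hlist v
      have hl' := hl.update (i := i) (fun e he => by have := (hes e).1 he; omega)
        (τ.natArr 5 (G.dst ⟨i, hlt⟩))
      by_cases hv : G.dst ⟨i, hlt⟩ = v
      · refine ⟨⟨i, hlt⟩ :: es, ⟨by simp [hv], ?_⟩, ?_, fun e => ?_⟩
        · rw [Function.update_self]
          rw [hv] at hl' ⊢
          exact hl'
        · rw [List.nodup_cons]
          refine ⟨fun h => ?_, hn⟩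
          have := (hes _).1 h
          simp at this
        · rw [List.mem_cons, hes]
          constructor
          · rintro (rfl | h)
            · exact ⟨hv, by simp⟩
            · exact ⟨h.1, by omega⟩
          · rintro ⟨h1, h2⟩
            by_cases h3 : (e : ℕ) = i
            · exact Or.inl (Fin.ext h3)
            · exact Or.inr ⟨h1, by omega⟩
      · refine ⟨es, ?_, hn, fun e => ?_⟩
        · rw [Function.update_of_ne (a := (v : ℕ)) fun h => hv (Fin.ext h.symm)]
          exact hl'
        · rw [hes]
          refine and_congr_right fun h1 => ⟨fun h => by omega, fun h => ?_⟩
          by_contra h3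
          have h4 : e = ⟨i, hlt⟩ := Fin.ext (by simp; omega)
          exact hv (h4 ▸ h1)
  · rintro τ ⟨hdeg, hlist⟩
    refine ⟨fun v => ?_, fun v => ?_⟩
    · rw [hdeg]
      congr 1
      ext e; simp
    · obtain ⟨es, h1, h2, h3⟩ := hlist v
      exact ⟨es, h1, h2, fun e => by simp [h3]⟩

/-- Puts the vertices without outgoing edges into a queue, and finds the rows of a table with `n`
rows of `k + 1` entries. -/
def queueLoop : Cmd :=
  .loop (.natLe (.add (.var 5) (.lit 1)) (.var 0)) (
    .ite (.natLe (.get 4 (.var 5)) (.lit 0))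
      (.putNat 7 (.var 6) (.var 5) ;; .setNat 6 (.add (.var 6) (.lit 1))) .skip ;;
    -- The machine does not multiply naturals, so the multiples of `k + 1` are accumulated by
    -- addition.
    .putNat 11 (.var 5) (.var 7) ;;
    .setNat 7 (.add (.add (.var 7) (.var 2)) (.lit 1)) ;;
    .setNat 5 (.add (.var 5) (.lit 1)))

lemma halts_queueLoop {sub : Store → Store → ℕ → Prop} {σ : Store} (hI : HasInput G b k σ)
    (h5 : σ.nat 5 = 0) (h6 : σ.nat 6 = 0) (h7 : σ.nat 7 = 0) :
    Halts sub queueLoop σ (60 * n + 6) 0 fun τ =>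
      (∀ v : Fin n, τ.natArr 11 v = v * (k + 1)) ∧
      ∃ todo : List (Fin n), Stores (τ.natArr 7) 0 todo ∧ todo.Nodup ∧ τ.nat 6 = todo.length ∧
        ∀ v, v ∈ todo ↔ σ.natArr 4 v = 0 := by
  let I : ℕ → Store → Prop := fun i τ => τ.nat 7 = i * (k + 1) ∧
    (∀ v : Fin n, v < i → τ.natArr 11 v = v * (k + 1)) ∧
      ∃ todo : List (Fin n), Stores (τ.natArr 7) 0 todo ∧ todo.Nodup ∧ τ.nat 6 = todo.length ∧
        ∀ v, v ∈ todo ↔ σ.natArr 4 v = 0 ∧ (v : ℕ) < i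
  refine (Halts.count (T := 50) (K := 0) I h5 hI.numVertices (by decide) ?_ ?_).mono
    (by omega) (by simp) ?_
  · exact ⟨by simpa using h7, by simp, [], trivial, by simp, h6, by simp⟩
  · rintro i τ hlt hf hi ⟨hb, hrow, todo, hq, hnd, hlen, hmem⟩
    have hIτ := hI.of_frame hf (by decide)
    have h4 : τ.natArr 4 = σ.natArr 4 := hf.natArr 4 (by decide)
    have hrow' : ∀ v : Fin n, v < i + 1 →
        Function.update (τ.natArr 11) i (i * (k + 1)) v = v * (k + 1) := by
      intro v hv
      by_cases h : (v : ℕ) = i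
      · simp [h]
      · rw [Function.update_of_ne h, hrow v (by omega)]
    have hb' : i * (k + 1) + k + 1 = (i + 1) * (k + 1) := by ring
    refine Halts.of_wp_frame ?_ (by decide) fun _ h _ => h
    simp only [Cmd.wp, NExp.eval, BExp.Holds, Store.nat_putNat, if_true,
      if_false, Nat.reduceEqDiff, hi, hb, hlen, h4, Store.nat_setNat,
      hIτ.budget, nonpos_iff_eq_zero]
    refine ⟨fun h0 => ⟨trivial, hb', hrow', todo ++ [⟨i, hlt⟩], ?_, ?_, by simp, fun v => ?_⟩,
      fun h0 => ⟨trivial, hb', hrow', todo, hq, hnd, hlen, fun v => ?_⟩⟩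
    · simpa using hq.concat ⟨i, hlt⟩
    · refine hnd.append (by simp) ?_
      simp [hmem]
    · rw [List.mem_append, hmem, List.mem_singleton, Fin.ext_iff]
      constructor
      · rintro (h | h)
        · exact ⟨h.1, by omega⟩
        · simp only at h
          exact ⟨h ▸ h0, by omega⟩
      · rintro ⟨h1, h2⟩
        by_cases h3 : (v : ℕ) = i
        · exact Or.inr h3
        · exact Or.inl ⟨h1, by omega⟩
    · rw [hmem]
      refine and_congr_right fun h1 => ⟨fun h => by omega, fun h => ?_⟩
      by_contra h3
      exact h0 ((show (v : ℕ) = i by omega) ▸ h1)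
  · rintro τ ⟨-, hrow, todo, hq, hnd, hlen, hmem⟩
    exact ⟨fun v => hrow v v.2, todo, hq, hnd, hlen, fun v => by simp [hmem]⟩

end

section

variable {n m : ℕ} {G : TaskGraph n m} {b : ℝ} {k : ℕ}

/-- Every edge comes after all the edges that start at its head. -/
def TaskGraph.IsSorted (G : TaskGraph n m) (done : List (Fin m)) : Prop :=
  ∀ i (h : i < done.length), ∀ f, G.src f = G.dst done[i] → f ∈ done.take i

lemma TaskGraph.IsSorted.concat {done : List (Fin m)} (h : G.IsSorted done) {e : Fin m}
    (he : ∀ f, G.src f = G.dst e → f ∈ done) : G.IsSorted (done ++ [e]) := by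
  intro i hi f hf
  by_cases h1 : i < done.length
  · rw [List.getElem_append_left h1] at hf
    rw [List.take_append_of_le_length h1.le]
    exact h i h1 f hf
  · have h2 : i = done.length := by simp at hi; omega
    subst h2
    simp only [List.getElem_concat_length] at hf
    simpa using he f hf

/-- State of the topological sorting: `done` are the sorted edges, `es` those waiting edges whose head
has left the queue, and `todo` is the queue. -/
structure SortState (G : TaskGraph n m) (head next outdeg queue ord : ℕ → ℕ) (p qi qlen cnt : ℕ)
    (done es : List (Fin m)) (todo : List (Fin n)) (seen : Finset (Fin n)) : Prop where
  ord : Stores ord 0 done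
  cnt : cnt = done.length
  done_nodup : done.Nodup
  waiting : LinkedList next p es
  es_nodup : es.Nodup
  queue : Stores queue qi todo
  qlen : qlen = qi + todo.length
  todo_nodup : todo.Nodup
  -- `seen` consists of the vertices that were ever put into the queue. Each enters once, so at most
  -- `n` vertices are taken out.
  card_seen : qi + todo.length = seen.card
  todo_subset : ∀ v ∈ todo, v ∈ seen
  outdeg : ∀ v : Fin n, outdeg v = G.outdeg (Finset.univ \ done.toFinset) v
  mem_seen : ∀ v, v ∈ seen ↔ ∀ e, G.src e = v → e ∈ done
  dst_mem_seen : ∀ e, G.dst e ∈ seen ↔ e ∈ done ∨ e ∈ es ∨ G.dst e ∈ todo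
  es_not_done : ∀ e ∈ es, e ∉ done
  todo_not_done : ∀ e, G.dst e ∈ todo → e ∉ done ∧ e ∉ es
  sorted : G.IsSorted done

variable {head next outdeg queue ord : ℕ → ℕ} {p qi qlen cnt : ℕ}
    {done es : List (Fin m)} {todo : List (Fin n)} {seen : Finset (Fin n)}

/-- When no edge is waiting, the next vertex `v` leaves the queue and the edges into `v` become the
waiting ones. None of them was treated before, as `v` was still in the queue. -/
lemma SortState.pop (h : SortState G head next outdeg queue ord p qi qlen cnt done es todo seen)
    (hp : p = 0) (hq : qi < qlen)
    (hhead : ∀ v : Fin n, ∃ es : List (Fin m), LinkedList next (head v) es ∧ es.Nodup ∧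
        ∀ e, e ∈ es ↔ G.dst e = v) :
    qi < n ∧ ∃ es' todo', SortState G head next outdeg queue ord (head (queue qi)) (qi + 1) qlen cnt
      done es' todo' seen := by
  have hes : es = [] := by
    cases es with
    | nil => rfl
    | cons e es => have := h.waiting.1; omega
  subst hes
  obtain ⟨v, todo', rfl⟩ : ∃ v todo', todo = v :: todo' := by
    cases todo with
    | nil => have := h.qlen; simp at this; omega
    | cons v todo' => exact ⟨v, todo', rfl⟩
  obtain ⟨es', h1, h2, h3⟩ := hhead v
  have hnd := List.nodup_cons.1 h.todo_nodup
  have hcard := h.card_seen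
  have hle : seen.card ≤ n := by simpa using Finset.card_le_univ seen
  simp only [List.length_cons] at hcard
  refine ⟨by omega, es', todo', ?_⟩
  constructor
  · exact h.ord
  · exact h.cnt
  · exact h.done_nodup
  · rw [h.queue.1]; exact h1
  · exact h2
  · exact h.queue.2
  · rw [h.qlen]; simp; omega
  · exact hnd.2
  · omega
  · exact fun w hw => h.todo_subset w (by simp [hw])
  · exact h.outdeg
  · exact h.mem_seen
  · intro e
    rw [h.dst_mem_seen, h3]
    simp
  · intro e he
    exact (h.todo_not_done e (by simp [(h3 e).1 he])).1
  · intro e he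
    refine ⟨(h.todo_not_done e (by simp [he])).1, fun h4 => hnd.1 ?_⟩
    rw [← (h3 e).1 h4]; exact he
  · exact h.sorted

/-- The first waiting edge is appended to the order and removed from the count of its tail; the tail
is queued once no edge out of it is left. -/
lemma SortState.step
    (h : SortState G head next outdeg queue ord p qi qlen cnt done es todo seen) (hp : p ≠ 0) :
    ∃ e : Fin m, p - 1 = e ∧ cnt < m ∧
      (outdeg (G.src e) - 1 = 0 → ∃ es' todo' seen', SortState G head next
        (Function.update outdeg (G.src e) (outdeg (G.src e) - 1))
        (Function.update queue qlen (G.src e)) (Function.update ord cnt e) (next e) qi (qlen + 1)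
        (cnt + 1) (done ++ [e]) es' todo' seen') ∧
      (outdeg (G.src e) - 1 ≠ 0 → ∃ es' todo' seen', SortState G head next
        (Function.update outdeg (G.src e) (outdeg (G.src e) - 1))
        queue (Function.update ord cnt e) (next e) qi qlen
        (cnt + 1) (done ++ [e]) es' todo' seen') := by
  obtain ⟨e, es', rfl⟩ : ∃ e es', es = e :: es' := by
    cases es with
    | nil => exact absurd h.waiting hp
    | cons e es => exact ⟨e, es, rfl⟩
  have hend : e ∉ done := h.es_not_done e (by simp)
  have hnd := List.nodup_cons.1 h.es_nodup
  have hdone : (done ++ [e]).Nodup := h.done_nodup.append (by simp) (by simpa using hend)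
  have hlen : cnt < m := by
    have := hdone.length_le_card
    simp only [List.length_append, List.length_singleton, Fintype.card_fin] at this
    rw [h.cnt]; omega
  have hord : Stores (Function.update ord cnt e) 0 (done ++ [e]) := by
    have := h.ord.concat e
    rwa [zero_add, ← h.cnt] at this
  have hins : insert e (Finset.univ \ (done ++ [e]).toFinset) = Finset.univ \ done.toFinset := by
    ext f
    by_cases hf : f = e <;> simp [hf, hend]
  have hdeg : ∀ v : Fin n, G.outdeg (Finset.univ \ done.toFinset) v =
      G.outdeg (Finset.univ \ (done ++ [e]).toFinset) v + if G.src e = v then 1 else 0 := by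
    intro v
    rw [← hins, TaskGraph.outdeg_insert (by simp)]
  have hdeg' : ∀ v : Fin n, Function.update outdeg (G.src e) (outdeg (G.src e) - 1) v =
      G.outdeg (Finset.univ \ (done ++ [e]).toFinset) v := by
    intro v
    by_cases hv : G.src e = v
    · subst hv
      rw [Function.update_self, h.outdeg, hdeg]
      simp
    · rw [Function.update_of_ne fun h' => hv (Fin.ext h'.symm), h.outdeg, hdeg]
      simp [hv]
  have hzero : ∀ v : Fin n, G.outdeg (Finset.univ \ (done ++ [e]).toFinset) v = 0 ↔
      ∀ f, G.src f = v → f ∈ done ++ [e] := by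
    intro v
    rw [TaskGraph.outdeg_eq_zero]
    simp only [Finset.mem_sdiff, Finset.mem_univ, true_and, not_not, List.mem_toFinset]
  have hz := hdeg' (G.src e)
  rw [Function.update_self] at hz
  have hseen : G.src e ∉ seen := fun hs => hend ((h.mem_seen _).1 hs e rfl)
  have hdst : G.dst e ∈ seen := (h.dst_mem_seen e).2 (by simp)
  -- The head of a waiting edge has been queued, and that happens only after all edges out of it are
  -- sorted.
  have hsorted : G.IsSorted (done ++ [e]) :=
    h.sorted.concat fun f hf => (h.mem_seen _).1 hdst f hf
  have hmem : ∀ v, v ≠ G.src e → (v ∈ seen ↔ ∀ f, G.src f = v → f ∈ done ++ [e]) := by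
    intro v hv
    rw [h.mem_seen]
    refine forall₂_congr fun f hf => ?_
    simp only [List.mem_append, List.mem_singleton]
    refine ⟨Or.inl, fun h' => h'.resolve_right ?_⟩
    rintro rfl
    exact hv hf.symm
  have hedst : G.dst e ∉ todo := fun hd => (h.todo_not_done e hd).2 (by simp)
  refine ⟨e, by have := h.waiting.1; omega, hlen, fun h0 => ?_, fun h0 => ?_⟩
  · rw [hz, hzero] at h0
    refine ⟨es', todo ++ [G.src e], insert (G.src e) seen, ?_⟩
    constructor
    · exact hord
    · rw [h.cnt]; simp
    · exact hdone
    · exact h.waiting.2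
    · exact hnd.2
    · rw [h.qlen]; exact h.queue.concat _
    · rw [h.qlen]; simp; omega
    · exact h.todo_nodup.append (by simp) (by simpa using fun hs => hseen (h.todo_subset _ hs))
    · rw [Finset.card_insert_of_notMem hseen, ← h.card_seen]; simp; omega
    · intro v hv
      rcases List.mem_append.1 hv with hv | hv
      · exact Finset.mem_insert_of_mem (h.todo_subset v hv)
      · simp_all
    · exact hdeg'
    · intro v
      by_cases hv : v = G.src e
      · subst hv
        simpa using h0
      · rw [← hmem v hv]; simp [hv]
    · intro f
      rw [Finset.mem_insert, h.dst_mem_seen]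
      simp only [List.mem_append, List.mem_cons]
      tauto
    · intro f hf
      have h1 := h.es_not_done f (by simp [hf])
      simp only [List.mem_append, List.mem_singleton, not_or]
      exact ⟨h1, fun h2 => hnd.1 (h2 ▸ hf)⟩
    · intro f hf
      -- The tail of `e` is new in the queue, so no edge into it can have been sorted or be waiting.
      have hfseen : G.dst f = G.src e → f ∉ done ∧ f ∉ e :: es' := fun h1 => by
        have := mt (h.dst_mem_seen f).2 (h1 ▸ hseen)
        tauto
      have h2 : f ∉ done ∧ f ∉ e :: es' := by
        rcases List.mem_append.1 hf with h1 | h1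
        · exact h.todo_not_done f h1
        · exact hfseen (by simpa using h1)
      simp_all
    · exact hsorted
  · rw [hz, Ne, hzero] at h0
    refine ⟨es', todo, seen, ?_⟩
    constructor
    · exact hord
    · rw [h.cnt]; simp
    · exact hdone
    · exact h.waiting.2
    · exact hnd.2
    · exact h.queue
    · exact h.qlen
    · exact h.todo_nodup
    · exact h.card_seen
    · exact h.todo_subset
    · exact hdeg'
    · intro v
      by_cases hv : v = G.src e
      · subst hv
        exact ⟨fun hs => absurd hs hseen, fun hs => absurd hs h0⟩
      · exact hmem v hv
    · intro f
      rw [h.dst_mem_seen]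
      simp only [List.mem_append, List.mem_cons]
      tauto
    · intro f hf
      have h1 := h.es_not_done f (by simp [hf])
      simp only [List.mem_append, List.mem_singleton, not_or]
      exact ⟨h1, fun h2 => hnd.1 (h2 ▸ hf)⟩
    · intro f hf
      have h2 := h.todo_not_done f hf
      simp_all
    · exact hsorted

/-- `ord` lists all edges such that every edge comes after all the edges that start at its head. -/
structure HasOrder (G : TaskGraph n m) (ord : ℕ → ℕ) (done : List (Fin m)) : Prop where
  length : done.length = m
  mem : ∀ e, e ∈ done
  nodup : done.Nodup
  sorted : G.IsSorted done
  stores : Stores ord 0 done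

/-- With no edge waiting and an empty queue, every edge into a seen vertex is sorted. By acyclicity,
induction from the sinks upwards then shows that every vertex has been seen, hence every edge
sorted. -/
lemma SortState.hasOrder
    (h : SortState G head next outdeg queue ord p qi qlen cnt done es todo seen) (hp : p = 0)
    (hq : qlen ≤ qi) : HasOrder G ord done := by
  have hes : es = [] := by
    cases es with
    | nil => rfl
    | cons e es => have := h.waiting.1; omega
  have htodo : todo = [] := by
    have := h.qlen
    exact List.length_eq_zero_iff.1 (by omega)
  subst hes htodo
  have hall : ∀ v, v ∈ seen := by
    refine G.induction fun v ih => ?_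
    rw [h.mem_seen]
    intro e he
    simpa using (h.dst_mem_seen e).1 (ih e he)
  have hmem : ∀ e, e ∈ done := fun e => (h.mem_seen (G.src e)).1 (hall _) e rfl
  refine ⟨?_, hmem, h.done_nodup, h.sorted, h.ord⟩
  rw [← List.toFinset_card_of_nodup h.done_nodup,
    Finset.eq_univ_of_forall fun e => List.mem_toFinset.2 (hmem e)]
  simp

/-- Sorts the edges topologically into the array `8`. -/
def sortLoop : Cmd :=
  .loop (.not (.and (.natLe (.var 8) (.lit 0)) (.natLe (.var 6) (.var 9)))) (
    -- The nested iteration over vertices and their incoming edges is flattened: a round either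
    -- takes a vertex from the queue or treats one waiting edge. Variable `8` points to the waiting
    -- edges, `9` and `6` delimit the queue, `10` counts sorted edges.
    .ite (.natLe (.var 8) (.lit 0))
      (.setNat 8 (.get 5 (.get 7 (.var 9))) ;; .setNat 9 (.add (.var 9) (.lit 1)))
      (.setNat 11 (.sub (.var 8) (.lit 1)) ;;
        .putNat 8 (.var 10) (.var 11) ;;
        .setNat 10 (.add (.var 10) (.lit 1)) ;;
        .setNat 12 (.get 0 (.var 11)) ;;
        .putNat 4 (.var 12) (.sub (.get 4 (.var 12)) (.lit 1)) ;;
        .ite (.natLe (.get 4 (.var 12)) (.lit 0))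
          (.putNat 7 (.var 6) (.var 12) ;; .setNat 6 (.add (.var 6) (.lit 1))) .skip ;;
        .setNat 8 (.get 6 (.var 11))))

lemma halts_sortLoop {sub : Store → Store → ℕ → Prop} {σ : Store} (hI : HasInput G b k σ)
    (h8 : σ.nat 8 = 0) (h9 : σ.nat 9 = 0) (h10 : σ.nat 10 = 0)
    (hdeg : ∀ v : Fin n, σ.natArr 4 v = G.outdeg Finset.univ v)
    (hhead : ∀ v : Fin n, ∃ es : List (Fin m), LinkedList (σ.natArr 6) (σ.natArr 5 v) es ∧
      es.Nodup ∧ ∀ e, e ∈ es ↔ G.dst e = v)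
    {todo : List (Fin n)} (hq : Stores (σ.natArr 7) 0 todo) (hnd : todo.Nodup)
    (hlen : σ.nat 6 = todo.length) (hmem : ∀ v, v ∈ todo ↔ σ.natArr 4 v = 0) :
    Halts sub sortLoop σ ((m + n) * 100 + 20) 0 fun τ => ∃ done, HasOrder G (τ.natArr 8) done := by
  -- Each round sorts an edge or removes a vertex from the queue, so at most `m + n` rounds occur.
  let I : ℕ → Store → Prop := fun r τ => ∃ done es todo seen,
    SortState G (σ.natArr 5) (σ.natArr 6) (τ.natArr 4) (τ.natArr 7) (τ.natArr 8) (τ.nat 8) (τ.nat 9)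
      (τ.nat 6) (τ.nat 10) done es todo seen ∧ r + τ.nat 10 + τ.nat 9 = m + n
  refine (Halts.loop (T := 80) (K := 0) I (r := m + n) ?_ ?_).mono ?_ (by simp) ?_
  · rintro r τ hf ⟨done, es, todo, seen, hs, hr⟩ hcond
    have h5 : τ.natArr 5 = σ.natArr 5 := hf.natArr 5 (by decide)
    have h6 : τ.natArr 6 = σ.natArr 6 := hf.natArr 6 (by decide)
    have hIτ := hI.of_frame hf (by decide)
    simp only [BExp.Holds, NExp.eval, nonpos_iff_eq_zero] at hcond
    have hcnt : τ.nat 10 ≤ m := by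
      rw [hs.cnt]; simpa using hs.done_nodup.length_le_card
    have hqi : τ.nat 9 ≤ n := by
      have h1 := hs.card_seen
      have h2 : seen.card ≤ n := by simpa using Finset.card_le_univ seen
      omega
    refine Halts.of_wp_frame ?_ (by decide) fun _ h _ => h
    simp only [Cmd.wp, NExp.eval, BExp.Holds, Store.natArr_putNat, Store.nat_putNat, if_true,
      if_false, Nat.reduceEqDiff, h5, h6, Store.nat_setNat, Store.natArr_setNat,
      nonpos_iff_eq_zero]
    refine ⟨fun h0 => ?_, fun h0 => ?_⟩
    · obtain ⟨hlt, es', todo', hs'⟩ := hs.pop h0 (not_le.1 fun h => hcond ⟨h0, h⟩) hhead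
      exact ⟨r - 1, by omega, done, es', todo', seen, by simpa using hs', by simp; omega⟩
    · obtain ⟨e, he, hlt, h1, h2⟩ := hs.step h0
      simp only [he, hIτ.src e, Function.update_self]
      refine ⟨fun h0' => ?_, fun h0' => ?_⟩
      · obtain ⟨es', todo', seen', hs'⟩ := h1 h0'
        exact ⟨r - 1, by omega, _, es', todo', seen', by simpa using hs', by simp; omega⟩
      · obtain ⟨es', todo', seen', hs'⟩ := h2 h0'
        exact ⟨r - 1, by omega, _, es', todo', seen', by simpa using hs', by simp; omega⟩
  · refine ⟨[], [], todo, todo.toFinset, ?_, by omega⟩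
    constructor
    · trivial
    · exact h10
    · simp
    · exact h8
    · simp
    · rw [h9]; exact hq
    · rw [hlen, h9]; simp
    · exact hnd
    · rw [List.toFinset_card_of_nodup hnd, h9, zero_add]
    · simp
    · intro v; rw [hdeg]; simp
    · intro v
      rw [List.mem_toFinset, hmem, hdeg, TaskGraph.outdeg_eq_zero]
      simp
    · simp
    · simp
    · simp
    · intro i hi; simp at hi
  · simp only [BExp.size, NExp.size]; omega
  · rintro τ ⟨⟨r, done, es, todo, seen, hs, hr⟩, hcond⟩
    simp only [BExp.Holds, NExp.eval, nonpos_iff_eq_zero, not_not] at hcond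
    exact ⟨done, hs.hasOrder hcond.1 hcond.2⟩

end

/-! ## Distances and default edges -/

section

variable {n m : ℕ} {G : TaskGraph n m} {b : ℝ} {k : ℕ}

/-- What is known about the vertex `v` when the edges `D` are relaxed: `r` tells whether the target can
be reached, `d` points to the default edge, `x` is the distance and `y` the least perceived cost. -/
structure IsRelaxed (G : TaskGraph n m) (b : ℝ) (D : List (Fin m)) (v : Fin n) (r d : ℕ)
    (x y : ℝ) : Prop where
  reach : r ≠ 0 ↔ v = G.t ∨ ∃ e ∈ D, e ∈ G.options G.t v
  target : v = G.t → x = 0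
  dist : v ≠ G.t → r ≠ 0 →
    (∃ e ∈ D, e ∈ G.options G.t v ∧ x = G.cost e + G.dist (G.dst e) G.t) ∧
      ∀ e ∈ D, e ∈ G.options G.t v → x ≤ G.cost e + G.dist (G.dst e) G.t
  default : v ≠ G.t → r ≠ 0 →
    ∃ g ∈ D, g ∈ G.options G.t v ∧ d = g + 1 ∧ y = G.perceived b G.t g ∧
      ∀ e ∈ D, e ∈ G.options G.t v → G.perceived b G.t g < G.perceived b G.t e ∨
        G.perceived b G.t g = G.perceived b G.t e ∧ G.dst g ≤ G.dst e

variable {D : List (Fin m)} {v : Fin n} {r d : ℕ} {x y : ℝ}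

lemma IsRelaxed.reaches_iff (h : IsRelaxed G b D v r d x y) (hD : ∀ f, G.src f = v → f ∈ D) :
    r ≠ 0 ↔ G.Reaches v G.t := by
  rw [h.reach]
  constructor
  · rintro (rfl | ⟨e, -, he⟩)
    · exact ⟨[], rfl⟩
    · obtain ⟨rfl, he⟩ := he
      exact he.of_edge
  · intro hr
    by_cases hv : v = G.t
    · exact Or.inl hv
    · obtain ⟨e, he⟩ := G.options_nonempty hr hv
      exact Or.inr ⟨e, hD e he.1, he⟩

lemma IsRelaxed.eq_dist (h : IsRelaxed G b D v r d x y) (hD : ∀ f, G.src f = v → f ∈ D)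
    (hr : G.Reaches v G.t) : x = G.dist v G.t := by
  by_cases hv : v = G.t
  · rw [h.target hv, hv, G.dist_self]
  · obtain ⟨⟨e, -, he, hx⟩, hle⟩ := h.dist hv ((h.reaches_iff hD).2 hr)
    apply le_antisymm
    · obtain ⟨f, hf, hfr, hfd⟩ := G.exists_edge_dist hr hv
      rw [hfd]
      exact hle f (hD f hf) ⟨hf, hfr⟩
    · rw [hx]
      obtain ⟨rfl, he⟩ := he
      exact G.dist_src_le he

lemma IsRelaxed.exists_isDefault (h : IsRelaxed G b D v r d x y) (hD : ∀ f, G.src f = v → f ∈ D)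
    (hr : G.Reaches v G.t) (hv : v ≠ G.t) :
    ∃ g, G.src g = v ∧ G.IsDefault b g ∧ d = g + 1 ∧ y = G.perceived b G.t g := by
  obtain ⟨g, -, hg, hd, hy, hall⟩ := h.default hv ((h.reaches_iff hD).2 hr)
  obtain ⟨rfl, hg'⟩ := hg
  have hle : ∀ f ∈ G.options G.t (G.src g), G.perceived b G.t g ≤ G.perceived b G.t f := by
    intro f hf
    rcases hall f (hD f hf.1) hf with h1 | h1
    · exact h1.le
    · exact h1.1.le
  refine ⟨g, rfl, ⟨⟨⟨rfl, hg'⟩, hle⟩, fun f hf => ?_⟩, hd, hy⟩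
  rcases hall f (hD f hf.1.1) hf.1 with h1 | h1
  · exact absurd (hf.2 g ⟨rfl, hg'⟩) (not_le.2 h1)
  · exact h1.2

lemma IsRelaxed.concat_of_notMem (h : IsRelaxed G b D v r d x y) {e : Fin m}
    (he : e ∉ G.options G.t v) : IsRelaxed G b (D ++ [e]) v r d x y := by
  have hmem : ∀ f, f ∈ G.options G.t v → (f ∈ D ++ [e] ↔ f ∈ D) := by
    intro f hf
    rw [List.mem_append, List.mem_singleton, or_iff_left]
    rintro rfl
    exact he hf
  refine ⟨?_, h.target, fun hv hr => ?_, fun hv hr => ?_⟩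
  · rw [h.reach]
    refine or_congr_right (exists_congr fun f => ?_)
    exact and_congr_left fun hf => (hmem f hf).symm
  · obtain ⟨⟨f, h1, h2, h3⟩, h4⟩ := h.dist hv hr
    exact ⟨⟨f, (hmem f h2).2 h1, h2, h3⟩, fun g hg hg' => h4 g ((hmem g hg').1 hg) hg'⟩
  · obtain ⟨f, h1, h2, h3, h4, h5⟩ := h.default hv hr
    exact ⟨f, (hmem f h2).2 h1, h2, h3, h4, fun g hg hg' => h5 g ((hmem g hg').1 hg) hg'⟩

lemma IsRelaxed.concat_of_zero (h : IsRelaxed G b D v r d x y) {e : Fin m}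
    (he : e ∈ G.options G.t v) (hr : r = 0) :
    IsRelaxed G b (D ++ [e]) v 1 (e + 1) (G.cost e + G.dist (G.dst e) G.t)
      (G.perceived b G.t e) := by
  have hnot := mt h.reach.2 (not_not.2 hr)
  push Not at hnot
  have hmem : ∀ f ∈ D ++ [e], f ∈ G.options G.t v → f = e := by
    intro f hf hf'
    rcases List.mem_append.1 hf with h1 | h1
    · exact absurd hf' (hnot.2 f h1)
    · simpa using h1
  refine ⟨?_, fun hv => absurd hv hnot.1, fun _ _ => ⟨⟨e, by simp, he, rfl⟩, ?_⟩,
    fun _ _ => ⟨e, by simp, he, rfl, rfl, ?_⟩⟩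
  · simp only [ne_eq, one_ne_zero, not_false_eq_true, true_iff]
    exact Or.inr ⟨e, by simp, he⟩
  · intro f hf hf'
    rw [hmem f hf hf']
  · intro f hf hf'
    rw [hmem f hf hf']
    exact Or.inr ⟨rfl, le_rfl⟩

/-- The alternatives in `hd` are the two outcomes of comparing the old and the new edge
lexicographically, by perceived cost and then by head, as the agent does among unchunked edges. -/
lemma IsRelaxed.concat_of_ne_zero (h : IsRelaxed G b D v r d x y) {e : Fin m}
    (he : e ∈ G.options G.t v) (hr : r ≠ 0) {x' y' : ℝ} {d' : ℕ}
    (hx : x' = min x (G.cost e + G.dist (G.dst e) G.t))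
    (hd : d' = d ∧ y' = y ∧ (y < G.perceived b G.t e ∨ y = G.perceived b G.t e ∧
        ∀ g : Fin m, d = g + 1 → G.dst g ≤ G.dst e) ∨
      d' = e + 1 ∧ y' = G.perceived b G.t e ∧ (G.perceived b G.t e < y ∨
        G.perceived b G.t e = y ∧ ∀ g : Fin m, d = g + 1 → G.dst e ≤ G.dst g)) :
    IsRelaxed G b (D ++ [e]) v r d' x' y' := by
  have hv : v ≠ G.t := by
    obtain ⟨rfl, h1⟩ := he
    exact G.src_ne_target h1
  have hmem : ∀ f, f ∈ D ++ [e] ↔ f ∈ D ∨ f = e := by simp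
  refine ⟨?_, fun hv' => absurd hv' hv, fun _ _ => ⟨?_, ?_⟩, fun _ _ => ?_⟩
  · exact ⟨fun _ => Or.inr ⟨e, by simp, he⟩, fun _ => hr⟩
  · obtain ⟨f, h1, h2, h3⟩ := (h.dist hv hr).1
    rcases min_choice x (G.cost e + G.dist (G.dst e) G.t) with hm | hm <;> rw [hx, hm]
    · exact ⟨f, by simp [h1], h2, h3⟩
    · exact ⟨e, by simp, he, rfl⟩
  · intro f hf hf'
    rw [hx]
    rcases (hmem f).1 hf with h1 | rfl
    · exact (min_le_left _ _).trans ((h.dist hv hr).2 f h1 hf')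
    · exact min_le_right _ _
  · obtain ⟨g, h1, h2, h3, h4, h5⟩ := h.default hv hr
    rw [h4] at hd
    rcases hd with ⟨hd', hy', hc⟩ | ⟨hd', hy', hc⟩
    · refine ⟨g, by simp [h1], h2, hd'.trans h3, hy', fun f hf hf' => ?_⟩
      rcases (hmem f).1 hf with h6 | rfl
      · exact h5 f h6 hf'
      · exact hc.imp_right fun h7 => ⟨h7.1, h7.2 g h3⟩
    · refine ⟨e, by simp, he, hd', hy', fun f hf hf' => ?_⟩
      rcases (hmem f).1 hf with h6 | rfl
      · rcases hc with hc | ⟨hc, hc'⟩ <;> rcases h5 f h6 hf' with h7 | ⟨h7, h8⟩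
        · exact Or.inl (hc.trans h7)
        · exact Or.inl (h7 ▸ hc)
        · exact Or.inl (hc ▸ h7)
        · exact Or.inr ⟨hc.trans h7, (hc' g h3).trans h8⟩
      · exact Or.inr ⟨rfl, le_rfl⟩

/-- Finds for every vertex its distance to the target, the least perceived cost and the default
edge. -/
def relaxLoop : Cmd :=
  .loop (.natLe (.add (.var 5) (.lit 1)) (.var 1)) (
    -- Variables `6`, `7` and `8` are the edge, its tail and its head; the real variables `1` and
    -- `2` are the distance and the perceived cost that the edge offers.
    .setNat 6 (.get 8 (.var 5)) ;;
    .setNat 7 (.get 0 (.var 6)) ;;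
    .setNat 8 (.get 1 (.var 6)) ;;
    .setNat 5 (.add (.var 5) (.lit 1)) ;;
    .ite (.natLe (.get 9 (.var 8)) (.lit 0)) .skip (
      .setReal 1 (.add (.get 0 (.var 6)) (.get 2 (.var 8))) ;;
      .setReal 2 (.add (.mul (.var 0) (.get 0 (.var 6))) (.get 2 (.var 8))) ;;
      .ite (.natLe (.get 9 (.var 7)) (.lit 0))
        (.putNat 9 (.var 7) (.lit 1) ;;
          .putNat 10 (.var 7) (.add (.var 6) (.lit 1)) ;;
          .putReal 2 (.var 7) (.var 1) ;;
          .putReal 3 (.var 7) (.var 2))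
        (.ite (.realLe (.get 2 (.var 7)) (.var 1)) .skip (.putReal 2 (.var 7) (.var 1)) ;;
          -- The old edge stays if it is perceived as strictly cheaper, or as equally expensive with
          -- a strictly smaller head.
          .ite (.and (.realLe (.get 3 (.var 7)) (.var 2))
              (.not (.and (.realLe (.var 2) (.get 3 (.var 7)))
                (.natLe (.var 8) (.get 1 (.sub (.get 10 (.var 7)) (.lit 1)))))))
            .skip
            (.putReal 3 (.var 7) (.var 2) ;;
              .putNat 10 (.var 7) (.add (.var 6) (.lit 1))))))

/-- The arrays `9`, `10`, `2` and `3` tell for every vertex whether the target can be reached, the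
default edge, the distance to the target, and the least perceived cost. -/
structure HasDist (G : TaskGraph n m) (b : ℝ) (σ : Store) : Prop where
  reach : ∀ v : Fin n, σ.natArr 9 v ≠ 0 ↔ G.Reaches v G.t
  dist : ∀ v : Fin n, G.Reaches v G.t → σ.realArr 2 v = G.dist v G.t
  default : ∀ v : Fin n, G.Reaches v G.t → v ≠ G.t → ∃ g, G.src g = v ∧ G.IsDefault b g ∧
    σ.natArr 10 v = g + 1 ∧ σ.realArr 3 v = G.perceived b G.t g

/-- A single relaxation of each edge suffices, because in the sorted order the values at its head
are final by then. -/
lemma halts_relaxLoop {sub : Store → Store → ℕ → Prop} {σ : Store} (hI : HasInput G b k σ)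
    (h5 : σ.nat 5 = 0) {done : List (Fin m)} (ho : HasOrder G (σ.natArr 8) done)
    (h9 : ∀ v : Fin n, σ.natArr 9 v = if v = G.t then 1 else 0)
    (h2 : ∀ v, σ.realArr 2 v = 0) :
    Halts sub relaxLoop σ (110 * m + 6) 0 (HasDist G b) := by
  let I : ℕ → Store → Prop := fun i τ => ∀ v : Fin n, IsRelaxed G b (done.take i) v
    (τ.natArr 9 v) (τ.natArr 10 v) (τ.realArr 2 v) (τ.realArr 3 v)
  refine (Halts.count (T := 100) (K := 0) I h5 hI.numEdges (by decide) ?_ ?_).mono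
    (by omega) (by simp) ?_
  · intro v
    refine ⟨by simp [h9], fun _ => h2 v, fun hv hr => ?_, fun hv hr => ?_⟩ <;>
    · rw [h9, if_neg hv] at hr
      exact absurd rfl hr
  · intro i τ hlt hf hi hrel
    have hIτ := hI.of_frame hf (by decide)
    have h8 : τ.natArr 8 = σ.natArr 8 := hf.natArr 8 (by decide)
    have hlt' : i < done.length := by rw [ho.length]; exact hlt
    obtain ⟨e, he⟩ : ∃ e, done[i] = e := ⟨_, rfl⟩
    have hord : σ.natArr 8 i = e := by
      have := ho.stores.getElem hlt'
      rwa [zero_add, he] at this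
    have htake : done.take (i + 1) = done.take i ++ [e] := by
      rw [List.take_succ_eq_append_getElem hlt', he]
    -- All edges out of the head of `e` come earlier in the order, so the relaxed values there are
    -- the true ones.
    have hall : ∀ f, G.src f = G.dst e → f ∈ done.take i := fun f hf =>
      ho.sorted i hlt' f (by rw [he]; exact hf)
    have hdst := hrel (G.dst e)
    have hreach := hdst.reaches_iff hall
    have hother : ∀ w : Fin n, w ≠ G.src e → IsRelaxed G b (done.take (i + 1)) w
        (τ.natArr 9 w) (τ.natArr 10 w) (τ.realArr 2 w) (τ.realArr 3 w) := by
      intro w hw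
      rw [htake]
      exact (hrel w).concat_of_notMem fun h => hw h.1.symm
    have hother' : ∀ w : Fin n, w ≠ G.src e → (w : ℕ) ≠ (G.src e : ℕ) :=
      fun w hw h => hw (Fin.ext h)
    refine Halts.of_wp_frame ?_ (by decide) fun _ h _ => h
    simp only [Cmd.wp, NExp.eval, RExp.eval, BExp.Holds, Store.nat_putNat,
      if_true, if_false, Nat.reduceEqDiff, h8, Store.nat_setNat, Store.natArr_setNat,
      nonpos_iff_eq_zero, Store.real_setNat, Store.realArr_setNat, Store.real_setReal,
      Store.nat_setReal, Store.natArr_setReal, Store.realArr_setReal, Store.natArr_putReal,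
      Store.nat_putReal, Store.real_putReal, Store.realArr_putReal,
      hi, hord, hIτ.src e, hIτ.dst e, hIτ.cost e, hIτ.bias]
    refine ⟨fun h0 => ⟨trivial, fun w => ?_⟩, fun h0 => ?_⟩
    · by_cases hw : w = G.src e
      · rw [htake]
        refine (hrel w).concat_of_notMem fun h => ?_
        exact (hreach.2 h.2) h0
      · exact hother w hw
    have hopt : e ∈ G.options G.t (G.src e) := ⟨rfl, hreach.1 h0⟩
    have hd : τ.realArr 2 (G.dst e) = G.dist (G.dst e) G.t := hdst.eq_dist hall (hreach.1 h0)
    have hperc : b * G.cost e + G.dist (G.dst e) G.t = G.perceived b G.t e := rfl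
    have hu := hrel (G.src e)
    rw [hd, hperc]
    refine ⟨fun hz => ⟨by simp, fun w => ?_⟩, fun hz => ?_⟩
    · by_cases hw : w = G.src e
      · subst hw
        simpa [htake] using hu.concat_of_zero hopt hz
      · simpa [Function.update_of_ne (hother' w hw)] using hother w hw
    · obtain ⟨g, -, hg, hgd, -⟩ := hu.default (G.src_ne_target hopt.2) hz
      have hgm : τ.natArr 10 (G.src e) - 1 = g := by omega
      have hguniq : ∀ f : Fin m, τ.natArr 10 (G.src e) = f + 1 → f = g := fun f hf =>
        Fin.ext (by omega)
      rw [hgm, hIτ.dst g]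
      generalize hy : τ.realArr 3 (G.src e) = y at *
      have hkeep : y ≤ G.perceived b G.t e ∧
          ¬ (G.perceived b G.t e ≤ y ∧ (G.dst e : ℕ) ≤ G.dst g) →
          y < G.perceived b G.t e ∨ y = G.perceived b G.t e ∧
            ∀ f : Fin m, τ.natArr 10 (G.src e) = f + 1 → G.dst f ≤ G.dst e := by
        rintro ⟨h1, h2⟩
        rcases h1.lt_or_eq with h3 | h3
        · exact Or.inl h3
        · refine Or.inr ⟨h3, fun f hf => ?_⟩
          rw [hguniq f hf, Fin.le_def]
          by_contra h4
          exact h2 ⟨h3.ge, by omega⟩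
      have hswap : ¬ (y ≤ G.perceived b G.t e ∧
          ¬ (G.perceived b G.t e ≤ y ∧ (G.dst e : ℕ) ≤ G.dst g)) →
          G.perceived b G.t e < y ∨ G.perceived b G.t e = y ∧
            ∀ f : Fin m, τ.natArr 10 (G.src e) = f + 1 → G.dst e ≤ G.dst f := by
        intro h
        by_cases h1 : y ≤ G.perceived b G.t e
        · have h2 : G.perceived b G.t e ≤ y ∧ (G.dst e : ℕ) ≤ G.dst g := by
            by_contra h3
            exact h ⟨h1, h3⟩
          exact Or.inr ⟨le_antisymm h2.1 h1, fun f hf => by rw [hguniq f hf]; exact h2.2⟩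
        · exact Or.inl (not_le.1 h1)
      refine ⟨fun h1 => ⟨fun h2 => ⟨trivial, fun w => ?_⟩, fun h2 => ⟨trivial, fun w => ?_⟩⟩,
        fun h1 => ⟨fun h2 => ⟨trivial, fun w => ?_⟩, fun h2 => ⟨trivial, fun w => ?_⟩⟩⟩ <;>
      by_cases hw : w = G.src e
      · subst hw
        simpa [htake, hy] using hu.concat_of_ne_zero hopt hz (min_eq_left h1).symm
          (Or.inl ⟨rfl, rfl, hkeep h2⟩)
      · simpa [Function.update_of_ne (hother' w hw)] using hother w hw
      · subst hw
        simpa [htake, hy] using hu.concat_of_ne_zero hopt hz (min_eq_left h1).symm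
          (Or.inr ⟨rfl, rfl, hswap h2⟩)
      · simpa [Function.update_of_ne (hother' w hw)] using hother w hw
      · subst hw
        simpa [htake, hy] using hu.concat_of_ne_zero hopt hz (min_eq_right (le_of_not_ge h1)).symm
          (Or.inl ⟨rfl, rfl, hkeep h2⟩)
      · simpa [Function.update_of_ne (hother' w hw)] using hother w hw
      · subst hw
        simpa [htake, hy] using hu.concat_of_ne_zero hopt hz (min_eq_right (le_of_not_ge h1)).symm
          (Or.inr ⟨rfl, rfl, hswap h2⟩)
      · simpa [Function.update_of_ne (hother' w hw)] using hother w hw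
  · intro τ h
    have hlen : done.take m = done := by rw [List.take_of_length_le ho.length.le]
    rw [show I m τ = _ from rfl] at h
    simp only [I, hlen] at h
    exact ⟨fun v => (h v).reaches_iff fun f _ => ho.mem f,
      fun v => (h v).eq_dist fun f _ => ho.mem f,
      fun v => (h v).exists_isDefault fun f _ => ho.mem f⟩

end

/-! ## Numbers of chunks needed to guide the agent -/

section

variable {n m : ℕ} {G : TaskGraph n m} {b : ℝ} {k : ℕ}

/-- The default edge has the least perceived cost at the tail, so a chunking guides exactly if its
bottleneck does not exceed that cost, and some `l`-chunking does so exactly if an optimal one does.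
For a default edge `e` the equivalence could fail, as it needs no chunking. -/
lemma TaskGraph.IsOptimalChunking.bottleneck_le_iff_guides {e g : Fin m} {l : ℕ} {xs : List ℝ}
    (h : G.IsOptimalChunking b e l xs) (hl : 1 ≤ l) (hr : G.Reaches (G.dst e) G.t)
    (hg : G.IsDefault b g) (hge : G.src g = G.src e) (he : ¬ G.IsDefault b e) :
    (G.bottleneck b e xs ≤ G.perceived b G.t g ↔ G.Guides b e l) ∧
      (G.bottleneck b e xs ≤ G.perceived b G.t g → G.IsGuiding b e xs) := by
  have h1 : G.bottleneck b e xs ≤ G.perceived b G.t g → G.IsGuiding b e xs := by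
    intro hle f hf
    rw [G.bottleneck_le_iff b h.1 hl hr] at hle
    exact hle.mono (hg.1.2 f (hge ▸ hf))
  refine ⟨⟨fun hle => ⟨hr, Or.inr ⟨hl, xs, h.1, h1 hle⟩⟩, fun hgd => ?_⟩, h1⟩
  obtain ⟨-, ys, hys, hyg⟩ := hgd.2.resolve_left he
  refine (h.2 ys hys).trans ((G.bottleneck_le_iff b hys hl hr _).2 (hyg g ?_))
  rw [← hge]
  exact hg.1.1

/-- `A` returns optimal chunkings in at most `C` steps per chunk. -/
def ChunksInTime (A : Cmd) (C : ℕ) : Prop :=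
  ∀ (n m : ℕ) (G : TaskGraph n m) (b : ℝ) (e : Fin m) (l : ℕ),
    1 < b → 1 ≤ l → G.Reaches (G.dst e) G.t →
    ∃ (τ : Store) (time : ℕ),
      asSub A (Store.args b (G.cost e) (G.dist (G.src e) G.t) (G.dist (G.dst e) G.t) l) τ time ∧
      G.IsOptimalChunking b e l (readList (τ.realArr 0) 0 l) ∧
      τ.real 0 = G.bottleneck b e (readList (τ.realArr 0) 0 l) ∧ time ≤ C * l

lemma IsEdgeChunker.exists_chunksInTime {A : Cmd} (h : IsEdgeChunker A) :
    ∃ C, ChunksInTime A C := by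
  obtain ⟨C, hC⟩ := h
  refine ⟨⌈C⌉₊, fun n m G b e l hb hl hr => ?_⟩
  obtain ⟨τ, time, h1, h2, h3, h4⟩ := hC n m G b e l hb hl hr
  refine ⟨τ, time, h1, h2, h3, ?_⟩
  have : (time : ℝ) ≤ (⌈C⌉₊ : ℝ) * l :=
    h4.trans (mul_le_mul_of_nonneg_right (Nat.le_ceil C) (Nat.cast_nonneg l))
  exact_mod_cast this

/-- Asks for an optimal chunking of the edge in the variable `5`, with endpoints in the variables `7`
and `8`, into as many chunks as the variable `x` says. -/
def askChunker (x : ℕ) : Cmd :=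
  .call (.var 0) (.get 0 (.var 5)) (.get 2 (.var 7)) (.get 2 (.var 8)) (.var x) 1 4

/-- Binary search for the least number of chunks that guides the agent along an edge. -/
def searchLoop : Cmd :=
  .loop (.natLe (.add (.var 9) (.lit 2)) (.var 10)) (
    .setNat 11 (.half (.add (.var 9) (.var 10))) ;;
    askChunker 11 ;;
    .ite (.realLe (.var 1) (.get 3 (.var 7))) (.setNat 10 (.var 11)) (.setNat 9 (.var 11)))

/-- Copies a returned chunking into the array `1`. -/
def copyLoop : Cmd :=
  .loop (.natLe (.add (.var 12) (.lit 1)) (.var 10)) (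
    .putReal 1 (.var 6) (.get 4 (.var 12)) ;;
    .setNat 6 (.add (.var 6) (.lit 1)) ;;
    .setNat 12 (.add (.var 12) (.lit 1)))

/-- Finds out how many chunks guide the agent along an edge which is not a default edge, and stores
them. -/
def searchEdge : Cmd :=
  -- The search keeps a number that is too small and one that is large enough; `k + 1` stands for
  -- more chunks than the budget allows.
  (.setNat 9 (.lit 0) ;; .setNat 10 (.add (.var 2) (.lit 1))) ;;
  searchLoop ;;
  .putNat 12 (.var 5) (.var 10) ;;
  -- The chunking is requested again, since the last call of the search need not have been for the
  -- number found.
  .ite (.natLe (.var 10) (.var 2))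
    (askChunker 10 ;; (.putNat 3 (.var 5) (.var 6) ;; .setNat 12 (.lit 0)) ;; copyLoop) .skip

/-- Finds out for every edge how many chunks guide the agent along it. -/
def needLoop : Cmd :=
  .loop (.natLe (.add (.var 5) (.lit 1)) (.var 1)) (
    (.setNat 7 (.get 0 (.var 5)) ;; .setNat 8 (.get 1 (.var 5))) ;;
    .ite (.natLe (.get 9 (.var 8)) (.lit 0)) (.putNat 12 (.var 5) (.add (.var 2) (.lit 1)))
      (.ite (.and (.natLe (.get 10 (.var 7)) (.add (.var 5) (.lit 1)))
          (.natLe (.add (.var 5) (.lit 1)) (.get 10 (.var 7))))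
        (.putNat 12 (.var 5) (.lit 0)) searchEdge) ;;
    .setNat 5 (.add (.var 5) (.lit 1)))

/-- The memory is ready for work on the edge `e`. -/
structure AtEdge (G : TaskGraph n m) (b : ℝ) (k : ℕ) (e : Fin m) (σ : Store) : Prop where
  input : HasInput G b k σ
  dist : HasDist G b σ
  edge : σ.nat 5 = e
  src : σ.nat 7 = G.src e
  dst : σ.nat 8 = G.dst e

lemma HasDist.congr {σ σ' : Store} (h : HasDist G b σ) (h9 : σ'.natArr 9 = σ.natArr 9)
    (h10 : σ'.natArr 10 = σ.natArr 10) (h2 : σ'.realArr 2 = σ.realArr 2)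
    (h3 : σ'.realArr 3 = σ.realArr 3) : HasDist G b σ' := by
  refine ⟨?_, ?_, ?_⟩
  · rw [h9]; exact h.reach
  · rw [h2]; exact h.dist
  · rw [h10, h3]; exact h.default

/-- The program `p` does not change the edge at work nor what is known about its ends. -/
def Cmd.keepsEdge (p : Cmd) : Bool :=
  p.keepsInput && [5, 7, 8].all (· ∉ p.natVars) && [9, 10].all (· ∉ p.natArrs) &&
    [2, 3].all (· ∉ p.realArrs)

lemma AtEdge.of_frame {e : Fin m} {p : Cmd} {σ σ' : Store} (h : AtEdge G b k e σ)
    (hf : p.Frame σ σ') (hp : p.keepsEdge = true) : AtEdge G b k e σ' := by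
  simp only [Cmd.keepsEdge, Bool.and_eq_true, List.all_cons, List.all_nil, decide_eq_true_eq,
    Bool.and_true] at hp
  obtain ⟨⟨⟨h1, h5, h7, h8⟩, h9, h10⟩, h2, h3⟩ := hp
  exact ⟨h.input.of_frame hf h1, h.dist.congr (hf.natArr _ h9) (hf.natArr _ h10) (hf.realArr _ h2)
    (hf.realArr _ h3), (hf.nat _ h5).trans h.edge, (hf.nat _ h7).trans h.src,
    (hf.nat _ h8).trans h.dst⟩

variable {A : Cmd} {C : ℕ} {e g : Fin m}

lemma halts_askChunker (hA : ChunksInTime A C) (hb : 1 < b) {σ : Store}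
    (hσ : AtEdge G b k e σ) (hr : G.Reaches (G.dst e) G.t) {x l : ℕ} (hx : σ.nat x = l)
    (hl : 1 ≤ l) :
    Halts (asSub A) (askChunker x) σ (9 + C * l) 1 fun σ' =>
      G.IsOptimalChunking b e l (readList (σ'.realArr 4) 0 l) ∧
      σ'.real 1 = G.bottleneck b e (readList (σ'.realArr 4) 0 l) := by
  obtain ⟨τ, time, h1, h2, h3, h4⟩ := hA n m G b e l hb hl hr
  have hin := hσ.input
  refine ⟨_, _, _, Run.call (τ := τ) (t := time) ?_, ?_, le_rfl, ?_⟩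
  · simpa only [RExp.eval, NExp.eval, hin.bias, hσ.edge, hσ.src, hσ.dst, hin.cost, hx,
      hσ.dist.dist _ hr, hσ.dist.dist _ hr.of_edge] using h1
  · simp only [RExp.size, NExp.size]; omega
  · simpa using ⟨h2, h3⟩

lemma halts_searchLoop (hA : ChunksInTime A C) (hb : 1 < b) (hk : 2 ≤ k) {σ : Store}
    (hσ : AtEdge G b k e σ) (hr : G.Reaches (G.dst e) G.t)
    (he : ¬ G.IsDefault b e) (h9 : σ.nat 9 = 0) (h10 : σ.nat 10 = k + 1) :
    Halts (asSub A) searchLoop σ ((Nat.log 2 k + 1) * (50 + C * k) + 10) (Nat.log 2 k + 1)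
      fun σ' => 1 ≤ σ'.nat 10 ∧ ∀ l ≤ k, G.Guides b e l ↔ σ'.nat 10 ≤ l := by
  obtain ⟨g, hge, hg, -, hgp⟩ := hσ.dist.default _ hr.of_edge (G.src_ne_target hr)
  -- Variable `9` never guides, and variable `10` guides unless it is still `k + 1`. Their gap is at
  -- most `2 ^ r`, initially `k + 1 ≤ 2 ^ (Nat.log 2 k + 1)`, and it is halved by each round.
  let I : ℕ → Store → Prop := fun r τ => τ.nat 9 < τ.nat 10 ∧ τ.nat 10 ≤ k + 1 ∧
    τ.nat 10 ≤ τ.nat 9 + 2 ^ r ∧ ¬ G.Guides b e (τ.nat 9) ∧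
    (τ.nat 10 ≤ k → G.Guides b e (τ.nat 10))
  refine (Halts.loop (T := 30 + C * k) (K := 1) I (r := Nat.log 2 k + 1) ?_ ?_).mono ?_
    (by simp) ?_
  · rintro r τ hf ⟨hlt, hhi, hgap, hlo, hgood⟩ hcond
    have hτ := hσ.of_frame hf (by decide)
    have hp : τ.realArr 3 (G.src e) = G.perceived b G.t g := by
      rw [hf.realArr 3 (by decide), hgp]
    simp only [BExp.Holds, NExp.eval] at hcond
    obtain ⟨r', rfl⟩ : ∃ r', r = r' + 1 := by
      cases r with
      | zero => simp at hgap; omega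
      | succ r' => exact ⟨r', rfl⟩
    rw [pow_succ] at hgap
    generalize hmid : (τ.nat 9 + τ.nat 10) / 2 = mid
    have hmid1 : 1 ≤ mid := by omega
    have hmidk : C * mid ≤ C * k := Nat.mul_le_mul_left _ (by omega)
    refine Halts.mono (T := 6 + ((9 + C * mid) + 10)) (K := 0 + (1 + 0)) (Halts.andThen
      (P' := fun τ₁ => τ₁.nat 11 = mid ∧ τ₁.nat 9 = τ.nat 9 ∧ τ₁.nat 10 = τ.nat 10)
      (Halts.of_wp_frame ?_ (by decide) fun _ h _ => h) ?_) (by omega) le_rfl fun _ h => h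
    · simp [Cmd.wp, NExp.eval, hmid]
    rintro τ₁ ⟨h11, h9', h10'⟩ hf₁
    have hτ₁ := hτ.of_frame hf₁ (by decide)
    rw [← hf₁.realArr 3 (by decide)] at hp
    refine Halts.andThen (halts_askChunker hA hb hτ₁ hr h11 hmid1) ?_
    rintro τ₂ ⟨hopt, hbot⟩ hf₂
    rw [← hf₂.realArr 3 (by decide)] at hp
    have e7 := hf₂.nat 7 (by decide)
    have e9 := hf₂.nat 9 (by decide)
    have e10 := hf₂.nat 10 (by decide)
    have e11 := hf₂.nat 11 (by decide)
    have hiff := (hopt.bottleneck_le_iff_guides hmid1 hr hg hge he).1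
    refine Halts.of_wp_frame ?_ (by decide) fun _ h _ => h
    simp only [Cmd.wp, NExp.eval, RExp.eval, BExp.Holds, e7, hτ₁.src, hp, hbot, e11, h11, hiff]
    refine ⟨fun h => ⟨r', by omega, ?_⟩, fun h => ⟨r', by omega, ?_⟩⟩
    · simp only [I, Store.nat_setNat, Nat.reduceEqDiff, if_true, if_false, e9, h9']
      exact ⟨by omega, by omega, by omega, hlo, fun _ => h⟩
    · simp only [I, Store.nat_setNat, Nat.reduceEqDiff, if_true, if_false, e10, h10']
      exact ⟨by omega, by omega, by omega, h, hgood⟩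
  · refine ⟨by omega, by omega, ?_, ?_, by omega⟩
    · have := Nat.lt_pow_succ_log_self (b := 2) (by omega) k
      omega
    · rw [h9]
      rintro ⟨-, h | h⟩
      · exact he h
      · omega
  · simp only [BExp.size, NExp.size, Nat.reduceAdd]
    rw [show 1 + 5 + (30 + C * k) = 36 + C * k by omega, Nat.mul_add, Nat.mul_add]
    omega
  · rintro τ ⟨⟨r, hlt, hhi, hgap, hlo, hgood⟩, hcond⟩
    simp only [BExp.Holds, NExp.eval, not_le] at hcond
    refine ⟨by omega, fun l hl => ⟨fun h => ?_, fun h => (hgood (by omega)).mono hb.le h⟩⟩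
    by_contra h'
    exact hlo (h.mono hb.le (by omega))

lemma halts_copyLoop {sub : Store → Store → ℕ → Prop} {σ : Store} {l : ℕ}
    (h10 : σ.nat 10 = l) (h12 : σ.nat 12 = 0) :
    Halts sub copyLoop σ (30 * l + 6) 0 fun τ => τ.nat 6 = σ.nat 6 + l ∧
      (∀ j < σ.nat 6, τ.realArr 1 j = σ.realArr 1 j) ∧
      readList (τ.realArr 1) (σ.nat 6) l = readList (σ.realArr 4) 0 l := by
  let I : ℕ → Store → Prop := fun i τ => τ.nat 6 = σ.nat 6 + i ∧
      (∀ j < σ.nat 6, τ.realArr 1 j = σ.realArr 1 j) ∧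
      ∀ j < i, τ.realArr 1 (σ.nat 6 + j) = σ.realArr 4 j
  refine (Halts.count (T := 20) (K := 0) I h12 h10 (by decide) ?_ ?_).mono
    (by omega) (by simp) ?_
  · exact ⟨rfl, fun _ _ => rfl, fun j hj => by omega⟩
  · rintro i τ hlt hf hi ⟨h6, hold, hnew⟩
    have h4 : τ.realArr 4 = σ.realArr 4 := hf.realArr 4 (by decide)
    refine Halts.of_wp_frame ?_ (by decide) fun _ h _ => h
    simp only [Cmd.wp, NExp.eval, RExp.eval, Store.nat_setNat, Store.nat_putReal, Nat.reduceEqDiff,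
      if_true, if_false, hi, h6, h4]
    refine ⟨trivial, by simp [add_assoc], fun j hj => ?_, fun j hj => ?_⟩ <;>
      simp only [Store.realArr_setNat, Store.realArr_putReal, if_true]
    · rw [Function.update_of_ne (by omega), hold j hj]
    · by_cases h : j = i
      · subst h; rw [Function.update_self]
      · rw [Function.update_of_ne (by omega), hnew j (by omega)]
  · rintro τ ⟨h6, hold, hnew⟩
    exact ⟨h6, hold, readList_congr fun j hj => by rw [hnew j hj, zero_add]⟩

/-- `r` is the number of chunks that guide the agent along `e`, if it is at most `k`, and then `xs`
is such a chunking. -/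
structure IsNeed (G : TaskGraph n m) (b : ℝ) (k : ℕ) (e : Fin m) (r : ℕ) (xs : List ℝ) : Prop where
  guides : ∀ l ≤ k, G.Guides b e l ↔ r ≤ l
  chunking : 1 ≤ r → r ≤ k → IsChunking (G.cost e) r xs ∧ G.IsGuiding b e xs

/-- The memory `τ` arises from `σ` when the numbers for the edge `e` are found. -/
structure NeedStep (G : TaskGraph n m) (b : ℝ) (k : ℕ) (e : Fin m) (σ τ : Store) : Prop where
  need : IsNeed G b k e (τ.natArr 12 e) (readList (τ.realArr 1) (τ.natArr 3 e) (τ.natArr 12 e))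
  fits : 1 ≤ τ.natArr 12 e → τ.natArr 12 e ≤ k → τ.natArr 3 e + τ.natArr 12 e ≤ τ.nat 6
  need_of_ne : ∀ i ≠ (e : ℕ), τ.natArr 12 i = σ.natArr 12 i
  pos_of_ne : ∀ i ≠ (e : ℕ), τ.natArr 3 i = σ.natArr 3 i
  le : σ.nat 6 ≤ τ.nat 6
  chunks : ∀ j < σ.nat 6, τ.realArr 1 j = σ.realArr 1 j

lemma halts_searchEdge (hA : ChunksInTime A C) (hb : 1 < b) (hk : 2 ≤ k) {σ : Store}
    (hσ : AtEdge G b k e σ) (hr : G.Reaches (G.dst e) G.t) (he : ¬ G.IsDefault b e) :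
    Halts (asSub A) searchEdge σ ((Nat.log 2 k + 1) * (50 + C * k) + C * k + 30 * k + 60)
      (Nat.log 2 k + 2) (NeedStep G b k e σ) := by
  refine Halts.mono (T := 10 + (((Nat.log 2 k + 1) * (50 + C * k) + 10) + (5 + (1 + 3 +
    ((9 + C * k) + (10 + (30 * k + 6)))))))
    (K := 0 + ((Nat.log 2 k + 1) + (0 + (1 + (0 + 0))))) (Halts.andThen
      (P' := fun τ => τ.nat 9 = 0 ∧ τ.nat 10 = k + 1 ∧ τ.nat 6 = σ.nat 6)
      (Halts.of_wp_frame ?_ (by decide) fun _ h _ => h) ?_) (by omega) (by omega) fun _ h => h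
  · simp [Cmd.wp, NExp.eval, hσ.input.budget]
  rintro σ₁ ⟨h9, h10, h6⟩ hf₁
  have hσ₁ := hσ.of_frame hf₁ (by decide)
  refine Halts.andThen (halts_searchLoop hA hb hk hσ₁ hr he h9 h10) ?_
  rintro σ₂ ⟨hpos, hneed⟩ hf₂
  have hσ₂ := hσ₁.of_frame hf₂ (by decide)
  have e6 : σ₂.nat 6 = σ.nat 6 := (hf₂.nat 6 (by decide)).trans h6
  have e12 : σ₂.natArr 12 = σ.natArr 12 :=
    (hf₂.natArr 12 (by decide)).trans (hf₁.natArr 12 (by decide))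
  have e3 : σ₂.natArr 3 = σ.natArr 3 :=
    (hf₂.natArr 3 (by decide)).trans (hf₁.natArr 3 (by decide))
  have e1 : σ₂.realArr 1 = σ.realArr 1 :=
    (hf₂.realArr 1 (by decide)).trans (hf₁.realArr 1 (by decide))
  generalize hL : σ₂.nat 10 = r at hpos hneed
  refine Halts.andThen (P' := fun τ => τ.nat 10 = r ∧ τ.nat 6 = σ.nat 6 ∧
    τ.natArr 12 = Function.update (σ.natArr 12) e r ∧ τ.natArr 3 = σ.natArr 3 ∧
    τ.realArr 1 = σ.realArr 1) (Halts.of_wp_frame ?_ (by simp [Cmd.steps, NExp.size])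
      fun _ h _ => h) ?_
  · simp [Cmd.wp, NExp.eval, hσ₂.edge, hL, e6, e12, e3, e1]
  rintro σ₃ ⟨g10, g6, g12, g3, g1⟩ hf₃
  have hσ₃ := hσ₂.of_frame hf₃ (by decide)
  have hn12 : ∀ i ≠ (e : ℕ), Function.update (σ.natArr 12) e r i = σ.natArr 12 i :=
    fun i hi => Function.update_of_ne hi _ _
  refine Halts.ite (fun hc => ?_) fun hc => ?_
  · simp only [BExp.Holds, NExp.eval, g10, hσ₃.input.budget] at hc
    refine Halts.mono (T := (9 + C * r) + (10 + (30 * r + 6))) (K := 1 + (0 + 0)) ?_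
      (by have := Nat.mul_le_mul_left C hc; omega) le_rfl fun _ h => h
    refine Halts.andThen (halts_askChunker hA hb hσ₃ hr g10 hpos) ?_
    rintro σ₄ ⟨hopt, -⟩ hf₄
    have hσ₄ := hσ₃.of_frame hf₄ (by decide)
    obtain ⟨g, hge, hg, -, -⟩ := hσ.dist.default _ hr.of_edge (G.src_ne_target hr)
    have hguide := hopt.bottleneck_le_iff_guides hpos hr hg hge he
    have hguiding := hguide.2 (hguide.1.2 ((hneed r hc).2 le_rfl))
    refine Halts.andThen (P' := fun τ => τ.nat 12 = 0 ∧ τ.nat 10 = r ∧ τ.nat 6 = σ.nat 6 ∧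
      τ.natArr 12 = Function.update (σ.natArr 12) e r ∧
      τ.natArr 3 = Function.update (σ.natArr 3) e (σ.nat 6) ∧
      τ.realArr 1 = σ.realArr 1 ∧ τ.realArr 4 = σ₄.realArr 4)
      (Halts.of_wp_frame ?_ (by decide) fun _ h _ => h) ?_
    · have f10 := (hf₄.nat 10 (by decide)).trans g10
      have f6 := (hf₄.nat 6 (by decide)).trans g6
      have f12 := (hf₄.natArr 12 (by decide)).trans g12
      have f3 := (hf₄.natArr 3 (by decide)).trans g3
      have f1 := (hf₄.realArr 1 (by decide)).trans g1
      simp [Cmd.wp, NExp.eval, hσ₄.edge, f10, f6, f12, f3, f1]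
    rintro σ₅ ⟨i12, i10, i6, j12, j3, j1, j4⟩ hf₅
    refine (halts_copyLoop i10 i12).frame.mono le_rfl le_rfl ?_
    rintro σ₆ ⟨⟨k6, kold, kread⟩, hf₆⟩
    rw [i6] at k6 kold kread
    have k12 := (hf₆.natArr 12 (by decide)).trans j12
    have k3 := (hf₆.natArr 3 (by decide)).trans j3
    constructor
    · rw [k12, k3, Function.update_self, Function.update_self, kread, j4]
      exact ⟨hneed, fun _ _ => ⟨hopt.1, hguiding⟩⟩
    · intro _ _
      rw [k12, k3, Function.update_self, Function.update_self, k6]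
    · rw [k12]; exact hn12
    · rw [k3]; exact fun i hi => Function.update_of_ne hi _ _
    · omega
    · rw [← j1]; exact kold
  · simp only [BExp.Holds, NExp.eval, g10, hσ₃.input.budget] at hc
    refine (Halts.of_wp ?_).mono (by simp only [Cmd.steps]; omega) (by omega) fun _ h => h
    simp only [Cmd.wp]
    constructor
    · rw [g12, Function.update_self]
      exact ⟨hneed, fun _ h => absurd h hc⟩
    · rw [g12, Function.update_self]
      exact fun _ h => absurd h hc
    · rw [g12]; exact hn12
    · rw [g3]; exact fun _ _ => rfl
    · exact g6.ge
    · rw [g1]; exact fun _ _ => rfl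

/-- The arrays `12`, `3` and `1` hold the numbers of chunks needed, and guiding chunkings. -/
def HasNeed (G : TaskGraph n m) (b : ℝ) (k : ℕ) (σ : Store) : Prop :=
  ∀ e : Fin m, IsNeed G b k e (σ.natArr 12 e)
    (readList (σ.realArr 1) (σ.natArr 3 e) (σ.natArr 12 e))

lemma halts_needLoop (hA : ChunksInTime A C) (hb : 1 < b) (hk : 2 ≤ k) {σ : Store}
    (hI : HasInput G b k σ) (hd : HasDist G b σ) (h5 : σ.nat 5 = 0) :
    Halts (asSub A) needLoop σ
      (m * ((Nat.log 2 k + 1) * (50 + C * k) + C * k + 30 * k + 100) + 6)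
      (m * (Nat.log 2 k + 2)) (HasNeed G b k) := by
  -- The chunkings are stored consecutively in real array `1`, and variable `6` is the first free
  -- position. Whatever belongs to earlier edges lies below it and survives later writing.
  let I : ℕ → Store → Prop := fun i τ => ∀ e : Fin m, (e : ℕ) < i →
    IsNeed G b k e (τ.natArr 12 e) (readList (τ.realArr 1) (τ.natArr 3 e) (τ.natArr 12 e)) ∧
    (1 ≤ τ.natArr 12 e → τ.natArr 12 e ≤ k → τ.natArr 3 e + τ.natArr 12 e ≤ τ.nat 6)
  have hstep : ∀ (e : Fin m) (τ τ' : Store), I e τ → NeedStep G b k e τ τ' → I (e + 1) τ' := by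
    intro e τ τ' hIe hs f hf
    by_cases hfe : f = e
    · subst hfe
      exact ⟨hs.need, hs.fits⟩
    · have hfe' : (f : ℕ) ≠ e := fun h => hfe (Fin.ext h)
      obtain ⟨h1, h2⟩ := hIe f (by omega)
      rw [hs.need_of_ne f hfe', hs.pos_of_ne f hfe']
      refine ⟨⟨h1.guides, fun h3 h4 => ?_⟩, fun h3 h4 => (h2 h3 h4).trans hs.le⟩
      rw [readList_congr (g := τ.realArr 1) (o' := τ.natArr 3 f)]
      · exact h1.chunking h3 h4
      · intro j hj
        have := h2 h3 h4
        exact hs.chunks _ (by omega)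
  refine (Halts.count (T := (Nat.log 2 k + 1) * (50 + C * k) + C * k + 30 * k + 94)
    (K := Nat.log 2 k + 2) I h5 hI.numEdges (by decide) ?_ ?_).mono ?_ le_rfl ?_
  · intro e he; omega
  · intro i τ hlt hf hi hIi
    have hIτ := hI.of_frame hf (by decide)
    have hdτ : HasDist G b τ := hd.congr (hf.natArr 9 (by decide)) (hf.natArr 10 (by decide))
      (hf.realArr 2 (by decide)) (hf.realArr 3 (by decide))
    generalize he : (⟨i, hlt⟩ : Fin m) = e
    obtain rfl : i = e := by rw [← he]
    refine Halts.mono (T := 10 + ((1 + 4 + (1 + 13 +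
      ((Nat.log 2 k + 1) * (50 + C * k) + C * k + 30 * k + 60))) + 4))
      (K := 0 + ((Nat.log 2 k + 2) + 0)) (Halts.andThen
      (P' := fun τ' => AtEdge G b k e τ' ∧ I e τ')
      (Halts.of_wp_frame ?_ (by decide) fun _ h _ => h) ?_) (by omega) (by omega) fun _ h => h
    · simp only [Cmd.wp, NExp.eval, hi, hIτ.src e, hIτ.dst e, Store.nat_setNat,
        Store.natArr_setNat, Nat.reduceEqDiff, if_false]
      refine ⟨⟨?_, hdτ.congr rfl rfl rfl rfl, ?_, ?_, ?_⟩, hIi⟩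
      · constructor <;> simp [hIτ.numVertices, hIτ.numEdges, hIτ.budget, hIτ.start, hIτ.target,
          hIτ.bias, hIτ.src, hIτ.dst, hIτ.cost]
      · simp [hi]
      · simp
      · simp
    rintro τ₁ ⟨hτ₁, hI₁⟩ -
    refine Halts.andThen (P' := fun τ₂ => τ₂.nat 5 = e ∧ I (e + 1) τ₂) ?_ ?_
    swap
    · rintro τ₂ ⟨h5', hI₂⟩ -
      refine Halts.of_wp_frame ?_ (by decide) fun _ h _ => h
      simp only [Cmd.wp, NExp.eval, Store.nat_setNat, if_true, h5', true_and]
      exact hI₂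
    have hreach := hτ₁.dist.reach (G.dst e)
    -- For `0` chunks or more than `k`, no chunking is claimed, so it does not matter which position
    -- is recorded for the edge.
    have hkeep : ∀ r, IsNeed G b k e r [] → r = 0 ∨ k < r → NeedStep G b k e τ₁
        (τ₁.putNat 12 e r) := by
      intro r hr hr0
      constructor
      · simp only [Store.natArr_putNat, if_true, Function.update_self]
        exact ⟨hr.guides, fun h1 h2 => by omega⟩
      · simp only [Store.natArr_putNat, if_true, Function.update_self]
        intro h1 h2
        omega
      · simp only [Store.natArr_putNat, if_true]
        exact fun i hi => Function.update_of_ne hi _ _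
      · exact fun _ _ => rfl
      · exact le_rfl
      · exact fun _ _ => rfl
    refine Halts.ite (fun hc => ?_) fun hc => Halts.ite (fun hc' => ?_) fun hc' => ?_
    · simp only [BExp.Holds, NExp.eval, hτ₁.dst, nonpos_iff_eq_zero] at hc
      refine (Halts.of_wp ?_).mono (by simp only [Cmd.steps, NExp.size]; omega) (by omega)
        fun _ h => h
      simp only [Cmd.wp, NExp.eval, hτ₁.edge, hτ₁.input.budget]
      refine ⟨hτ₁.edge, hstep e _ _ hI₁ (hkeep _ ⟨fun l hl => ?_, fun _ h => by omega⟩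
        (by omega))⟩
      exact ⟨fun h => absurd hc (hreach.2 h.1), fun h => by omega⟩
    all_goals
      simp only [BExp.Holds, NExp.eval, hτ₁.dst, nonpos_iff_eq_zero] at hc
      simp only [BExp.Holds, NExp.eval, hτ₁.src, hτ₁.edge] at hc'
      have hr := hreach.1 hc
      obtain ⟨g, hge, hg, hg10, -⟩ := hτ₁.dist.default _ hr.of_edge (G.src_ne_target hr)
      rw [hg10] at hc'
    · refine (Halts.of_wp ?_).mono (by simp only [Cmd.steps, NExp.size]; omega) (by omega)
        fun _ h => h
      simp only [Cmd.wp, NExp.eval, hτ₁.edge]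
      obtain rfl : g = e := Fin.ext (by omega)
      refine ⟨hτ₁.edge, hstep g _ _ hI₁ (hkeep _ ⟨fun l hl => ?_, fun h _ => by omega⟩
        (by omega))⟩
      exact ⟨fun _ => by omega, fun _ => ⟨hr, Or.inl hg⟩⟩
    · have hnd : ¬ G.IsDefault b e := by
        intro h
        have := hg.eq h hge
        subst this
        exact hc' ⟨le_rfl, le_rfl⟩
      refine (halts_searchEdge hA hb hk hτ₁ hr hnd).frame.mono le_rfl le_rfl ?_
      rintro τ₂ ⟨hs, hf₂⟩
      exact ⟨(hf₂.nat 5 (by decide)).trans hτ₁.edge, hstep e _ _ hI₁ hs⟩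
  · refine le_of_eq ?_
    congr 2
    omega
  · intro τ h e
    exact (h e e.2).1

end

/-! ## Cheapest walks within the budget -/

section

variable {n m : ℕ} {G : TaskGraph n m} {b : ℝ} {k : ℕ} {need : Fin m → ℕ}

/-- Number of chunks used along a walk. -/
def walkNeed (need : Fin m → ℕ) (p : List (Fin m)) : ℕ := (p.map need).sum

@[simp] lemma walkNeed_nil : walkNeed need [] = 0 := rfl

@[simp] lemma walkNeed_cons (e : Fin m) (p : List (Fin m)) :
    walkNeed need (e :: p) = need e + walkNeed need p := by simp [walkNeed]

@[simp] lemma walkNeed_append (p q : List (Fin m)) :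
    walkNeed need (p ++ q) = walkNeed need p + walkNeed need q := by simp [walkNeed]

/-- Cost of a cheapest walk to the target along which at most `j` chunks are needed. -/
noncomputable def budgetDist (G : TaskGraph n m) (need : Fin m → ℕ) (v : Fin n) (j : ℕ) : ℝ :=
  sInf {c | ∃ p, (G.IsWalk v p G.t ∧ walkNeed need p ≤ j) ∧ G.walkCost p = c}

lemma budgetDist_le {v : Fin n} {j : ℕ} {p : List (Fin m)} (hp : G.IsWalk v p G.t)
    (hj : walkNeed need p ≤ j) : budgetDist G need v j ≤ G.walkCost p := by
  refine csInf_le ⟨0, ?_⟩ ⟨p, ⟨hp, hj⟩, rfl⟩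
  rintro _ ⟨q, -, rfl⟩
  exact G.walkCost_nonneg q

/-- No chunks are needed along default edges. -/
def FreeDefault (G : TaskGraph n m) (b : ℝ) (need : Fin m → ℕ) : Prop :=
  ∀ e, G.IsDefault b e → need e = 0

/-- Following default edges from `v` leads to the target without any chunks, so every budget admits
a walk. -/
lemma FreeDefault.exists_walk (hn : FreeDefault G b need) (v : Fin n) (hv : G.Reaches v G.t) :
    ∃ p, G.IsWalk v p G.t ∧ walkNeed need p = 0 := by
  induction v using G.induction with
  | h v ih =>
    by_cases hvt : v = G.t
    · exact ⟨[], hvt, rfl⟩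
    · obtain ⟨e, he, hd⟩ := G.exists_isDefault b hv hvt
      obtain ⟨p, hp, hp0⟩ := ih e he hd.1.1.2
      exact ⟨e :: p, ⟨he, hp⟩, by simp [hp0, hn e hd]⟩

lemma FreeDefault.exists_budgetDist (hn : FreeDefault G b need) {v : Fin n}
    (hv : G.Reaches v G.t) (j : ℕ) :
    ∃ p, G.IsWalk v p G.t ∧ walkNeed need p ≤ j ∧ G.walkCost p = budgetDist G need v j := by
  have hfin : {p | G.IsWalk v p G.t ∧ walkNeed need p ≤ j}.Finite := by
    refine (List.finite_length_le (Fin m) m).subset fun p hp => ?_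
    simpa using (G.acyclic.nodup hp.1).length_le_card
  obtain ⟨p₀, hp₀, hp₀'⟩ := hn.exists_walk v hv
  obtain ⟨p, hp, hmin⟩ := Set.exists_min_image _ G.walkCost hfin ⟨p₀, hp₀, by simp [hp₀']⟩
  refine ⟨p, hp.1, hp.2, le_antisymm ?_ (budgetDist_le hp.1 hp.2)⟩
  refine le_csInf ⟨_, p, hp, rfl⟩ ?_
  rintro _ ⟨q, hq, rfl⟩
  exact hmin q hq

/-- Entry of the table for the vertex `v` and the budget `j` when the edges `D` are relaxed: `c` points
to the edge to take, and `x` is the cost. -/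
structure IsEntry (G : TaskGraph n m) (need : Fin m → ℕ) (D : List (Fin m)) (v : Fin n) (j c : ℕ)
    (x : ℝ) : Prop where
  target : v = G.t → x = 0
  ne_zero : ∀ e ∈ D, G.src e = v → need e ≤ j → c ≠ 0
  edge : c ≠ 0 → ∃ e ∈ D, G.src e = v ∧ need e ≤ j ∧ c = e + 1 ∧
    x = G.cost e + budgetDist G need (G.dst e) (j - need e)
  le : ∀ e ∈ D, G.src e = v → need e ≤ j →
    x ≤ G.cost e + budgetDist G need (G.dst e) (j - need e)

variable {D : List (Fin m)} {v : Fin n} {j c : ℕ} {x : ℝ}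

lemma IsEntry.concat_of_not (h : IsEntry G need D v j c x) {e : Fin m}
    (he : ¬ (G.src e = v ∧ need e ≤ j)) : IsEntry G need (D ++ [e]) v j c x := by
  have hmem : ∀ f ∈ D ++ [e], G.src f = v → need f ≤ j → f ∈ D := by
    intro f hf h1 h2
    rcases List.mem_append.1 hf with h3 | h3
    · exact h3
    · simp only [List.mem_singleton] at h3
      subst h3
      exact absurd ⟨h1, h2⟩ he
  refine ⟨h.target, fun f hf h1 h2 => h.ne_zero f (hmem f hf h1 h2) h1 h2, fun hc => ?_,
    fun f hf h1 h2 => h.le f (hmem f hf h1 h2) h1 h2⟩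
  obtain ⟨f, hf, h1⟩ := h.edge hc
  exact ⟨f, by simp [hf], h1⟩

lemma IsEntry.concat_keep (h : IsEntry G need D v j c x) {e : Fin m} (hc : c ≠ 0)
    (hx : x ≤ G.cost e + budgetDist G need (G.dst e) (j - need e)) :
    IsEntry G need (D ++ [e]) v j c x := by
  refine ⟨h.target, fun _ _ _ _ => hc, fun _ => ?_, fun f hf h1 h2 => ?_⟩
  · obtain ⟨f, hf, h1⟩ := h.edge hc
    exact ⟨f, by simp [hf], h1⟩
  · rcases List.mem_append.1 hf with h3 | h3
    · exact h.le f h3 h1 h2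
    · simp only [List.mem_singleton] at h3
      subst h3
      exact hx

lemma IsEntry.concat_replace (h : IsEntry G need D v j c x) {e : Fin m} (he : G.src e = v)
    (hej : need e ≤ j) (hv : v ≠ G.t)
    (hx : ¬ (1 ≤ c ∧ x ≤ G.cost e + budgetDist G need (G.dst e) (j - need e))) :
    IsEntry G need (D ++ [e]) v j (e + 1)
      (G.cost e + budgetDist G need (G.dst e) (j - need e)) := by
  refine ⟨fun hv' => absurd hv' hv, fun _ _ _ _ => by omega,
    fun _ => ⟨e, by simp, he, hej, rfl, rfl⟩, fun f hf h1 h2 => ?_⟩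
  rcases List.mem_append.1 hf with h3 | h3
  · have hc := h.ne_zero f h3 h1 h2
    have hlt : ¬ x ≤ G.cost e + budgetDist G need (G.dst e) (j - need e) :=
      fun hle => hx ⟨by omega, hle⟩
    exact (le_of_not_ge hlt).trans (h.le f h3 h1 h2)
  · simp only [List.mem_singleton] at h3
    subst h3
    exact le_rfl

/-- Bellman's equation: a cheapest walk within the budget consists of a first edge and a cheapest
walk within what is left. The default edge is always affordable, so away from the target the minimum
is over a nonempty set and the entry holds an edge. -/
lemma IsEntry.eq_budgetDist (hn : FreeDefault G b need)
    (hreach : ∀ e, need e ≤ k → G.Reaches (G.dst e) G.t)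
    (h : IsEntry G need D v j c x) (hD : ∀ f, G.src f = v → f ∈ D)
    (hv : G.Reaches v G.t) (hj : j ≤ k) :
    x = budgetDist G need v j ∧ (v ≠ G.t → c ≠ 0) := by
  by_cases hvt : v = G.t
  · refine ⟨?_, fun h' => absurd hvt h'⟩
    obtain ⟨p, hp, -, hpc⟩ := hn.exists_budgetDist hv j
    rw [h.target hvt]
    apply le_antisymm
    · rw [← hpc]; exact G.walkCost_nonneg p
    · simpa using budgetDist_le (G := G) (need := need) (v := v) (j := j) (p := []) hvt (by simp)
  · obtain ⟨e, he, hd⟩ := G.exists_isDefault b hv hvt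
    have hc : c ≠ 0 := h.ne_zero e (hD e he) he (by rw [hn e hd]; omega)
    refine ⟨le_antisymm ?_ ?_, fun _ => hc⟩
    · obtain ⟨p, hp, hpn, hpc⟩ := hn.exists_budgetDist hv j
      rw [← hpc]
      cases p with
      | nil => exact absurd hp hvt
      | cons f p =>
        rw [walkNeed_cons] at hpn
        refine (h.le f (hD f hp.1) hp.1 (by omega)).trans ?_
        rw [WDigraph.walkCost_cons]
        exact add_le_add le_rfl (budgetDist_le hp.2 (by omega))
    · obtain ⟨f, -, hf, hfj, -, hx⟩ := h.edge hc
      obtain ⟨p, hp, hpn, hpc⟩ := hn.exists_budgetDist (hreach f (by omega)) (j - need f)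
      rw [hx, ← hpc, ← WDigraph.walkCost_cons]
      exact budgetDist_le ⟨hf, hp⟩ (by rw [walkNeed_cons]; omega)

/-- Relaxes the row of the tail of an edge. -/
def rowLoop : Cmd :=
  .loop (.natLe (.var 7) (.var 2)) (
    -- Variable `7` is the budget at the tail, `8` the table position of the tail for it, and `9`
    -- that of the head for what remains after paying for the edge. They advance together, so no
    -- positions have to be computed.
    .setReal 1 (.add (.get 0 (.var 6)) (.get 5 (.var 9))) ;;
    .ite (.and (.natLe (.lit 1) (.get 13 (.var 8))) (.realLe (.get 5 (.var 8)) (.var 1))) .skip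
      (.putReal 5 (.var 8) (.var 1) ;; .putNat 13 (.var 8) (.add (.var 6) (.lit 1))) ;;
    .setNat 7 (.add (.var 7) (.lit 1)) ;;
    .setNat 8 (.add (.var 8) (.lit 1)) ;;
    .setNat 9 (.add (.var 9) (.lit 1)))

/-- Tabulates the costs of cheapest walks within all budgets up to `k`. -/
def tableLoop : Cmd :=
  .loop (.natLe (.add (.var 5) (.lit 1)) (.var 1)) (
    (.setNat 6 (.get 8 (.var 5)) ;;
      .setNat 7 (.get 12 (.var 6)) ;;
      .setNat 8 (.add (.get 11 (.get 0 (.var 6))) (.get 12 (.var 6))) ;;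
      .setNat 9 (.get 11 (.get 1 (.var 6)))) ;;
    rowLoop ;;
    .setNat 5 (.add (.var 5) (.lit 1)))

/-- The arrays `13` and `5` hold, in rows of `k + 1` entries, the table for the edges `D`. -/
def HasTable (G : TaskGraph n m) (k : ℕ) (need : Fin m → ℕ) (D : List (Fin m)) (σ : Store) : Prop :=
  ∀ (v : Fin n) (j : ℕ), j ≤ k →
    IsEntry G need D v j (σ.natArr 13 (v * (k + 1) + j)) (σ.realArr 5 (v * (k + 1) + j))

lemma index_inj {v w j i : ℕ} (hj : j ≤ k) (hi : i ≤ k)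
    (h : v * (k + 1) + j = w * (k + 1) + i) : v = w ∧ j = i := by
  have hv : v = w := by
    rcases lt_trichotomy v w with hlt | heq | hlt
    · have := Nat.mul_le_mul_right (k + 1) (Nat.succ_le_of_lt hlt)
      rw [Nat.succ_mul] at this
      omega
    · exact heq
    · have := Nat.mul_le_mul_right (k + 1) (Nat.succ_le_of_lt hlt)
      rw [Nat.succ_mul] at this
      omega
  subst hv
  exact ⟨rfl, by omega⟩

/-- Relaxing `e` changes only the row of its tail, from the budget `need e` on; smaller budgets
cannot afford `e`. If `need e` exceeds `k`, no round takes place. -/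
lemma halts_rowLoop {sub : Store → Store → ℕ → Prop} {σ : Store} (hI : HasInput G b k σ)
    (hn : FreeDefault G b need) (hreach : ∀ e, need e ≤ k → G.Reaches (G.dst e) G.t)
    {e : Fin m} (h6 : σ.nat 6 = e) (h7 : σ.nat 7 = need e)
    (h8 : σ.nat 8 = G.src e * (k + 1) + need e) (h9 : σ.nat 9 = G.dst e * (k + 1))
    (hD : ∀ f, G.src f = G.dst e → f ∈ D) (ht : HasTable G k need D σ) :
    Halts sub rowLoop σ (60 * (k + 1) + 10) 0 (HasTable G k need (D ++ [e])) := by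
  -- After `i` rounds the row of the tail takes `e` into account for budgets below `need e + i`;
  -- everything else still refers to `D`.
  let I : ℕ → Store → Prop := fun r τ => ∃ i, need e + i + r = max (need e) (k + 1) ∧
    τ.nat 7 = need e + i ∧ τ.nat 8 = G.src e * (k + 1) + (need e + i) ∧
    τ.nat 9 = G.dst e * (k + 1) + i ∧
    ∀ (v : Fin n) (j : ℕ), j ≤ k →
      IsEntry G need (if v = G.src e ∧ j < need e + i then D ++ [e] else D) v j
        (τ.natArr 13 (v * (k + 1) + j)) (τ.realArr 5 (v * (k + 1) + j))
  have hlen : k + 1 - need e ≤ k + 1 := Nat.sub_le _ _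
  refine (Halts.loop (T := 50) (K := 0) I (r := k + 1 - need e) ?_ ?_).frame.mono ?_ (by simp) ?_
  · rintro r τ hf ⟨i, hir, g7, g8, g9, hent⟩ hcond
    have hIτ := hI.of_frame hf (by decide)
    have g6 : τ.nat 6 = e := (hf.nat 6 (by decide)).trans h6
    simp only [BExp.Holds, NExp.eval, g7, hIτ.budget] at hcond
    have hr := hreach e (by omega)
    -- The row of the head is final by the sorted order, and it is not being modified since an
    -- acyclic graph has no loops.
    have hval : τ.realArr 5 (G.dst e * (k + 1) + i) = budgetDist G need (G.dst e) i := by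
      have := hent (G.dst e) i (by omega)
      rw [if_neg (fun h => G.src_ne_dst e h.1.symm)] at this
      exact (this.eq_budgetDist hn hreach hD hr (by omega)).1
    have hcur := hent (G.src e) (need e + i) hcond
    rw [if_neg (by omega)] at hcur
    have hsub : need e + i - need e = i := by omega
    have hnext : ∀ (f : ℕ → ℕ) (g : ℕ → ℝ), IsEntry G need (D ++ [e]) (G.src e) (need e + i)
          (f (G.src e * (k + 1) + (need e + i))) (g (G.src e * (k + 1) + (need e + i))) →
        (∀ a ≠ (G.src e * (k + 1) + (need e + i) : ℕ), f a = τ.natArr 13 a) →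
        (∀ a ≠ (G.src e * (k + 1) + (need e + i) : ℕ), g a = τ.realArr 5 a) →
        ∀ (v : Fin n) (j : ℕ), j ≤ k →
          IsEntry G need (if v = G.src e ∧ j < need e + (i + 1) then D ++ [e] else D) v j
            (f (v * (k + 1) + j)) (g (v * (k + 1) + j)) := by
      intro f g hfg hf' hg' v j hj
      by_cases hvj : v = G.src e ∧ j = need e + i
      · obtain ⟨rfl, rfl⟩ := hvj
        rw [if_pos ⟨rfl, by omega⟩]
        exact hfg
      · have hne : (v * (k + 1) + j : ℕ) ≠ G.src e * (k + 1) + (need e + i) := by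
          intro h
          have := index_inj hj hcond h
          exact hvj ⟨Fin.ext this.1, this.2⟩
        rw [hf' _ hne, hg' _ hne]
        have := hent v j hj
        have hiff : (v = G.src e ∧ j < need e + (i + 1)) ↔ (v = G.src e ∧ j < need e + i) := by
          refine and_congr_right fun hv => ?_
          have : j ≠ need e + i := fun h => hvj ⟨hv, h⟩
          omega
        simpa only [hiff] using this
    refine Halts.of_wp_frame ?_ (by decide) fun _ h _ => h
    simp only [Cmd.wp, NExp.eval, RExp.eval, BExp.Holds, Store.nat_setReal, Store.natArr_setReal,
      Store.realArr_setReal, Store.real_setReal, Store.nat_setNat, Store.nat_putNat,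
      Store.nat_putReal, Nat.reduceEqDiff,
      if_true, if_false, g6, g7, g8, g9, hIτ.cost e, hval]
    refine ⟨fun hkeep => ⟨r - 1, by omega, i + 1, by omega, ?_, ?_, ?_, ?_⟩,
      fun hnot => ⟨r - 1, by omega, i + 1, by omega, ?_, ?_, ?_, ?_⟩⟩
    · simp [add_assoc]
    · simp [add_assoc]
    · simp [add_assoc]
    · refine hnext _ _ (hcur.concat_keep (by simp; omega) ?_) (fun _ _ => rfl) (fun _ _ => rfl)
      rw [hsub]
      exact hkeep.2
    · simp [add_assoc]
    · simp [add_assoc]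
    · simp [add_assoc]
    · have hrep := hcur.concat_replace rfl (by omega) (G.src_ne_target hr)
        (by rw [hsub]; exact hnot)
      rw [hsub] at hrep
      refine hnext _ _ ?_ ?_ ?_
      · simpa using hrep
      · intro a ha
        simp [Function.update_of_ne ha]
      · intro a ha
        simp [Function.update_of_ne ha]
  · refine ⟨0, by omega, h7, h8, h9, fun v j hj => ?_⟩
    split_ifs with h
    · exact (ht v j hj).concat_of_not (by omega)
    · exact ht v j hj
  · simp only [BExp.size, NExp.size, Nat.reduceAdd]; omega
  · rintro τ ⟨⟨⟨r, i, hir, g7, g8, g9, hent⟩, hcond⟩, hf⟩ v j hj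
    simp only [BExp.Holds, NExp.eval, g7, (hI.of_frame hf (by decide)).budget] at hcond
    have := hent v j hj
    by_cases hv : v = G.src e
    · rwa [if_pos ⟨hv, by omega⟩] at this
    · rw [if_neg fun h => hv h.1] at this
      exact this.concat_of_not fun h => hv h.1.symm

lemma halts_tableLoop {sub : Store → Store → ℕ → Prop} {σ : Store} (hI : HasInput G b k σ)
    (hn : FreeDefault G b need) (hreach : ∀ e, need e ≤ k → G.Reaches (G.dst e) G.t)
    (h5 : σ.nat 5 = 0) {done : List (Fin m)} (ho : HasOrder G (σ.natArr 8) done)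
    (hbase : ∀ v : Fin n, σ.natArr 11 v = v * (k + 1))
    (hneed : ∀ e : Fin m, σ.natArr 12 e = need e)
    (h13 : ∀ i, σ.natArr 13 i = 0) (hr5 : ∀ i, σ.realArr 5 i = 0) :
    Halts sub tableLoop σ (m * (60 * (k + 1) + 50) + 6) 0 (HasTable G k need done) := by
  let I : ℕ → Store → Prop := fun i τ => HasTable G k need (done.take i) τ
  refine (Halts.count (T := 30 + ((60 * (k + 1) + 10) + 4)) (K := 0) I h5 hI.numEdges (by decide)
    ?_ ?_).mono ?_ (by simp) ?_
  · intro v j hj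
    rw [h13, hr5]
    exact ⟨fun _ => rfl, by simp, by simp, by simp⟩
  · intro i τ hlt hf hi ht
    have hIτ := hI.of_frame hf (by decide)
    have h8 : τ.natArr 8 = σ.natArr 8 := hf.natArr 8 (by decide)
    have h11 : τ.natArr 11 = σ.natArr 11 := hf.natArr 11 (by decide)
    have h12 : τ.natArr 12 = σ.natArr 12 := hf.natArr 12 (by decide)
    have hlt' : i < done.length := by rw [ho.length]; exact hlt
    obtain ⟨e, he⟩ : ∃ e, done[i] = e := ⟨_, rfl⟩
    have hord : σ.natArr 8 i = e := by
      have := ho.stores.getElem hlt'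
      rwa [zero_add, he] at this
    have htake : done.take (i + 1) = done.take i ++ [e] := by
      rw [List.take_succ_eq_append_getElem hlt', he]
    have hall : ∀ f, G.src f = G.dst e → f ∈ done.take i := fun f hf =>
      ho.sorted i hlt' f (by rw [he]; exact hf)
    refine Halts.mono (K := 0 + (0 + 0)) (Halts.andThen (T := 30) (P' := fun τ₁ =>
      τ₁.nat 5 = i ∧ τ₁.nat 6 = e ∧ τ₁.nat 7 = need e ∧
        τ₁.nat 8 = G.src e * (k + 1) + need e ∧ τ₁.nat 9 = G.dst e * (k + 1) ∧
        HasTable G k need (done.take i) τ₁)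
      (Halts.of_wp_frame ?_ (by decide) fun _ h _ => h) ?_) le_rfl (by omega) fun _ h => h
    · simp only [Cmd.wp, NExp.eval, Store.nat_setNat, Store.natArr_setNat, Nat.reduceEqDiff,
        if_true, if_false, hi, h8, h11, h12, hord, hIτ.src e, hIτ.dst e, hbase, hneed, true_and]
      exact ht
    rintro τ₁ ⟨g5, g6, g7, g8, g9, ht₁⟩ hf₁
    refine Halts.andThen (halts_rowLoop (hIτ.of_frame hf₁ (by decide)) hn hreach g6 g7 g8 g9 hall
      ht₁) ?_
    intro τ₂ ht₂ hf₂
    have g5' := (hf₂.nat 5 (by decide)).trans g5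
    refine Halts.of_wp_frame ?_ (by decide) fun _ h _ => h
    simp only [Cmd.wp, NExp.eval, Store.nat_setNat, if_true, g5', true_and]
    change HasTable G k need (done.take (i + 1)) τ₂
    rw [htake]
    exact ht₂
  · refine le_of_eq ?_
    congr 2
    omega
  · intro τ h
    have hlen : done.take m = done := by rw [List.take_of_length_le ho.length.le]
    simpa only [I, hlen] using h

/-- Chunks the edges of a cheapest walk within the budget. -/
def traceLoop : Cmd :=
  .loop (.not (.and (.natLe (.var 5) (.var 4)) (.natLe (.var 4) (.var 5)))) (
    .setNat 7 (.sub (.get 13 (.add (.get 11 (.var 5)) (.var 6))) (.lit 1)) ;;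
    .putNat 2 (.var 7) (.get 12 (.var 7)) ;;
    .setNat 6 (.sub (.var 6) (.get 12 (.var 7))) ;;
    .setNat 5 (.get 1 (.var 7)))

/-- From the start with the full budget, each entry names the next edge of an optimal walk. As the
walk built so far repeats no edge, at most `m` rounds occur. -/
lemma halts_traceLoop {sub : Store → Store → ℕ → Prop} {σ : Store} (hI : HasInput G b k σ)
    (hn : FreeDefault G b need) (hreach : ∀ e, need e ≤ k → G.Reaches (G.dst e) G.t)
    {done : List (Fin m)} (hdone : ∀ e, e ∈ done) (ht : HasTable G k need done σ)
    (hbase : ∀ v : Fin n, σ.natArr 11 v = v * (k + 1))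
    (hneed : ∀ e : Fin m, σ.natArr 12 e = need e) (h2 : ∀ e : Fin m, σ.natArr 2 e = 0)
    (h5 : σ.nat 5 = G.s) (h6 : σ.nat 6 = k) :
    Halts sub traceLoop σ (60 * m + 10) 0 fun τ => ∃ p, G.IsWalk G.s p G.t ∧ walkNeed need p ≤ k ∧
      G.walkCost p ≤ budgetDist G need G.s k ∧
      ∀ e : Fin m, τ.natArr 2 e = if e ∈ p then need e else 0 := by
  -- `p` is the part of the walk already traced and `j` the budget left at its end `v`; its cost
  -- plus the entry at `(v, j)` never exceeds the optimum for `s`.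
  let I : ℕ → Store → Prop := fun r τ => ∃ (v : Fin n) (p : List (Fin m)) (j : ℕ),
    τ.nat 5 = v ∧ τ.nat 6 = j ∧ G.Reaches v G.t ∧ G.IsWalk G.s p v ∧ r + p.length = m ∧
    walkNeed need p + j ≤ k ∧
    G.walkCost p + budgetDist G need v j ≤ budgetDist G need G.s k ∧
    ∀ e : Fin m, τ.natArr 2 e = if e ∈ p then need e else 0
  refine (Halts.loop (T := 40) (K := 0) I (r := m) ?_ ?_).frame.mono ?_ (by simp) ?_
  · rintro r τ hf ⟨v, p, j, hv, hj, hvr, hp, hr, hjk, hcost, hcnt⟩ hcond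
    have hIτ := hI.of_frame hf (by decide)
    have g11 : τ.natArr 11 = σ.natArr 11 := hf.natArr 11 (by decide)
    have g12 : τ.natArr 12 = σ.natArr 12 := hf.natArr 12 (by decide)
    have g13 : τ.natArr 13 = σ.natArr 13 := hf.natArr 13 (by decide)
    simp only [BExp.Holds, NExp.eval, hv, hIτ.target] at hcond
    have hvt : v ≠ G.t := by
      rintro rfl
      exact hcond ⟨le_rfl, le_rfl⟩
    have hent := ht v j (by omega)
    obtain ⟨hx, hc⟩ := hent.eq_budgetDist hn hreach (fun f _ => hdone f) hvr (by omega)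
    obtain ⟨e, -, he, hej, hce, hxe⟩ := hent.edge (hc hvt)
    have hwalk : G.IsWalk G.s (p ++ [e]) (G.dst e) :=
      G.isWalk_append hp ⟨he, rfl⟩
    have hlen := (G.acyclic.nodup hwalk).length_le_card
    simp only [List.length_append, List.length_singleton, Fintype.card_fin] at hlen
    refine Halts.of_wp_frame ?_ (by decide) fun _ h _ => h
    simp only [Cmd.wp, NExp.eval, Store.nat_setNat, Store.natArr_setNat, Store.nat_putNat,
      Store.natArr_putNat, Nat.reduceEqDiff, if_true, if_false, hv, hj, g11, g12, g13, hbase, hce,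
      Nat.add_sub_cancel, hneed, hIτ.dst e]
    refine ⟨r - 1, by omega, G.dst e, p ++ [e], j - need e, by simp, by simp,
      hreach e (by omega), hwalk, by simp; omega, ?_, ?_, fun f => ?_⟩
    · rw [walkNeed_append, walkNeed_cons, walkNeed_nil]; omega
    · rw [WDigraph.walkCost_append, WDigraph.walkCost_cons, WDigraph.walkCost_nil]
      linarith
    · simp only [Store.natArr_setNat, Store.natArr_putNat, if_true]
      by_cases hfe : f = e
      · subst hfe; simp
      · rw [Function.update_of_ne fun h => hfe (Fin.ext h), hcnt]
        simp [hfe]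
  · exact ⟨G.s, [], k, h5, h6, G.reaches, rfl, by simp, by simp, by simp, by simp [h2]⟩
  · simp only [BExp.size, NExp.size, Nat.reduceAdd]; omega
  · rintro τ ⟨⟨⟨r, v, p, j, hv, hj, hvr, hp, hr, hjk, hcost, hcnt⟩, hcond⟩, hf⟩
    simp only [BExp.Holds, NExp.eval, hv, (hI.of_frame hf (by decide)).target, not_not] at hcond
    obtain rfl : v = G.t := Fin.ext (le_antisymm hcond.1 hcond.2)
    refine ⟨p, hp, by omega, ?_, hcnt⟩
    obtain ⟨q, hq, -, hqc⟩ := hn.exists_budgetDist hvr j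
    have := G.walkCost_nonneg q
    linarith

end

/-! ## Optimal configurations for a global budget -/

section

variable {n m : ℕ} {G : TaskGraph n m} {b : ℝ} {k : ℕ} {need : Fin m → ℕ}

/-- The agent follows `p` when exactly its edges get their guiding chunkings, so its cost is that of
`p`. Any other admissible configuration yields a walk that costs at most as much as its route and
needs at most as many chunks as it uses, so `p` is at least as cheap. -/
lemma TaskGraph.isOptimalConfig_of_walk (hb : 1 < b) {xs : Fin m → List ℝ}
    (hneed : ∀ e, IsNeed G b k e (need e) (xs e)) (hlen : ∀ e, (xs e).length = need e)
    {p : List (Fin m)} (hp : G.IsWalk G.s p G.t) (hpk : walkNeed need p ≤ k)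
    (hcost : G.walkCost p ≤ budgetDist G need G.s k) {cfg : ChunkConfig m}
    (hcfg : ∀ e, cfg e = if e ∈ p then xs e else []) : G.IsOptimalConfig b k cfg := by
  have hnk : ∀ e ∈ p, need e ≤ k := fun e he =>
    (List.single_le_sum (fun _ _ => Nat.zero_le _) _ (List.mem_map_of_mem he)).trans hpk
  have hguide : ∀ e ∈ p, cfg e ≠ [] →
      IsChunking (G.cost e) (need e) (cfg e) ∧ G.IsGuiding b e (cfg e) := by
    intro e he hne
    rw [hcfg, if_pos he] at hne ⊢
    refine (hneed e).chunking ?_ (hnk e he)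
    rw [← hlen]
    exact List.length_pos_of_ne_nil hne
  have hch : G.IsChunkedBy cfg := by
    intro e hne
    by_cases he : e ∈ p
    · have := (hguide e he hne).1
      exact ⟨rfl, this.2⟩
    · rw [hcfg, if_neg he] at hne
      exact absurd rfl hne
  have hsum : ∀ q : List (Fin m), q.Nodup → ∀ f : Fin m → ℕ,
      walkNeed f q = ∑ e ∈ q.toFinset, f e := fun q hq f => (List.sum_toFinset f hq).symm
  have hadm : G.Admissible k cfg := by
    refine ⟨hch, le_trans (le_of_eq ?_) hpk⟩
    rw [hsum p (G.acyclic.nodup hp) need,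
      ← Finset.sum_subset (Finset.subset_univ p.toFinset) (fun e _ he => ?_)]
    · refine Finset.sum_congr rfl fun e he => ?_
      rw [hcfg, if_pos (List.mem_toFinset.1 he), hlen]
    · rw [hcfg, if_neg (fun h => he (List.mem_toFinset.2 h)), List.length_nil]
  have hwalk : ∀ e ∈ p, cfg e = [] ∧ G.IsDefault b e ∨ cfg e ≠ [] ∧ G.IsGuiding b e (cfg e) := by
    intro e he
    by_cases hne : cfg e = []
    · left
      refine ⟨hne, ?_⟩
      rw [hcfg, if_pos he] at hne
      have h0 : need e = 0 := by rw [← hlen, hne, List.length_nil]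
      refine (((hneed e).guides 0 (Nat.zero_le _)).2 h0.le).2.resolve_right ?_
      rintro ⟨h, -⟩
      omega
    · exact Or.inr ⟨hne, (hguide e he hne).2⟩
  -- Acyclicity: the walk leaves each vertex at most once, so no sibling of one of its edges is
  -- chunked.
  have hsib : ∀ e ∈ p, ∀ f, G.src f = G.src e → f ≠ e → cfg f = [] := by
    intro e he f hf hfe
    rw [hcfg, if_neg]
    intro hfp
    exact hfe (List.inj_on_of_nodup_map (G.acyclic.nodup_src hp) hfp he hf)
  obtain ⟨q, hq, hqc⟩ := G.exists_route_of_walk (b := b) hch hp hwalk hsib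
  refine ⟨hadm, q, hq, fun cfg' p' hadm' hp' => ?_⟩
  -- Each edge of `r` is guided by the chunks that `cfg'` spends on it, hence needs at most that
  -- many; `r` repeats no edge, so its total need is within the budget.
  obtain ⟨r, hr, hrc, hrg⟩ := exists_walk_of_route hb.le hadm'.1 hp'
  rw [hqc]
  refine hcost.trans (le_trans (budgetDist_le hr ?_) hrc)
  rw [hsum r (G.acyclic.nodup hr)]
  refine le_trans (Finset.sum_le_sum (g := fun e => (cfg' e).length) fun e he => ?_)
    (le_trans (Finset.sum_le_sum_of_subset (Finset.subset_univ _)) hadm'.2)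
  refine ((hneed e).guides _ ?_).1 (hrg e (List.mem_toFinset.1 he))
  exact (Finset.single_le_sum (f := fun e => (cfg' e).length) (fun _ _ => Nat.zero_le _)
    (Finset.mem_univ e)).trans hadm'.2

/-- Sorts the edges topologically. -/
def sortEdges : Cmd :=
  linkLoop ;;
  (.setNat 5 (.lit 0) ;; .setNat 6 (.lit 0) ;; .setNat 7 (.lit 0)) ;;
  queueLoop ;;
  (.setNat 8 (.lit 0) ;; .setNat 9 (.lit 0) ;; .setNat 10 (.lit 0)) ;;
  sortLoop

/-- Computes an optimal configuration. -/
def optimizer : Cmd :=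
  sortEdges ;;
  -- Initially only the target is marked as leading to the target.
  (.setNat 5 (.lit 0) ;; .putNat 9 (.var 4) (.lit 1)) ;;
  relaxLoop ;;
  (.setNat 5 (.lit 0) ;; .setNat 6 (.lit 0)) ;;
  needLoop ;;
  .setNat 5 (.lit 0) ;;
  tableLoop ;;
  (.setNat 5 (.var 3) ;; .setNat 6 (.var 2)) ;;
  traceLoop

lemma halts_sortEdges {sub : Store → Store → ℕ → Prop} (G : TaskGraph n m) (b : ℝ) (k : ℕ) :
    Halts sub sortEdges (inputStore G b k) (160 * m + 160 * n + 100) 0 fun τ =>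
      (∃ done, HasOrder G (τ.natArr 8) done) ∧ ∀ v : Fin n, τ.natArr 11 v = v * (k + 1) := by
  have hI := hasInput_inputStore G b k
  refine Halts.mono (T := (60 * m + 6) + (10 + ((60 * n + 6) + (10 + ((m + n) * 100 + 20)))))
    (K := 0 + (0 + (0 + (0 + 0)))) (Halts.andThen
    (halts_linkLoop hI (by simp [inputStore]) (by simp [inputStore]) (by simp [inputStore])) ?_)
    (by omega) le_rfl fun _ h => h
  rintro σ₁ ⟨hdeg, hlist⟩ hf₁
  replace hI := hI.of_frame hf₁ (by decide)
  refine Halts.andThen (P' := fun τ => τ.nat 5 = 0 ∧ τ.nat 6 = 0 ∧ τ.nat 7 = 0)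
    (Halts.of_wp_frame (by simp [Cmd.wp, NExp.eval]) (by decide) fun _ h _ => h) ?_
  rintro σ₂ ⟨h5, h6, h7⟩ hf₂
  replace hI := hI.of_frame hf₂ (by decide)
  rw [← hf₂.natArr 4 (by decide)] at hdeg
  rw [← hf₂.natArr 5 (by decide), ← hf₂.natArr 6 (by decide)] at hlist
  refine Halts.andThen (halts_queueLoop hI h5 h6 h7) ?_
  rintro σ₃ ⟨hbase, todo, hq, hnd, hlen, hmem⟩ hf₃
  replace hI := hI.of_frame hf₃ (by decide)
  rw [← hf₃.natArr 4 (by decide)] at hdeg hmem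
  rw [← hf₃.natArr 5 (by decide), ← hf₃.natArr 6 (by decide)] at hlist
  refine Halts.andThen (P' := fun τ => τ.nat 8 = 0 ∧ τ.nat 9 = 0 ∧ τ.nat 10 = 0)
    (Halts.of_wp_frame (by simp [Cmd.wp, NExp.eval]) (by decide) fun _ h _ => h) ?_
  rintro σ₄ ⟨h8, h9, h10⟩ hf₄
  replace hI := hI.of_frame hf₄ (by decide)
  rw [← hf₄.natArr 4 (by decide)] at hdeg hmem
  rw [← hf₄.natArr 5 (by decide), ← hf₄.natArr 6 (by decide)] at hlist
  rw [← hf₄.natArr 7 (by decide)] at hq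
  rw [← hf₄.nat 6 (by decide)] at hlen
  rw [← hf₄.natArr 11 (by decide)] at hbase
  refine (halts_sortLoop hI h8 h9 h10 hdeg hlist hq hnd hlen hmem).frame.mono le_rfl le_rfl ?_
  rintro σ₅ ⟨ho, hf₅⟩
  rw [← hf₅.natArr 11 (by decide)] at hbase
  exact ⟨ho, hbase⟩

lemma halts_optimizer {A : Cmd} {C : ℕ} (hA : ChunksInTime A C) (G : TaskGraph n m) (hb : 1 < b)
    (hk : 2 ≤ k) :
    Halts (asSub A) optimizer (inputStore G b k)
      (m * ((Nat.log 2 k + 1) * (50 + C * k) + C * k + 30 * k + 100) +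
        m * (60 * (k + 1) + 50) + 400 * m + 200 * n + 200)
      (m * (Nat.log 2 k + 2)) fun τ => G.IsOptimalConfig b k (outputConfig m τ) := by
  have hI := hasInput_inputStore G b k
  refine Halts.mono (T := (160 * m + 160 * n + 100) + (10 + ((110 * m + 6) + (10 +
      ((m * ((Nat.log 2 k + 1) * (50 + C * k) + C * k + 30 * k + 100) + 6) + (5 +
      ((m * (60 * (k + 1) + 50) + 6) + (10 + (60 * m + 10)))))))))
    (K := 0 + (0 + (0 + (0 + (m * (Nat.log 2 k + 2) + (0 + (0 + (0 + 0))))))))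
    (Halts.andThen (halts_sortEdges G b k) ?_) (by omega) (by omega) fun _ h => h
  rintro σ₁ ⟨⟨done, ho⟩, hbase⟩ hf₁
  replace hI := hI.of_frame hf₁ (by decide)
  -- The initial zeros carry meaning: nothing reachable yet, distance and table cost `0` at the
  -- target, no edge chosen in the table, no edge chunked.
  have z9 : σ₁.natArr 9 = fun _ => 0 := (hf₁.natArr 9 (by decide)).trans (by simp [inputStore])
  have z2 : σ₁.realArr 2 = fun _ => 0 := (hf₁.realArr 2 (by decide)).trans (by simp [inputStore])
  have z5 : σ₁.realArr 5 = fun _ => 0 := (hf₁.realArr 5 (by decide)).trans (by simp [inputStore])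
  have z13 : σ₁.natArr 13 = fun _ => 0 := (hf₁.natArr 13 (by decide)).trans (by simp [inputStore])
  have zc : σ₁.natArr 2 = fun _ => 0 := (hf₁.natArr 2 (by decide)).trans (by simp [inputStore])
  refine Halts.andThen (P' := fun τ => τ.nat 5 = 0 ∧ ∀ v : Fin n, τ.natArr 9 v =
    if v = G.t then 1 else 0) (Halts.of_wp_frame ?_ (by decide) fun _ h _ => h) ?_
  · simp only [Cmd.wp, NExp.eval, Store.nat_putNat, Store.nat_setNat, Store.natArr_putNat,
      Store.natArr_setNat, Nat.reduceEqDiff, if_true, if_false, hI.target, z9, true_and]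
    intro v
    simp [Function.update_apply, Fin.ext_iff]
  rintro σ₂ ⟨h5, h9⟩ hf₂
  replace hI := hI.of_frame hf₂ (by decide)
  rw [← hf₂.natArr 8 (by decide)] at ho
  rw [← hf₂.natArr 11 (by decide)] at hbase
  rw [← hf₂.realArr 2 (by decide)] at z2
  rw [← hf₂.realArr 5 (by decide)] at z5
  rw [← hf₂.natArr 13 (by decide)] at z13
  rw [← hf₂.natArr 2 (by decide)] at zc
  refine Halts.andThen (halts_relaxLoop hI h5 ho h9 fun v => by rw [z2]) ?_
  intro σ₃ hd hf₃
  replace hI := hI.of_frame hf₃ (by decide)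
  rw [← hf₃.natArr 8 (by decide)] at ho
  rw [← hf₃.natArr 11 (by decide)] at hbase
  rw [← hf₃.realArr 5 (by decide)] at z5
  rw [← hf₃.natArr 13 (by decide)] at z13
  rw [← hf₃.natArr 2 (by decide)] at zc
  refine Halts.andThen (P' := fun τ => τ.nat 5 = 0)
    (Halts.of_wp_frame (by simp [Cmd.wp, NExp.eval]) (by decide) fun _ h _ => h) ?_
  intro σ₄ h5 hf₄
  replace hI := hI.of_frame hf₄ (by decide)
  replace hd := hd.congr (hf₄.natArr 9 (by decide)) (hf₄.natArr 10 (by decide))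
    (hf₄.realArr 2 (by decide)) (hf₄.realArr 3 (by decide))
  rw [← hf₄.natArr 8 (by decide)] at ho
  rw [← hf₄.natArr 11 (by decide)] at hbase
  rw [← hf₄.realArr 5 (by decide)] at z5
  rw [← hf₄.natArr 13 (by decide)] at z13
  rw [← hf₄.natArr 2 (by decide)] at zc
  refine Halts.andThen (halts_needLoop hA hb hk hI hd h5) ?_
  intro σ₅ hneed hf₅
  replace hI := hI.of_frame hf₅ (by decide)
  rw [← hf₅.natArr 8 (by decide)] at ho
  rw [← hf₅.natArr 11 (by decide)] at hbase
  rw [← hf₅.realArr 5 (by decide)] at z5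
  rw [← hf₅.natArr 13 (by decide)] at z13
  rw [← hf₅.natArr 2 (by decide)] at zc
  obtain ⟨need, hneed12⟩ : ∃ need : Fin m → ℕ, ∀ e : Fin m, σ₅.natArr 12 e = need e :=
    ⟨_, fun _ => rfl⟩
  have hN : ∀ e, IsNeed G b k e (need e)
      (readList (σ₅.realArr 1) (σ₅.natArr 3 e) (need e)) := by
    intro e
    have := hneed e
    rwa [hneed12 e] at this
  have hfree : FreeDefault G b need := by
    intro e he
    have := ((hN e).guides 0 (Nat.zero_le _)).1 ⟨he.1.1.2, Or.inl he⟩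
    omega
  have hreach : ∀ e, need e ≤ k → G.Reaches (G.dst e) G.t := fun e he =>
    (((hN e).guides _ he).2 le_rfl).1
  refine Halts.andThen (P' := fun τ => τ.nat 5 = 0)
    (Halts.of_wp_frame (by simp [Cmd.wp, NExp.eval]) (by decide) fun _ h _ => h) ?_
  intro σ₆ h5 hf₆
  replace hI := hI.of_frame hf₆ (by decide)
  rw [← hf₆.natArr 8 (by decide)] at ho
  rw [← hf₆.natArr 11 (by decide)] at hbase
  rw [← hf₆.natArr 12 (by decide)] at hneed12
  rw [← hf₆.realArr 5 (by decide)] at z5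
  rw [← hf₆.natArr 13 (by decide)] at z13
  rw [← hf₆.natArr 2 (by decide)] at zc
  rw [← hf₆.natArr 3 (by decide), ← hf₆.realArr 1 (by decide)] at hN
  refine Halts.andThen (halts_tableLoop hI hfree hreach h5 ho hbase hneed12
    (fun i => by rw [z13]) (fun i => by rw [z5])) ?_
  intro σ₇ ht hf₇
  replace hI := hI.of_frame hf₇ (by decide)
  rw [← hf₇.natArr 11 (by decide)] at hbase
  rw [← hf₇.natArr 12 (by decide)] at hneed12
  rw [← hf₇.natArr 2 (by decide)] at zc
  rw [← hf₇.natArr 3 (by decide), ← hf₇.realArr 1 (by decide)] at hN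
  refine Halts.andThen (P' := fun τ => τ.nat 5 = G.s ∧ τ.nat 6 = k)
    (Halts.of_wp_frame (by simp [Cmd.wp, NExp.eval, hI.start, hI.budget]) (by decide)
      fun _ h _ => h) ?_
  rintro σ₈ ⟨h5, h6⟩ hf₈
  replace hI := hI.of_frame hf₈ (by decide)
  replace ht : HasTable G k need done σ₈ := by
    unfold HasTable
    rw [hf₈.natArr 13 (by decide), hf₈.realArr 5 (by decide)]
    exact ht
  rw [← hf₈.natArr 11 (by decide)] at hbase
  rw [← hf₈.natArr 12 (by decide)] at hneed12
  rw [← hf₈.natArr 2 (by decide)] at zc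
  rw [← hf₈.natArr 3 (by decide), ← hf₈.realArr 1 (by decide)] at hN
  refine (halts_traceLoop hI hfree hreach ho.mem ht hbase hneed12 (fun e => by rw [zc]) h5
    h6).frame.mono le_rfl le_rfl ?_
  rintro σ₉ ⟨⟨p, hp, hpk, hcost, hcnt⟩, hf₉⟩
  rw [← hf₉.natArr 3 (by decide), ← hf₉.realArr 1 (by decide)] at hN
  refine G.isOptimalConfig_of_walk hb hN (fun e => by simp) hp hpk hcost fun e => ?_
  rw [outputConfig, hcnt]
  split_ifs <;> rfl

end

theorem mainTheorem4 :
    (∃ A : Cmd, IsEdgeChunker A) ∧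
    ∃ (Q : Cmd) (C₁ : ℝ), ∀ A : Cmd, IsEdgeChunker A →
      ∃ C₂ : ℝ, ∀ (n m k : ℕ) (G : TaskGraph n m) (b : ℝ), 1 < b → 2 ≤ k →
        ∃ (σ : Store) (time calls : ℕ),
          Run (asSub A) Q (inputStore G b k) σ time calls ∧
          G.IsOptimalConfig b k (outputConfig m σ) ∧
          (calls : ℝ) ≤ C₁ * (m * Real.log k) ∧
          (time : ℝ) ≤ C₂ * (m * k * Real.log k + n) := by
  -- The constant `6`: there are at most `Nat.log 2 k + 2 ≤ 3 * Nat.log 2 k` calls per edge, and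
  -- `Nat.log 2 k ≤ 2 * Real.log k`.
  refine ⟨⟨edgeChunker, isEdgeChunker_edgeChunker⟩, optimizer, 6, fun A hA => ?_⟩
  obtain ⟨C, hC⟩ := hA.exists_chunksInTime
  refine ⟨2 * ((3 * C + 1000 : ℕ) : ℝ), fun n m k G b hb hk => ?_⟩
  obtain ⟨σ, time, calls, hrun, htime, hcalls, hopt⟩ := halts_optimizer hC G hb hk
  refine ⟨σ, time, calls, hrun, hopt, ?_, ?_⟩
  all_goals
    have hL1 : 1 ≤ Nat.log 2 k := Nat.log_pos (by omega) hk
    -- The factor `2` is due to `Real.log 2 > 1 / 2`.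
    have hlog : (Nat.log 2 k : ℝ) ≤ 2 * Real.log k := by
      have h1 := Real.natLog_le_logb k 2
      rw [Real.logb, le_div_iff₀ (Real.log_pos (by norm_num))] at h1
      have h2 : (0 : ℝ) ≤ Nat.log 2 k := Nat.cast_nonneg _
      have h3 := Real.log_two_gt_d9
      push_cast at h1
      nlinarith
    generalize Nat.log 2 k = L at *
  · have h1 : calls ≤ 3 * (m * L) := by
      refine hcalls.trans ?_
      calc m * (L + 2) ≤ m * (3 * L) := Nat.mul_le_mul_left _ (by omega)
        _ = _ := by ring
    calc (calls : ℝ) ≤ ((3 * (m * L) : ℕ) : ℝ) := by exact_mod_cast h1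
      _ = 3 * (m * (L : ℝ)) := by push_cast; ring
      _ ≤ 3 * (m * (2 * Real.log k)) := by gcongr
      _ = _ := by ring
  · have hn : 1 ≤ n := by have := G.s.2; omega
    have hkL : k ≤ k * L := Nat.le_mul_of_pos_right _ hL1
    have hLk : L ≤ k * L := Nat.le_mul_of_pos_left _ (by omega)
    have hCk : C * k ≤ C * (k * L) := Nat.mul_le_mul_left _ hkL
    have h1 : time ≤ (3 * C + 1000) * (m * (k * L) + n) := by
      refine htime.trans ?_
      have e1 : (L + 1) * (50 + C * k) = 50 * L + 50 + C * (k * L) + C * k := by ring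
      have e2 : (L + 1) * (50 + C * k) + C * k + 30 * k + 100 ≤ (3 * C + 230) * (k * L) := by
        rw [e1, add_mul, mul_assoc]
        omega
      have e3 : 60 * (k + 1) + 50 ≤ 170 * (k * L) := by omega
      have e4 : m ≤ m * (k * L) := Nat.le_mul_of_pos_right _ (by omega)
      have e5 := Nat.mul_le_mul_left m e2
      have e6 := Nat.mul_le_mul_left m e3
      have e7 : m * ((3 * C + 230) * (k * L)) = 3 * (C * (m * (k * L))) + 230 * (m * (k * L)) := by
        ring
      have e8 : m * (170 * (k * L)) = 170 * (m * (k * L)) := by ring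
      have e9 : (3 * C + 1000) * (m * (k * L) + n) =
          3 * (C * (m * (k * L))) + 1000 * (m * (k * L)) + 3 * (C * n) + 1000 * n := by ring
      rw [e7] at e5
      rw [e8] at e6
      rw [e9]
      omega
    calc (time : ℝ) ≤ (((3 * C + 1000) * (m * (k * L) + n) : ℕ) : ℝ) := by exact_mod_cast h1
      _ = ((3 * C + 1000 : ℕ) : ℝ) * (m * (k * (L : ℝ)) + n) := by push_cast; ring
      _ ≤ ((3 * C + 1000 : ℕ) : ℝ) * (m * (k * (2 * Real.log k)) + 2 * n) := by
        gcongr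
        have : (0 : ℝ) ≤ n := Nat.cast_nonneg n
        linarith
      _ = _ := by ring
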